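/- **Setting.** Let $\mathbb K=\mathbb R$ or $\mathbb C$, let $p_1\ge 1$ and $p_2\ge 3$ be integers and $0\ne g\in\mathbb K$. For a matrix $A$ let $A_-$, $A_{(-)}$, $A_{(+)}$ be its strictly lower, lower (with diagonal) and upper (with diagonal) triangular parts. The times are $t=(t_1,\dots,t_{p_1})$ and $\tilde t=(\tilde t_1,\dots,\tilde t_{p_2})$; put $\alpha_s=-\frac{s+1}{g}\tilde t_{s+1}$ $(0\le s\le p_2-1)$ and $\beta_r=-\frac{r+1}{g}t_{r+1}$ $(0\le r\le p_1-1)$. $Q,\widetilde Q$ denote semi-infinite matrices $(n,m\ge0)$ with $Q_{n,n+1}=1$, $Q_{nm}=0$ for $m-n\ge2$ or $n-m\ge p_2$; $\widetilde Q_{n+1,n}\neq0$, $\widetilde Q_{nm}=0$ for $n-m\ge 2$ or $m-n\ge p_1$; their entries are differentiable functions of $(t,\tilde t)$. The *constrained Toda lattice system* consists of the flows $$\partial_{t_r}Q=[Q^r_{(+)},Q],\quad \partial_{\tilde t_s}Q=[Q,\widetilde Q^s_-],\quad \partial_{t_r}\widetilde Q=[Q^r_{(+)},\widetilde Q],\quad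 \partial_{\tilde t_s}\widetilde Q=[\widetilde Q,\widetilde Q^s_-]\qquad(1\le r\le p_1,\ 1\le s\le p_2)$$ and the string equations $$\text{(a)}\ 1=-g[Q,\widetilde Q],\qquad \text{(b)}\ Q_{(-)}=\sum_{s=0}^{p_2-1}\alpha_s\widetilde Q^s_{(-)},\qquad \text{(c)}\ \widetilde Q_{(+)}=\sum_{r=0}^{p_1-1}\beta_rQ^r_{(+)} .$$ **Change of times.** Given $a\ne0$ with $a^{p_2-1}=\alpha_{p_2-1}$, let $\gamma_{s\sigma}$ be the coefficient of $z^\sigma$ in the expansion at $z=\infty$ of $\bigl(\sum_{j=0}^{p_2-1}\alpha_jz^j\bigr)^{s/(p_2-1)}=a^sz^s(1+O(z^{-1}))$; so $\gamma_{11}=a$. The times $\hat t=(\hat t_1,\dots,\hat t_{p_2})$, $\hat t_{p_2}\ne0$, are introduced by a differentiable map $\tilde t=T(\hat t)$ on an open set with $$\frac{\partial}{\partial\hat t_s}=\sum_{\sigma=1}^s\gamma_{s\sigma}\frac{\partial}{\partial\tilde t_\sigma}\quad(1\le s\le p_2),\qquad a^{-1}=\gamma_{11}^{-1}=\frac{p_2}{g(p_2-1)}\hat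 t_{p_2},\qquad a^{p_2-1}=\alpha_{p_2-1}. \tag{1}$$ Moreover set $\hat t_{r(p_2-1)}:=t_r$ for $r=2,\dots,p_1$. **Fractional power.** Continue $\widetilde Q$ to a $\mathbb Z\times\mathbb Z$ matrix $\widetilde Q^{\rm ext}$ by $\widetilde Q^{\rm ext}_{n,n-1}=1$ for $n\le 0$ and by $0$ at all other positions $(n,m)$ with $n<0$ or $m<0$; continue $Q$ to $Q^{\rm ext}$ by the entries of $\sum_s\alpha_s(\widetilde Q^{\rm ext})^s$ at positions with $n<0$ or $m<0$. A fractional power $\widehat Q=Q^{1/(p_2-1)}$ is a $\mathbb Z\times\mathbb Z$ matrix with $\widehat Q_{nm}=0$ for $n-m\ge2$, $\widehat Q^{\,p_2-1}=Q^{\rm ext}$ and, on the block $n,m\ge0$, $$\widehat Q^s_{(-)}=\sum_{\sigma=0}^s\gamma_{s\sigma}\widetilde Q^\sigma_{(-)}\quad(0\le s\le p_2-1),\qquad \widehat Q^{p_2}_{-}=\sum_{\sigma=0}^{p_2}\gamma_{p_2\sigma}\widetilde Q^\sigma_{-}.$$ $Q^{s/(p_2-1)}_-$ denotes the strictly lower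 part of the block $n,m\ge0$ of $\widehat Q^s$. **Proposition.** 1. A map $T$ with (1) exists on $\{\hat t:\hat t_{p_2}\ne0\}$, and can be chosen so that for every $\tilde t$ and every $a\neq0$ with $a^{p_2-1}=\alpha_{p_2-1}$ there is exactly one $\hat t$ with $\hat t_{p_2}\ne0$, $T(\hat t)=\tilde t$ and $\gamma_{11}=a$. 2. Let $T$ be any map as in (1) on an open set $W$, let $\hat\Omega$ be an open set of times $(t,\hat t)$ with $\hat t\in W$, and let $\Omega$ be its image under $(t,\hat t)\mapsto(t,T(\hat t))$. Let $Q,\widetilde Q$ be as above on $\Omega$ and satisfy there (b) and (c). Then a fractional power $\widehat Q=Q^{1/(p_2-1)}$ exists at every point of $\hat\Omega$, $\widetilde Q$ is expressed through $Q$ by $$\widetilde Q=\gamma_{11}^{-1}\,Q^{1/(p_2-1)}_-+\sum_{r=0}^{p_1-1}\beta_rQ^r_{(+)},$$ and the following are equivalent: * $(Q,\widetilde Q)$ satisfies all the Toda flows and the string equation (a) on $\Omega$ (hence the whole constrained Toda lattice system); * $Q$, as a function of $(t,\hat t)\in\hat\Omega$, satisfies the flow equations $$\frac{\partial Q}{\partial\hat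 t_s}=\bigl[Q,\,Q^{s/(p_2-1)}_-\bigr],\qquad s=1,\dots,p_2,\,2(p_2-1),\,3(p_2-1),\dots,\,p_1(p_2-1),$$ and the string equations $$\frac{\partial Q}{\partial t_1}=\frac{\partial Q}{\partial\hat t_{p_2-1}},\qquad \Bigl(\sum_{r=1}^{p_1-1}(r+1)t_{r+1}\frac{\partial}{\partial t_r}+\frac{p_2}{p_2-1}\hat t_{p_2}\frac{\partial}{\partial\hat t_1}\Bigr)Q=-1 .$$ -/

import Mathlib

namespace TwoMatrix

noncomputable section

section MatrixCalculus

variable {ι 𝕜 : Type*} [LinearOrder ι] [RCLike 𝕜]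

/-- Product of infinite matrices, `(A B)_{nm} = ∑_k A_{nk} B_{km}`. For matrices with finitely many
nonzero diagonals below the main one (or, over `ℕ`, with finite rows) every sum is finite. -/
def lmul (A B : Matrix ι ι 𝕜) : Matrix ι ι 𝕜 :=
  Matrix.of fun n m => ∑ᶠ k, A n k * B k m

/-- Powers for the product `lmul`. -/
def lpow (A : Matrix ι ι 𝕜) : ℕ → Matrix ι ι 𝕜
  | 0 => 1
  | s + 1 => lmul (lpow A s) A

/-- The commutator `[A, B] = A B - B A`. -/
def lcomm (A B : Matrix ι ι 𝕜) : Matrix ι ι 𝕜 := lmul A B - lmul B A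

/-- `A_-`: the strictly lower triangular part. -/
def strictLower (A : Matrix ι ι 𝕜) : Matrix ι ι 𝕜 :=
  Matrix.of fun n m => if m < n then A n m else 0

/-- `A_{(-)}`: the lower triangular part, main diagonal included. -/
def lowerDiag (A : Matrix ι ι 𝕜) : Matrix ι ι 𝕜 :=
  Matrix.of fun n m => if m ≤ n then A n m else 0

/-- `A_{(+)}`: the upper triangular part, main diagonal included. -/
def upperDiag (A : Matrix ι ι 𝕜) : Matrix ι ι 𝕜 :=
  Matrix.of fun n m => if n ≤ m then A n m else 0

end MatrixCalculus

section Times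

variable {𝕜 : Type*} [RCLike 𝕜]

/-- The time with (one-based) label `r`, for `1 ≤ r ≤ p`. -/
def tm {p : ℕ} (t : Fin p → 𝕜) (r : ℕ) : 𝕜 :=
  if h : 1 ≤ r ∧ r ≤ p then t ⟨r - 1, by omega⟩ else 0

/-- The coordinate direction of the time with (one-based) label `r`. -/
def dir (𝕜 : Type*) [RCLike 𝕜] (p r : ℕ) : Fin p → 𝕜 :=
  fun i => if (i : ℕ) + 1 = r then 1 else 0

/-- The coupling coefficient `-((s+1)/g) t_{s+1}`. It is called `α_s` for the times of the second
matrix and `β_s` for those of the first one. -/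
def coupl {p : ℕ} (g : 𝕜) (t : Fin p → 𝕜) (s : ℕ) : 𝕜 :=
  -(((s + 1 : ℕ) : 𝕜) / g) * tm t (s + 1)

/-- The polynomial `ρ(w) = ∑_{i=1}^{k} (α_{k-i} / α_k) w^i`, so that
`∑_{s=0}^k α_s z^s = α_k z^k (1 + ρ(z⁻¹))`. -/
def rho (k : ℕ) (α : ℕ → 𝕜) : Polynomial 𝕜 :=
  ∑ i ∈ Finset.Icc 1 k, Polynomial.C (α (k - i) / α k) * Polynomial.X ^ i

/-- The generalized binomial coefficient `(s/k choose j)`. -/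
def fracBinom (𝕜 : Type*) [RCLike 𝕜] (s k j : ℕ) : 𝕜 :=
  (∏ i ∈ Finset.range j, ((s : 𝕜) / (k : 𝕜) - (i : 𝕜))) / (j.factorial : 𝕜)

/-- The coefficient `γ_{sσ}`: the coefficient of `z^σ` in the Laurent expansion at `z = ∞` of
`(∑_{j=0}^k α_j z^j)^{s/k} = a^s z^s (1 + ρ(z⁻¹))^{s/k}`, where `a` is the chosen `k`-th root
of `α_k`. In particular `γ_{11} = a`, and `γ_{kσ} = α_σ`. -/
def gam (k : ℕ) (a : 𝕜) (α : ℕ → 𝕜) (s σ : ℕ) : 𝕜 :=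
  if σ ≤ s then
    a ^ s * ∑ j ∈ Finset.range (s - σ + 1), fracBinom 𝕜 s k j * ((rho k α) ^ j).coeff (s - σ)
  else 0

/-- `γ_{11}` as a function of the times `θ = t̂`: `γ_{11}⁻¹ = p₂ t̂_{p₂} / (g (p₂ - 1))`. -/
def leading {p₂ : ℕ} (g : 𝕜) (θ : Fin p₂ → 𝕜) : 𝕜 :=
  g * ((p₂ : 𝕜) - 1) / ((p₂ : 𝕜) * tm θ p₂)

/-- `t̃ = T(t̂)` is the change of times on the open set `W`:
`∂/∂t̂_s = ∑_{σ=1}^s γ_{sσ} ∂/∂t̃_σ` for `1 ≤ s ≤ p₂`, with the integration constant of `t̂_{p₂}`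
fixed by `γ_{11}⁻¹ = p₂ t̂_{p₂} / (g (p₂ - 1))`, where `γ_{11}^{p₂-1} = α_{p₂-1}`. -/
structure IsHatTimes {p₂ : ℕ} (g : 𝕜) (T : (Fin p₂ → 𝕜) → (Fin p₂ → 𝕜))
    (W : Set (Fin p₂ → 𝕜)) : Prop where
  isOpen : IsOpen W
  ne_zero : ∀ θ ∈ W, tm θ p₂ ≠ 0
  differentiable : ∀ θ ∈ W, DifferentiableAt 𝕜 T θ
  normalized : ∀ θ ∈ W, leading g θ ^ (p₂ - 1) = coupl g (T θ) (p₂ - 1)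
  jacobian : ∀ θ ∈ W, ∀ s ∈ Finset.Icc 1 p₂, ∀ σ ∈ Finset.Icc 1 p₂,
    HasLineDerivAt 𝕜 (fun θ' => tm (T θ') σ)
      (gam (p₂ - 1) (leading g θ) (coupl g (T θ)) s σ) θ (dir 𝕜 p₂ s)

/-- `(t, t̂) ↦ (t, t̃)`. -/
def timeMap {p₁ p₂ : ℕ} (T : (Fin p₂ → 𝕜) → (Fin p₂ → 𝕜)) :
    (Fin p₁ → 𝕜) × (Fin p₂ → 𝕜) → (Fin p₁ → 𝕜) × (Fin p₂ → 𝕜) :=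
  fun x => (x.1, T x.2)

end Times

section FractionalPower

variable {𝕜 : Type*} [RCLike 𝕜]

/-- Continuation of the semi-infinite matrix `Q̃` to all lattice sites `n ∈ ℤ`: the free lattice
operator (one subdiagonal, normalized to `1`) is added at the sites `n ≤ 0`, that is,
`b_k(n) = 0` for `n < 0`. -/
def extTilde (Qt : Matrix ℕ ℕ 𝕜) : Matrix ℤ ℤ 𝕜 :=
  Matrix.of fun n m =>
    if 0 ≤ n ∧ 0 ≤ m then Qt n.toNat m.toNat else if m = n - 1 then 1 else 0

/-- The corresponding continuation of `Q`: it is `Q` on the sites `n, m ≥ 0`, and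
`∑_{s=0}^{p₂-1} α_s Q̃^s`, with the continued `Q̃`, elsewhere. -/
def extQ {p₂ : ℕ} (g : 𝕜) (tt : Fin p₂ → 𝕜) (Q Qt : Matrix ℕ ℕ 𝕜) : Matrix ℤ ℤ 𝕜 :=
  Matrix.of fun n m =>
    if 0 ≤ n ∧ 0 ≤ m then Q n.toNat m.toNat
    else ∑ s ∈ Finset.range p₂, coupl g tt s * lpow (extTilde Qt) s n m

/-- The semi-infinite block `n, m ≥ 0` of a lattice operator. -/
def block (A : Matrix ℤ ℤ 𝕜) : Matrix ℕ ℕ 𝕜 := Matrix.of fun n m => A (n : ℤ) (m : ℤ)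

/-- `Qh = Q̂` is the fractional power `Q^{1/(p₂-1)}`, with leading coefficient `a = γ_{11}`, of `Q`:
a lattice operator with one lower diagonal whose `(p₂-1)`-th power is `Q` (continued to all sites),
normalized by `Q̂^s_{(-)} = ∑_{σ=0}^s γ_{sσ} Q̃^σ_{(-)}` (for `s = p₂`: below the diagonal), which
selects one of the many matrix roots. -/
structure IsFracPower {p₂ : ℕ} (g a : 𝕜) (tt : Fin p₂ → 𝕜) (Q Qt : Matrix ℕ ℕ 𝕜)
    (Qh : Matrix ℤ ℤ 𝕜) : Prop where
  jacobi : ∀ n m : ℤ, m + 2 ≤ n → Qh n m = 0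
  root : lpow Qh (p₂ - 1) = extQ g tt Q Qt
  lower : ∀ s < p₂, lowerDiag (block (lpow Qh s)) =
    ∑ σ ∈ Finset.range (s + 1), gam (p₂ - 1) a (coupl g tt) s σ • lowerDiag (lpow Qt σ)
  lower_top : strictLower (block (lpow Qh p₂)) =
    ∑ σ ∈ Finset.range (p₂ + 1), gam (p₂ - 1) a (coupl g tt) p₂ σ • strictLower (lpow Qt σ)

end FractionalPower

section Systems

variable {𝕜 : Type*} [RCLike 𝕜] {p₁ p₂ : ℕ}

/-- The shape of the two semi-infinite Toda matrices. -/
structure IsTodaPair (p₁ p₂ : ℕ) (Q Qt : Matrix ℕ ℕ 𝕜) : Prop where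
  Q_one : ∀ n, Q n (n + 1) = 1
  Q_upper : ∀ n m, n + 2 ≤ m → Q n m = 0
  Q_lower : ∀ n m, m + p₂ ≤ n → Q n m = 0
  Qt_ne_zero : ∀ n, Qt (n + 1) n ≠ 0
  Qt_lower : ∀ n m, m + 2 ≤ n → Qt n m = 0
  Qt_upper : ∀ n m, n + p₁ ≤ m → Qt n m = 0

/-- The constraint
`Q_{(-)} = -∑_{s=1}^{p₂-1} ((s+1)/g) t̃_{s+1} Q̃^s_{(-)} - (1/g) t̃₁ 1`. -/
def CouplingQ (g : 𝕜) (tt : Fin p₂ → 𝕜) (Q Qt : Matrix ℕ ℕ 𝕜) : Prop :=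
  lowerDiag Q =
    -∑ s ∈ Finset.Icc 1 (p₂ - 1),
        ((((s + 1 : ℕ) : 𝕜) / g) * tm tt (s + 1)) • lowerDiag (lpow Qt s)
      - ((1 / g) * tm tt 1) • (1 : Matrix ℕ ℕ 𝕜)

/-- The constraint
`Q̃_{(+)} = -∑_{r=1}^{p₁-1} ((r+1)/g) t_{r+1} Q^r_{(+)} - (1/g) t₁ 1`. -/
def CouplingQt (g : 𝕜) (t : Fin p₁ → 𝕜) (Q Qt : Matrix ℕ ℕ 𝕜) : Prop :=
  upperDiag Qt =
    -∑ r ∈ Finset.Icc 1 (p₁ - 1),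
        ((((r + 1 : ℕ) : 𝕜) / g) * tm t (r + 1)) • upperDiag (lpow Q r)
      - ((1 / g) * tm t 1) • (1 : Matrix ℕ ℕ 𝕜)

/-- The matrix-valued function `A` has, at `x`, the entrywise derivative `X` in direction `v`. -/
def FlowAt {E : Type*} [NormedAddCommGroup E] [NormedSpace 𝕜 E] (A : E → Matrix ℕ ℕ 𝕜)
    (x v : E) (X : Matrix ℕ ℕ 𝕜) : Prop :=
  ∀ n m, HasLineDerivAt 𝕜 (fun y => A y n m) (X n m) x v

/-- The Toda lattice flows in the times `(t, t̃) ∈ Ω`, and the string equation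
`1 = -g [Q, Q̃]`. -/
structure TodaSystem (g : 𝕜) (Ω : Set ((Fin p₁ → 𝕜) × (Fin p₂ → 𝕜)))
    (Q Qt : (Fin p₁ → 𝕜) × (Fin p₂ → 𝕜) → Matrix ℕ ℕ 𝕜) : Prop where
  flow_Q_t : ∀ x ∈ Ω, ∀ r ∈ Finset.Icc 1 p₁,
    FlowAt Q x (dir 𝕜 p₁ r, 0) (lcomm (upperDiag (lpow (Q x) r)) (Q x))
  flow_Q_tt : ∀ x ∈ Ω, ∀ s ∈ Finset.Icc 1 p₂,
    FlowAt Q x (0, dir 𝕜 p₂ s) (lcomm (Q x) (strictLower (lpow (Qt x) s)))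
  flow_Qt_t : ∀ x ∈ Ω, ∀ r ∈ Finset.Icc 1 p₁,
    FlowAt Qt x (dir 𝕜 p₁ r, 0) (lcomm (upperDiag (lpow (Q x) r)) (Qt x))
  flow_Qt_tt : ∀ x ∈ Ω, ∀ s ∈ Finset.Icc 1 p₂,
    FlowAt Qt x (0, dir 𝕜 p₂ s) (lcomm (Qt x) (strictLower (lpow (Qt x) s)))
  string : ∀ x ∈ Ω, (1 : Matrix ℕ ℕ 𝕜) = -(g • lcomm (Q x) (Qt x))

/-- The direction of `∂/∂t̂_s` on the space of the times `(t, t̂)`, for `s = 1, …, p₂` and for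
`s = r (p₂ - 1)` with `2 ≤ r ≤ p₁`; in the latter case `t̂_{r(p₂-1)} ≡ t_r`. -/
def hatDir (𝕜 : Type*) [RCLike 𝕜] (p₁ p₂ s : ℕ) : (Fin p₁ → 𝕜) × (Fin p₂ → 𝕜) :=
  if s ≤ p₂ then (0, dir 𝕜 p₂ s) else (dir 𝕜 p₁ (s / (p₂ - 1)), 0)

/-- The system for the single matrix `Q`, as a function of the times `(t, t̂) ∈ Ωh`; `Qh` is
`Q̂ = Q^{1/(p₂-1)}`, so that `Q^{s/(p₂-1)}_-` is the strictly lower part of `Q̂^s`. -/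
structure HatSystem (Ωh : Set ((Fin p₁ → 𝕜) × (Fin p₂ → 𝕜)))
    (Q : (Fin p₁ → 𝕜) × (Fin p₂ → 𝕜) → Matrix ℕ ℕ 𝕜)
    (Qh : (Fin p₁ → 𝕜) × (Fin p₂ → 𝕜) → Matrix ℤ ℤ 𝕜) : Prop where
  flow : ∀ x ∈ Ωh, ∀ s : ℕ, (s ∈ Finset.Icc 1 p₂ ∨ ∃ r ∈ Finset.Icc 2 p₁, s = r * (p₂ - 1)) →
    FlowAt Q x (hatDir 𝕜 p₁ p₂ s) (lcomm (Q x) (strictLower (block (lpow (Qh x) s))))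
  string_one : ∀ x ∈ Ωh, ∀ n m,
    lineDeriv 𝕜 (fun y => Q y n m) x (dir 𝕜 p₁ 1, 0) =
      lineDeriv 𝕜 (fun y => Q y n m) x (hatDir 𝕜 p₁ p₂ (p₂ - 1))
  string_M : ∀ x ∈ Ωh, ∀ n m,
    ∑ r ∈ Finset.Icc 1 (p₁ - 1), ((r + 1 : ℕ) : 𝕜) * tm x.1 (r + 1) *
        lineDeriv 𝕜 (fun y => Q y n m) x (dir 𝕜 p₁ r, 0)
      + ((p₂ : 𝕜) / ((p₂ : 𝕜) - 1)) * tm x.2 p₂ *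
        lineDeriv 𝕜 (fun y => Q y n m) x (hatDir 𝕜 p₁ p₂ 1)
      = -((1 : Matrix ℕ ℕ 𝕜) n m)

end Systems

end

end TwoMatrix

namespace TwoMatrix

set_option linter.unusedSectionVars false

noncomputable section

/-! Matrices with finitely many diagonals below the main one form an associative algebra `Band`. It
is filtered by `Ord` (the lowest diagonal that may be nonzero), and the filtration is separated and
complete. Roots and inverses can therefore be built diagonal by diagonal, as for formal Laurent
series. Put k = p₂ - 1 and w = (∑ α_j z^j)^{1/k}.

Fractional power. Continued to ℤ, Q̃ becomes a matrix X whose subdiagonal vanishes nowhere, so X is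
invertible (`IsHess.exists_inverse`). Truncate w = a z π(1/z) to a polynomial π and put P = a X
π(X⁻¹). Then P^s agrees with ∑ γ_{sσ} X^σ up to strictly upper terms if s ≤ k, and below the
diagonal if s = k + 1 (`root_pow_sub_ord`). By (b), P^k agrees with the continued Q up to strictly
upper terms. `exists_root` removes this error: on each diagonal the linearized equation ∑ P^i V
P^{k-1-i} = error is a scalar recurrence of order k - 1 with nonzero extreme coefficients, which is
solvable on all of ℤ. The corrections lie on diagonals m - n ≥ k, too far up to disturb the
normalization. All continued matrices vanish from negative to nonnegative sites, so passing to the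
block is multiplicative and Q̂^{rk} restricts to Q^r.

Change of times. The times t̂ are, up to constants, the coefficients of z/w as a series Y in ε =
1/w. Lagrange inversion gives γ_{sσ} = [ε^{s-σ}] Y^{-σ-1}(Y - εY') (`gam_eq_coeff`). For s = k this
defines the α_σ, hence t̃, and differentiation in Y yields (1). The Jacobian is triangular with
diagonal a^s, so T can be inverted one coordinate at a time from the top.

Equivalence. Since Q commutes with Q^r, the t_r flow is generated by Q^r_-, which is Q^{rk/k}_-. The
strictly lower part of Q̂^s is ∑ γ_{sσ} Q̃^σ_-, so by the chain rule the flows of Q in t̂ and in t̃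
are equivalent. By (c) and Q̂_- = γ₁₁ Q̃_-, the operator in the second string equation applied to Q
is g[Q, Q̃]. What remains are the flows of Q̃, which the system for Q does not contain
(`flow_second`). Let D be the difference between the derivative of Q̃ and its expected value.
Differentiating (a) shows that D commutes with Q. Differentiating (c) shows that D vanishes on and
above the diagonal. A matrix that commutes with Q and has zero first row is zero. -/

/-- A set of lattice sites, each with an integer position. -/
class Site (ι : Type*) where
  pos : ι → ℤ
  pos_injective : Function.Injective pos

instance : Site ℕ := ⟨fun n => (n : ℤ), Nat.cast_injective⟩

instance : Site ℤ := ⟨fun n => n, fun _ _ h => h⟩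

/-! ### The filtered algebra of matrices with finitely many lower diagonals. -/

section Band

variable {ι 𝕜 : Type*} [LinearOrder ι] [Site ι] [RCLike 𝕜]

open Site (pos pos_injective)

@[simp] lemma pos_nat (n : ℕ) : pos n = (n : ℤ) := rfl

@[simp] lemma pos_int (n : ℤ) : pos n = n := rfl

/-- All entries of `A` more than `-d` below the main diagonal vanish. -/
def Ord (d : ℤ) (A : Matrix ι ι 𝕜) : Prop := ∀ n m, pos m < pos n + d → A n m = 0

lemma Ord.mono {d e : ℤ} {A : Matrix ι ι 𝕜} (h : Ord d A) (hed : e ≤ d) : Ord e A :=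
  fun n m hnm => h n m (by omega)

lemma Ord.add {d : ℤ} {A B : Matrix ι ι 𝕜} (hA : Ord d A) (hB : Ord d B) : Ord d (A + B) :=
  fun n m h => by simp [hA n m h, hB n m h]

lemma Ord.smul {d : ℤ} {A : Matrix ι ι 𝕜} (c : 𝕜) (hA : Ord d A) : Ord d (c • A) :=
  fun n m h => by simp [hA n m h]

lemma ord_zero (d : ℤ) : Ord d (0 : Matrix ι ι 𝕜) := fun _ _ _ => rfl

lemma ord_one : Ord 0 (1 : Matrix ι ι 𝕜) := fun n m h => by
  have : n ≠ m := by rintro rfl; omega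
  simp [Matrix.one_apply_ne this]

lemma finite_between (a b : ℤ) : {k : ι | a ≤ pos k ∧ pos k ≤ b}.Finite :=
  (Set.finite_Icc a b).preimage pos_injective.injOn

/-- The sites with position between `a` and `b`. -/
def sites (ι : Type*) [LinearOrder ι] [Site ι] (a b : ℤ) : Finset ι :=
  (finite_between (ι := ι) a b).toFinset

@[simp] lemma mem_sites {a b : ℤ} {k : ι} : k ∈ sites ι a b ↔ a ≤ pos k ∧ pos k ≤ b := by
  simp [sites]

/-- Only the sites with n + d ≤ k ≤ m - e contribute. The freedom to take any finite set containing
this window lets several products share one index set. -/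
lemma lmul_eq_sum {d e : ℤ} {A B : Matrix ι ι 𝕜} (hA : Ord d A) (hB : Ord e B) (n m : ι)
    (F : Finset ι) (hF : ∀ k, pos n + d ≤ pos k → pos k + e ≤ pos m → k ∈ F) :
    lmul A B n m = ∑ k ∈ F, A n k * B k m := by
  refine finsum_eq_sum_of_support_subset _ fun k hk => ?_
  by_contra hkF
  apply hk
  by_cases h1 : pos n + d ≤ pos k
  · by_cases h2 : pos k + e ≤ pos m
    · exact absurd (hF k h1 h2) hkF
    · simp [hB k m (by omega)]
  · simp [hA n k (by omega)]

lemma Ord.lmul {d e : ℤ} {A B : Matrix ι ι 𝕜} (hA : Ord d A) (hB : Ord e B) :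
    Ord (d + e) (lmul A B) := fun n m h => by
  rw [lmul_eq_sum hA hB n m ∅ (fun k h1 h2 => by omega), Finset.sum_empty]

lemma lmul_assoc {d e f : ℤ} {A B C : Matrix ι ι 𝕜} (hA : Ord d A) (hB : Ord e B) (hC : Ord f C) :
    lmul (lmul A B) C = lmul A (lmul B C) := by
  ext n m
  -- One window that serves the inner and outer sums alike, so that associativity is an exchange of
  -- finite sums. Where an inner sum could leave the window, its outer factor is zero.
  set N := |d| + |e| + |f|
  have hd := neg_abs_le d
  have he := neg_abs_le e
  have hf := neg_abs_le f
  have hd' := abs_nonneg d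
  have he' := abs_nonneg e
  have hf' := abs_nonneg f
  set F := sites ι (pos n - N) (pos m + N)
  rw [lmul_eq_sum (hA.lmul hB) hC n m F (fun k h1 h2 => by rw [mem_sites]; omega),
    lmul_eq_sum hA (hB.lmul hC) n m F (fun k h1 h2 => by rw [mem_sites]; omega)]
  have h1 : ∀ k ∈ F, TwoMatrix.lmul A B n k * C k m = ∑ l ∈ F, A n l * B l k * C k m := by
    intro k _
    by_cases hk : pos m < pos k + f
    · simp [hC k m hk]
    · rw [lmul_eq_sum hA hB n k F (fun l h1 h2 => by rw [mem_sites]; omega), Finset.sum_mul]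
  have h2 : ∀ l ∈ F, A n l * TwoMatrix.lmul B C l m = ∑ k ∈ F, A n l * B l k * C k m := by
    intro l _
    by_cases hl : pos l < pos n + d
    · simp [hA n l hl]
    · rw [lmul_eq_sum hB hC l m F (fun k h1 h2 => by rw [mem_sites]; omega), Finset.mul_sum]
      simp [mul_assoc]
  rw [Finset.sum_congr rfl h1, Finset.sum_congr rfl h2, Finset.sum_comm]

variable (ι 𝕜) in
/-- The space of matrices with finitely many nonzero diagonals below the main one. -/
def bandSubmodule : Submodule 𝕜 (Matrix ι ι 𝕜) where
  carrier := {A | ∃ d, Ord d A}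
  zero_mem' := ⟨0, ord_zero 0⟩
  add_mem' := by
    rintro A B ⟨d, hA⟩ ⟨e, hB⟩
    exact ⟨min d e, (hA.mono (min_le_left _ _)).add (hB.mono (min_le_right _ _))⟩
  smul_mem' := by
    rintro c A ⟨d, hA⟩
    exact ⟨d, hA.smul c⟩

variable (ι 𝕜) in
/-- The algebra of matrices with finitely many nonzero diagonals below the main one. -/
def Band : Type _ := bandSubmodule ι 𝕜

instance : AddCommGroup (Band ι 𝕜) := inferInstanceAs (AddCommGroup (bandSubmodule ι 𝕜))

instance : Module 𝕜 (Band ι 𝕜) := inferInstanceAs (Module 𝕜 (bandSubmodule ι 𝕜))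

/-- The underlying matrix. -/
def Band.val (A : Band ι 𝕜) : Matrix ι ι 𝕜 := Subtype.val A

lemma Band.ext {A B : Band ι 𝕜} (h : A.val = B.val) : A = B := Subtype.ext h

/-- A matrix of bounded order as an element of the algebra. -/
def Ord.band {d : ℤ} {A : Matrix ι ι 𝕜} (h : Ord d A) : Band ι 𝕜 := ⟨A, d, h⟩

@[simp] lemma Ord.val_band {d : ℤ} {A : Matrix ι ι 𝕜} (h : Ord d A) : h.band.val = A := rfl

lemma Band.exists_ord (A : Band ι 𝕜) : ∃ d, Ord d A.val := A.2

instance : Mul (Band ι 𝕜) :=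
  ⟨fun A B => ⟨lmul A.val B.val, _, A.exists_ord.choose_spec.lmul B.exists_ord.choose_spec⟩⟩

instance : One (Band ι 𝕜) := ⟨⟨1, 0, ord_one⟩⟩

@[simp] lemma Band.val_add (A B : Band ι 𝕜) : (A + B).val = A.val + B.val := rfl
@[simp] lemma Band.val_sub (A B : Band ι 𝕜) : (A - B).val = A.val - B.val := rfl
@[simp] lemma Band.val_smul (c : 𝕜) (A : Band ι 𝕜) : (c • A).val = c • A.val := rfl
@[simp] lemma Band.val_zero : (0 : Band ι 𝕜).val = 0 := rfl
@[simp] lemma Band.val_one : (1 : Band ι 𝕜).val = 1 := rfl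
@[simp] lemma Band.val_mul (A B : Band ι 𝕜) : (A * B).val = lmul A.val B.val := rfl

/-- `Band.val` as a linear map. -/
def Band.valₗ : Band ι 𝕜 →ₗ[𝕜] Matrix ι ι 𝕜 := (bandSubmodule ι 𝕜).subtype

@[simp] lemma Band.val_sum {σ : Type*} (s : Finset σ) (f : σ → Band ι 𝕜) :
    (∑ i ∈ s, f i).val = ∑ i ∈ s, (f i).val := map_sum Band.valₗ f s

lemma lmul_add' {d e : ℤ} {A B C : Matrix ι ι 𝕜} (hA : Ord d A) (hB : Ord e B) (hC : Ord e C) :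
    lmul A (B + C) = lmul A B + lmul A C := by
  ext n m
  have hF : ∀ k : ι, pos n + d ≤ pos k → pos k + e ≤ pos m → k ∈ sites ι (pos n + d) (pos m - e) :=
    fun k h1 h2 => by rw [mem_sites]; omega
  rw [Matrix.add_apply, lmul_eq_sum hA (hB.add hC) n m _ hF, lmul_eq_sum hA hB n m _ hF,
    lmul_eq_sum hA hC n m _ hF, ← Finset.sum_add_distrib]
  simp [mul_add]

lemma add_lmul' {d e : ℤ} {A B C : Matrix ι ι 𝕜} (hA : Ord d A) (hB : Ord d B) (hC : Ord e C) :
    lmul (A + B) C = lmul A C + lmul B C := by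
  ext n m
  have hF : ∀ k : ι, pos n + d ≤ pos k → pos k + e ≤ pos m → k ∈ sites ι (pos n + d) (pos m - e) :=
    fun k h1 h2 => by rw [mem_sites]; omega
  rw [Matrix.add_apply, lmul_eq_sum (hA.add hB) hC n m _ hF, lmul_eq_sum hA hC n m _ hF,
    lmul_eq_sum hB hC n m _ hF, ← Finset.sum_add_distrib]
  simp [add_mul]

lemma lmul_smul' (c : 𝕜) (A B : Matrix ι ι 𝕜) : lmul A (c • B) = c • lmul A B := by
  ext n m
  simp only [lmul, Matrix.of_apply, Matrix.smul_apply]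
  rw [smul_finsum]
  exact finsum_congr fun k => mul_smul_comm c (A n k) (B k m)

lemma smul_lmul' (c : 𝕜) (A B : Matrix ι ι 𝕜) : lmul (c • A) B = c • lmul A B := by
  ext n m
  simp only [lmul, Matrix.of_apply, Matrix.smul_apply]
  rw [smul_finsum]
  exact finsum_congr fun k => smul_mul_assoc c (A n k) (B k m)

lemma one_lmul' (A : Matrix ι ι 𝕜) : lmul 1 A = A := by
  ext n m
  simp only [lmul, Matrix.of_apply]
  rw [finsum_eq_single _ n fun k hk => by simp [Matrix.one_apply_ne' hk]]
  simp

lemma lmul_one' (A : Matrix ι ι 𝕜) : lmul A 1 = A := by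
  ext n m
  simp only [lmul, Matrix.of_apply]
  rw [finsum_eq_single _ m fun k hk => by simp [Matrix.one_apply_ne hk]]
  simp

lemma lmul_zero' (A : Matrix ι ι 𝕜) : lmul A 0 = 0 := by
  ext n m; simp [lmul]

lemma zero_lmul' (A : Matrix ι ι 𝕜) : lmul 0 A = 0 := by
  ext n m; simp [lmul]

instance : Ring (Band ι 𝕜) :=
  { (inferInstance : AddCommGroup (Band ι 𝕜)), (inferInstance : Mul (Band ι 𝕜)),
    (inferInstance : One (Band ι 𝕜)) with
    left_distrib := fun A B C => Band.ext <| by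
      obtain ⟨d, hA⟩ := A.exists_ord
      obtain ⟨e, hB⟩ := B.exists_ord
      obtain ⟨f, hC⟩ := C.exists_ord
      exact lmul_add' hA (hB.mono (min_le_left e f)) (hC.mono (min_le_right e f))
    right_distrib := fun A B C => Band.ext <| by
      obtain ⟨d, hA⟩ := A.exists_ord
      obtain ⟨e, hB⟩ := B.exists_ord
      obtain ⟨f, hC⟩ := C.exists_ord
      exact add_lmul' (hA.mono (min_le_left d e)) (hB.mono (min_le_right d e)) hC
    zero_mul := fun A => Band.ext (zero_lmul' A.val)
    mul_zero := fun A => Band.ext (lmul_zero' A.val)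
    mul_assoc := fun A B C => Band.ext <| by
      obtain ⟨d, hA⟩ := A.exists_ord
      obtain ⟨e, hB⟩ := B.exists_ord
      obtain ⟨f, hC⟩ := C.exists_ord
      exact lmul_assoc hA hB hC
    one_mul := fun A => Band.ext (one_lmul' A.val)
    mul_one := fun A => Band.ext (lmul_one' A.val)
    neg_add_cancel := fun A => neg_add_cancel A }

instance : Algebra 𝕜 (Band ι 𝕜) :=
  Algebra.ofModule (fun c A B => Band.ext (smul_lmul' c A.val B.val))
    (fun c A B => Band.ext (lmul_smul' c A.val B.val))

@[simp] lemma Band.val_pow (A : Band ι 𝕜) (s : ℕ) : (A ^ s).val = lpow A.val s := by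
  induction s with
  | zero => simp [lpow]
  | succ s ih => rw [pow_succ, Band.val_mul, ih]; rfl

lemma Band.val_comm (A B : Band ι 𝕜) : (A * B - B * A).val = lcomm A.val B.val := rfl

lemma Ord.sub {d : ℤ} {A B : Matrix ι ι 𝕜} (hA : Ord d A) (hB : Ord d B) : Ord d (A - B) :=
  fun n m h => by simp [hA n m h, hB n m h]

lemma Ord.sum {σ : Type*} {d : ℤ} {s : Finset σ} {f : σ → Matrix ι ι 𝕜}
    (h : ∀ i ∈ s, Ord d (f i)) : Ord d (∑ i ∈ s, f i) := fun n m hnm => by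
  rw [Matrix.sum_apply, Finset.sum_eq_zero fun i hi => h i hi n m hnm]

lemma Band.ord_mul {d e : ℤ} {A B : Band ι 𝕜} (hA : Ord d A.val) (hB : Ord e B.val) :
    Ord (d + e) (A * B).val := hA.lmul hB

lemma Band.ord_pow {d : ℤ} {A : Band ι 𝕜} (hA : Ord d A.val) (s : ℕ) :
    Ord (s * d) (A ^ s).val := by
  induction s with
  | zero => simpa using ord_one
  | succ s ih =>
    rw [pow_succ]
    exact (ord_mul ih hA).mono (by push_cast; linarith [add_mul (s : ℤ) 1 d])

/-- Telescoping: each term A^i (A - B) B^{s-1-i} loses at most s - 1 orders to its factors of order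
-1. -/
lemma Band.ord_pow_sub_pow {k : ℤ} {A B : Band ι 𝕜} (hA : Ord (-1) A.val) (hB : Ord (-1) B.val)
    (h : Ord k (A - B).val) (s : ℕ) : Ord (k + 1 - s) (A ^ s - B ^ s).val := by
  induction s with
  | zero => simpa using ord_zero _
  | succ s ih =>
    have : A ^ (s + 1) - B ^ (s + 1) = A ^ s * (A - B) + (A ^ s - B ^ s) * B := by
      rw [pow_succ, pow_succ]; noncomm_ring
    rw [this, val_add]
    refine ((ord_mul (ord_pow hA s) h).mono ?_).add ((ord_mul ih hB).mono ?_) <;>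
      push_cast <;> linarith

lemma Ord.eq_zero {A : Matrix ι ι 𝕜} (h : ∀ j : ℕ, Ord j A) : A = 0 := by
  ext n m
  exact h (pos m - pos n + 1).toNat n m (by
    have := Int.self_le_toNat (pos m - pos n + 1)
    omega)

/-- A sequence of matrices whose increments have growing order converges. -/
lemma Band.exists_limit (A : ℕ → Band ι 𝕜) {d : ℤ} (h : ∀ j : ℕ, Ord (d + j) (A (j + 1) - A j).val) :
    ∃ L : Band ι 𝕜, ∀ j : ℕ, Ord (d + j) (L - A j).val := by
  have step : ∀ i j : ℕ, Ord (d + j) (A (j + i) - A j).val := by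
    intro i j
    induction i with
    | zero => simpa using ord_zero _
    | succ i ih =>
      have : A (j + (i + 1)) - A j = (A (j + i + 1) - A (j + i)) + (A (j + i) - A j) := by
        rw [← add_assoc]; abel
      rw [this]
      exact ((h (j + i)).mono (by push_cast; omega)).add ih
  obtain ⟨e, he⟩ := (A 0).exists_ord
  -- The entry (n, m) is stationary from this index on, because all later increments have order
  -- greater than m - n.
  let L : Matrix ι ι 𝕜 :=
    Matrix.of fun n m => (A (pos m - pos n - d + 1).toNat).val n m
  have hL : ∀ j : ℕ, Ord (d + j) (L - (A j).val) := by
    intro j n m hnm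
    set i := (pos m - pos n - d + 1).toNat with hi
    have hij : i ≤ j := by omega
    have := step (j - i) i n m (by
      have := Int.self_le_toNat (pos m - pos n - d + 1)
      omega)
    rw [Nat.add_sub_cancel' hij] at this
    simp only [Band.val_sub, Matrix.sub_apply] at this
    simp only [Matrix.sub_apply, L, Matrix.of_apply, ← hi]
    rw [sub_eq_zero] at this ⊢
    exact this.symm
  have hL0 : Ord (min d e) L := by
    have h1 := ((hL 0).mono (e := min d e) (by simp)).add (he.mono (min_le_right d e))
    simpa using h1
  exact ⟨hL0.band, hL⟩

end Band

/-! ### Linear recurrences on ℤ. -/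

section Recursion

variable {𝕜 : Type*} [RCLike 𝕜]

/-- The solution `v` of `∑_{i ≤ l} c n i v (n + i) = w n` with `l` zero initial values. -/
def recSol (l : ℕ) (c : ℕ → ℕ → 𝕜) (w : ℕ → 𝕜) (j : ℕ) : 𝕜 :=
  if _h : j < l then 0
  else (w (j - l) - ∑ i : Fin l, c (j - l) i * recSol l c w (j - l + i)) / c (j - l) l
termination_by j
decreasing_by omega

lemma recSol_of_lt {l : ℕ} (c : ℕ → ℕ → 𝕜) (w : ℕ → 𝕜) {j : ℕ} (h : j < l) :
    recSol l c w j = 0 := by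
  rw [recSol, dif_pos h]

lemma recSol_spec (l : ℕ) (c : ℕ → ℕ → 𝕜) (w : ℕ → 𝕜) (n : ℕ) (hc : c n l ≠ 0) :
    ∑ i ∈ Finset.range (l + 1), c n i * recSol l c w (n + i) = w n := by
  rw [Finset.sum_range_succ, recSol.eq_def l c w (n + l), dif_neg (by omega), Nat.add_sub_cancel,
    Finset.sum_range, mul_div_cancel₀ _ hc]
  ring

/-- A nonzero last coefficient allows solving forwards, a nonzero first one backwards. The free
choice of l initial values reflects the non-uniqueness of matrix roots. -/
lemma exists_two_sided_recursion (l : ℕ) (c : ℤ → ℕ → 𝕜) (w : ℤ → 𝕜) (h0 : ∀ n, c n 0 ≠ 0)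
    (hl : ∀ n, c n l ≠ 0) :
    ∃ v : ℤ → 𝕜, ∀ n, ∑ i ∈ Finset.range (l + 1), c n i * v (n + i) = w n := by
  set u := recSol l (fun n i => c n i) (fun n => w n) with hu
  set d := recSol l (fun n i => c (-1 - n) (l - i)) (fun n => w (-1 - n)) with hd
  -- The backward solution is indexed by l - 1 - z, so its l zero initial values sit at the sites 0,
  -- …, l - 1, the same as those of the forward solution, and the two halves match.
  refine ⟨fun z => if 0 ≤ z then u z.toNat else d (l - 1 - z).toNat, fun n => ?_⟩
  by_cases hn : 0 ≤ n
  · lift n to ℕ using hn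
    rw [← recSol_spec l (fun n i => c n i) (fun n => w n) n (hl n)]
    refine Finset.sum_congr rfl fun i _ => ?_
    dsimp only
    rw [if_pos (by positivity)]
    congr 2
  · obtain ⟨m, rfl⟩ : ∃ m : ℕ, n = -1 - m := ⟨(-1 - n).toNat, by omega⟩
    rw [← recSol_spec l (fun n i => c (-1 - n) (l - i)) (fun n => w (-1 - n)) m
      (by simpa using h0 _), ← Finset.sum_range_reflect]
    refine Finset.sum_congr rfl fun i hi => ?_
    have hi' := Finset.mem_range.1 hi
    have e1 : l + 1 - 1 - i = l - i := by omega
    have e2 : m + i = ((l : ℤ) - 1 - (-1 - m + (l - i : ℕ))).toNat := by omega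
    dsimp only
    rw [e1, e2]
    congr 1
    split_ifs with h
    · rw [hu, recSol_of_lt _ _ (by omega), recSol_of_lt _ _ (by omega)]
    · rfl

end Recursion

/-! ### Roots and inverses of matrices with a nonvanishing subdiagonal. -/

section Root

variable {𝕜 : Type*} [RCLike 𝕜]

lemma lmul_apply_lowest {d e : ℤ} {A B : Matrix ℤ ℤ 𝕜} (hA : Ord d A) (hB : Ord e B) {n k m : ℤ}
    (hk : k = n + d) (hm : m = k + e) : lmul A B n m = A n k * B k m := by
  rw [lmul_eq_sum hA hB n m {k} (fun j h1 h2 => by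
    simp only [pos_int] at h1 h2; rw [Finset.mem_singleton]; omega), Finset.sum_singleton]

lemma Ord.of_eq_zero {d : ℤ} {A : Matrix ℤ ℤ 𝕜} (hA : Ord d A) (h : ∀ n, A n (n + d) = 0) :
    Ord (d + 1) A := fun n m hnm => by
  simp only [pos_int] at hnm
  rcases (show m < n + d ∨ m = n + d by omega) with h1 | rfl
  · exact hA n m h1
  · exact h n

/-- One lower diagonal, all of whose entries are nonzero. -/
def IsHess (A : Matrix ℤ ℤ 𝕜) : Prop := Ord (-1) A ∧ ∀ n m, m = n - 1 → A n m ≠ 0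

lemma IsHess.pow_ne_zero {A : Band ℤ 𝕜} (hA : IsHess A.val) (s : ℕ) {n m : ℤ} (h : m = n - s) :
    (A ^ s).val n m ≠ 0 := by
  induction s generalizing m with
  | zero => simp_all
  | succ s ih =>
    rw [pow_succ, Band.val_mul, lmul_apply_lowest (Band.ord_pow hA.1 s) hA.1 (k := n - s)
      (by ring) (by push_cast at h; omega)]
    exact mul_ne_zero (ih rfl) (hA.2 _ _ (by push_cast at h; omega))

/-- The first order expansion of (P + V)^s. Terms with two factors V have order at least 2d - (s -
2), which exceeds the order d - (s - 1) of the linear terms because d ≥ 0. -/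
lemma ord_add_pow_sub {d : ℤ} (hd : 0 ≤ d) {P V : Band ℤ 𝕜} (hP : Ord (-1) P.val)
    (hV : Ord d V.val) (s : ℕ) :
    Ord (d + 1 - s + 1)
      ((P + V) ^ s - P ^ s - ∑ i ∈ Finset.range s, P ^ i * V * P ^ (s - 1 - i)).val := by
  have hPV : Ord (-1) (P + V).val := hP.add (hV.mono (by omega))
  induction s with
  | zero => simpa using ord_zero _
  | succ s ih =>
    have h1 : ∑ i ∈ Finset.range (s + 1), P ^ i * V * P ^ (s + 1 - 1 - i) =
        (∑ i ∈ Finset.range s, P ^ i * V * P ^ (s - 1 - i)) * P + P ^ s * V := by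
      rw [Finset.sum_range_succ, Finset.sum_mul]
      congr 1
      · refine Finset.sum_congr rfl fun i hi => ?_
        rw [Finset.mem_range] at hi
        rw [mul_assoc _ _ P, ← pow_succ]
        congr 2
        omega
      · simp
    have h2 : (P + V) ^ (s + 1) - P ^ (s + 1) -
        ∑ i ∈ Finset.range (s + 1), P ^ i * V * P ^ (s + 1 - 1 - i) =
        ((P + V) ^ s - P ^ s - ∑ i ∈ Finset.range s, P ^ i * V * P ^ (s - 1 - i)) * P +
          ((P + V) ^ s - P ^ s) * V := by
      rw [h1, pow_succ, pow_succ]; noncomm_ring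
    rw [h2, Band.val_add]
    have h3 : Ord (d + 1 - s) ((P + V) ^ s - P ^ s).val :=
      Band.ord_pow_sub_pow hPV hP (by simpa using hV) s
    refine ((Band.ord_mul ih hP).mono ?_).add ((Band.ord_mul h3 hV).mono ?_) <;>
      push_cast <;> linarith

/-- A Newton step. V is a single diagonal, and on the diagonal e the terms P^i V P^{l-i} involve
only the lowest entries of the powers of P, so each is a nonzero multiple of one entry of V.
Cancelling the error there is a recurrence of order l for those entries. -/
lemma exists_root_step (l : ℕ) {e : ℤ} (he : 1 ≤ e) {P M : Band ℤ 𝕜} (hP : IsHess P.val)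
    (h : Ord e (M - P ^ (l + 1)).val) :
    ∃ V : Band ℤ 𝕜, Ord (e + l) V.val ∧ Ord (e + 1) (M - (P + V) ^ (l + 1)).val := by
  -- The equation for row n + l. The term with index i contains v at n + i and comes from P^{l-i} V
  -- P^i.
  obtain ⟨v, hv⟩ := exists_two_sided_recursion l
    (fun n i => (P ^ (l - i)).val (n + l) (n + i + (l - i : ℕ) - (l - i : ℕ)) *
      (P ^ i).val (n + i + e + l) (n + l + e))
    (fun n => (M - P ^ (l + 1)).val (n + l) (n + l + e))
    (fun n => mul_ne_zero (hP.pow_ne_zero _ (by simp)) (hP.pow_ne_zero _ (by push_cast; ring)))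
    (fun n => mul_ne_zero (hP.pow_ne_zero _ (by simp)) (hP.pow_ne_zero _ (by ring)))
  let V₀ : Matrix ℤ ℤ 𝕜 := Matrix.of fun n m => if m = n + e + l then v n else 0
  have hV₀ : Ord (e + l) V₀ := fun n m hnm => by
    simp only [pos_int] at hnm
    simp only [V₀, Matrix.of_apply]
    rw [if_neg (by omega)]
  let V : Band ℤ 𝕜 := hV₀.band
  have hV : Ord (e + l) V.val := hV₀
  refine ⟨V, hV, ?_⟩
  set S : Band ℤ 𝕜 := ∑ i ∈ Finset.range (l + 1), P ^ i * V * P ^ (l + 1 - 1 - i) with hS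
  have h1 : Ord (e + 1) ((P + V) ^ (l + 1) - P ^ (l + 1) - S).val :=
    (ord_add_pow_sub (by omega) hP.1 hV (l + 1)).mono (by push_cast; linarith)
  have hterm : ∀ i ∈ Finset.range (l + 1), Ord e (P ^ i * V * P ^ (l + 1 - 1 - i)).val := by
    intro i hi
    rw [Finset.mem_range] at hi
    refine (Band.ord_mul (Band.ord_mul (Band.ord_pow hP.1 i) hV) (Band.ord_pow hP.1 _)).mono ?_
    omega
  have hSo : Ord e S.val := by
    rw [hS, Band.val_sum]
    exact Ord.sum hterm
  have h2 : Ord (e + 1) (M - P ^ (l + 1) - S).val := by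
    refine Ord.of_eq_zero (h.sub hSo) fun n => ?_
    have := hv (n - l)
    simp only [sub_add_cancel] at this
    rw [Band.val_sub, Matrix.sub_apply, ← this, hS, Band.val_sum, Matrix.sum_apply, sub_eq_zero,
      ← Finset.sum_range_reflect]
    refine Finset.sum_congr rfl fun i hi => ?_
    rw [Finset.mem_range] at hi
    have e1 : l - (l + 1 - 1 - i) = i := by omega
    have e2 : ((l + 1 - 1 - i : ℕ) : ℤ) = l - i := by omega
    rw [e1, e2]
    rw [Band.val_mul, Band.val_mul, lmul_apply_lowest
      (Ord.lmul (Band.ord_pow hP.1 i) hV) (Band.ord_pow hP.1 _) (k := n - i + e + l) (by ring)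
      (by rw [e2]; ring), lmul_apply_lowest (Band.ord_pow hP.1 i) hV (k := n - i) (by ring)
      (by ring)]
    have e3 : V.val (n - i) (n - i + e + l) = v (n - i) := by
      simp [V, V₀]
    rw [e3]
    have e4 : n - (l : ℤ) + (l - i) = n - i := by ring
    rw [e4, show n - (i : ℤ) + i - i = n - i by ring]
    ring
  have h3 : M - (P + V) ^ (l + 1) =
      (M - P ^ (l + 1) - S) - ((P + V) ^ (l + 1) - P ^ (l + 1) - S) := by abel
  rw [h3]
  exact h2.sub h1

lemma IsHess.add {A V : Matrix ℤ ℤ 𝕜} (hA : IsHess A) {d : ℤ} (hd : 0 ≤ d) (hV : Ord d V) :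
    IsHess (A + V) :=
  ⟨hA.1.add (hV.mono (by omega)), fun n m h => by
    rw [Matrix.add_apply, hV n m (by simp only [pos_int]; omega), add_zero]; exact hA.2 n m h⟩

/-- An approximate root of a matrix can be corrected in the upper triangular part. -/
lemma exists_root (l : ℕ) {P M : Band ℤ 𝕜} (hP : IsHess P.val) (h : Ord 1 (M - P ^ (l + 1)).val) :
    ∃ R : Band ℤ 𝕜, Ord (1 + l) (R - P).val ∧ R ^ (l + 1) = M := by
  let good : ℕ → Band ℤ 𝕜 → Prop := fun j A =>
    IsHess A.val ∧ Ord (1 + j) (M - A ^ (l + 1)).val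
  have step : ∀ (j : ℕ) (A : {A // good j A}), ∃ V : Band ℤ 𝕜,
      Ord (1 + l + j) V.val ∧ good (j + 1) (A.1 + V) := by
    rintro j ⟨A, hA, hj⟩
    obtain ⟨V, hV, hV'⟩ := exists_root_step l (by omega) hA hj
    exact ⟨V, hV.mono (by omega), hA.add (by omega) hV, hV'.mono (by push_cast; omega)⟩
  choose V hV hV' using step
  let F : ∀ j, {A // good j A} := fun j =>
    Nat.rec ⟨P, hP, by simpa using h⟩ (fun j A => ⟨A.1 + V j A, hV' j A⟩) j
  obtain ⟨R, hR⟩ := Band.exists_limit (fun j => (F j).1) (d := 1 + l) fun j => by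
    have : (F (j + 1)).1 - (F j).1 = V j (F j) := add_sub_cancel_left _ _
    rw [this]
    exact hV j (F j)
  have hRP : Ord (1 + l) (R - P).val := by
    have h0 : (F 0).1 = P := rfl
    have := hR 0
    rw [h0] at this
    simpa using this
  have hR1 : Ord (-1) R.val := by
    have := hP.1.add (hRP.mono (e := -1) (by omega))
    simpa using this
  refine ⟨R, hRP, ?_⟩
  -- The error of the j-th iterate has order at least 1 + j, and replacing the iterate by the limit
  -- changes the power by order at least 1 + j as well; hence the error of R has every order.
  have hz : (R ^ (l + 1) - M).val = 0 := Ord.eq_zero fun j => by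
    have h1 := Band.ord_pow_sub_pow hR1 (F j).2.1.1 (hR j) (l + 1)
    have h2 := (F j).2.2
    have : R ^ (l + 1) - M = (R ^ (l + 1) - (F j).1 ^ (l + 1)) - (M - (F j).1 ^ (l + 1)) := by abel
    rw [this]
    exact (h1.mono (by push_cast; omega)).sub (h2.mono (by omega))
  exact sub_eq_zero.1 (Band.ext hz)

/-- The Neumann series converges because N raises the order. -/
lemma exists_inverse_one_sub {N : Band ℤ 𝕜} (hN : Ord 1 N.val) :
    ∃ G : Band ℤ 𝕜, Ord 0 G.val ∧ G * (1 - N) = 1 ∧ (1 - N) * G = 1 := by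
  have hNp : ∀ j : ℕ, Ord j (N ^ j).val := fun j => by simpa using Band.ord_pow hN j
  obtain ⟨G, hG⟩ := Band.exists_limit (fun j => ∑ i ∈ Finset.range j, N ^ i) (d := 0) fun j => by
    rw [Finset.sum_range_succ, add_sub_cancel_left]
    simpa using hNp j
  have h1 : Ord 0 (1 - N).val := Ord.sub ord_one (hN.mono (by norm_num))
  refine ⟨G, by simpa using hG 0, ?_, ?_⟩
  · refine sub_eq_zero.1 (Band.ext (Ord.eq_zero fun j => ?_))
    have : G * (1 - N) - 1 = (G - ∑ i ∈ Finset.range j, N ^ i) * (1 - N) - N ^ j := by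
      rw [sub_mul, geom_sum_mul_neg]; abel
    rw [this]
    exact ((Band.ord_mul (hG j) h1).mono (by omega)).sub (hNp j)
  · refine sub_eq_zero.1 (Band.ext (Ord.eq_zero fun j => ?_))
    have : (1 - N) * G - 1 = (1 - N) * (G - ∑ i ∈ Finset.range j, N ^ i) - N ^ j := by
      rw [mul_sub, mul_neg_geom_sum]; abel
    rw [this]
    exact ((Band.ord_mul h1 (hG j)).mono (by omega)).sub (hNp j)

/-- The superdiagonal matrix T of reciprocals inverts X to leading order: both 1 - TX and 1 - XT are
strictly upper. Neumann series then give a left and a right inverse, which coincide. -/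
lemma IsHess.exists_inverse {X : Band ℤ 𝕜} (hX : IsHess X.val) :
    ∃ Y : Band ℤ 𝕜, Ord 1 Y.val ∧ X * Y = 1 ∧ Y * X = 1 := by
  let T₀ : Matrix ℤ ℤ 𝕜 := Matrix.of fun n m => if m = n + 1 then (X.val m n)⁻¹ else 0
  have hT₀ : Ord 1 T₀ := fun n m hnm => by
    simp only [pos_int] at hnm
    simp only [T₀, Matrix.of_apply]
    rw [if_neg (by omega)]
  let T : Band ℤ 𝕜 := hT₀.band
  have hT : Ord 1 T.val := hT₀
  have h1 : Ord 1 (1 - T * X).val := by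
    refine Ord.of_eq_zero (d := 0)
      (Ord.sub ord_one ((Band.ord_mul hT hX.1).mono (by norm_num))) fun n => ?_
    rw [Band.val_sub, Matrix.sub_apply, Band.val_mul,
      lmul_apply_lowest hT hX.1 (k := n + 1) rfl (by ring)]
    have : T.val n (n + 1) = (X.val (n + 1) n)⁻¹ := by simp [T, T₀]
    rw [this, add_zero, inv_mul_cancel₀ (hX.2 _ _ (by ring))]
    simp
  have h2 : Ord 1 (1 - X * T).val := by
    refine Ord.of_eq_zero (d := 0)
      (Ord.sub ord_one ((Band.ord_mul hX.1 hT).mono (by norm_num))) fun n => ?_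
    rw [Band.val_sub, Matrix.sub_apply, Band.val_mul,
      lmul_apply_lowest hX.1 hT (k := n - 1) rfl (by ring)]
    have : T.val (n - 1) (n + 0) = (X.val n (n - 1))⁻¹ := by simp [T, T₀]
    rw [this, mul_inv_cancel₀ (hX.2 _ _ (by ring))]
    simp
  obtain ⟨G, hG, hG1, -⟩ := exists_inverse_one_sub h1
  obtain ⟨G', -, -, hG2⟩ := exists_inverse_one_sub h2
  rw [sub_sub_cancel] at hG1 hG2
  rw [← mul_assoc] at hG1
  rw [mul_assoc] at hG2
  refine ⟨G * T, by simpa using Band.ord_mul hG hT, ?_, hG1⟩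
  rw [left_inv_eq_right_inv hG1 hG2, hG2]

end Root

/-! ### Restriction to the semi-infinite block, and the continued constraint. -/

section Block

variable {𝕜 : Type*} [RCLike 𝕜]

/-- The entries from negative to nonnegative sites vanish. -/
def CornerZero (A : Matrix ℤ ℤ 𝕜) : Prop := ∀ n m, n < 0 → 0 ≤ m → A n m = 0

/-- Intermediate sites k < 0 drop out because B vanishes from negative to nonnegative sites; A needs
no such condition. -/
lemma block_lmul {d e : ℤ} {A B : Matrix ℤ ℤ 𝕜} (hA : Ord d A) (hB : Ord e B)
    (hB' : CornerZero B) : block (lmul A B) = lmul (block A) (block B) := by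
  have hbA : Ord d (block A) := fun n m h => hA n m h
  have hbB : Ord e (block B) := fun n m h => hB n m h
  ext n m
  set F := sites ℕ (n + d) (m - e)
  rw [lmul_eq_sum hbA hbB n m F fun k h1 h2 => by
    simp only [pos_nat] at h1 h2; rw [mem_sites, pos_nat]; omega]
  simp only [block, lmul, Matrix.of_apply]
  rw [finsum_eq_sum_of_support_subset (s := F.map Nat.castEmbedding), Finset.sum_map]
  · rfl
  · intro k hk
    rw [Function.mem_support] at hk
    have h1 := left_ne_zero_of_mul hk
    have h2 := right_ne_zero_of_mul hk
    have hk0 : 0 ≤ k := by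
      by_contra hneg
      exact h2 (hB' k m (by omega) (by omega))
    lift k to ℕ using hk0
    simp only [Finset.coe_map, Set.mem_image, Finset.mem_coe]
    refine ⟨k, ?_, rfl⟩
    rw [mem_sites]
    simp only [pos_nat]
    constructor
    · by_contra h
      exact h1 (hA n k (by simp only [pos_int]; omega))
    · by_contra h
      exact h2 (hB k m (by simp only [pos_int]; omega))

lemma block_one : block (1 : Matrix ℤ ℤ 𝕜) = 1 := by
  ext n m
  simp [block, Matrix.one_apply]

lemma block_pow (A : Band ℤ 𝕜) (hA : CornerZero A.val) (s : ℕ) :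
    block (A ^ s).val = lpow (block A.val) s := by
  induction s with
  | zero => simp [lpow, block_one]
  | succ s ih =>
    obtain ⟨d, hd⟩ := A.exists_ord
    rw [pow_succ, Band.val_mul, block_lmul (Band.ord_pow hd s) hd hA, ih]
    rfl

lemma CornerZero.lmul {A B : Matrix ℤ ℤ 𝕜} (hA : CornerZero A) (hB : CornerZero B) :
    CornerZero (lmul A B) := fun n m hn hm => by
  refine (finsum_congr fun k => ?_).trans finsum_zero
  by_cases hk : k < 0
  · rw [hB k m hk hm, mul_zero]
  · rw [hA n k hn (by omega), zero_mul]

lemma CornerZero.lpow {A : Matrix ℤ ℤ 𝕜} (hA : CornerZero A) (s : ℕ) : CornerZero (lpow A s) := by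
  induction s with
  | zero =>
    intro n m hn hm
    exact Matrix.one_apply_ne (by omega)
  | succ s ih => exact ih.lmul hA

lemma extTilde_cornerZero (Qt : Matrix ℕ ℕ 𝕜) : CornerZero (extTilde Qt) := fun n m hn hm => by
  simp only [extTilde, Matrix.of_apply]
  rw [if_neg (by omega), if_neg (by omega)]

lemma block_extTilde (Qt : Matrix ℕ ℕ 𝕜) : block (extTilde Qt) = Qt := by
  ext n m
  simp [block, extTilde]

lemma extTilde_isHess {Qt : Matrix ℕ ℕ 𝕜} (h0 : ∀ n, Qt (n + 1) n ≠ 0)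
    (h : ∀ n m, m + 2 ≤ n → Qt n m = 0) : IsHess (extTilde Qt) := by
  constructor
  · intro n m hnm
    simp only [pos_int] at hnm
    simp only [extTilde, Matrix.of_apply]
    split_ifs with h1 h2
    · exact h _ _ (by omega)
    · omega
    · rfl
  · rintro n m rfl
    simp only [extTilde, Matrix.of_apply]
    split_ifs with h1
    · have : n.toNat = (n - 1).toNat + 1 := by omega
      rw [this]
      exact h0 _
    · exact one_ne_zero

lemma block_extQ {p₂ : ℕ} (g : 𝕜) (tt : Fin p₂ → 𝕜) (Q Qt : Matrix ℕ ℕ 𝕜) :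
    block (extQ g tt Q Qt) = Q := by
  ext n m
  simp [block, extQ]

lemma extQ_cornerZero {p₂ : ℕ} (g : 𝕜) (tt : Fin p₂ → 𝕜) (Q Qt : Matrix ℕ ℕ 𝕜) :
    CornerZero (extQ g tt Q Qt) := fun n m hn hm => by
  simp only [extQ, Matrix.of_apply]
  rw [if_neg (by omega)]
  exact Finset.sum_eq_zero fun s _ => by
    rw [(extTilde_cornerZero Qt).lpow s n m hn hm, mul_zero]

lemma lowerDiag_eq_iff {A B : Matrix ℕ ℕ 𝕜} : lowerDiag A = lowerDiag B ↔ Ord 1 (A - B) := by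
  constructor
  · intro h n m hnm
    simp only [pos_nat] at hnm
    have := congrFun (congrFun h n) m
    simp only [lowerDiag, Matrix.of_apply] at this
    rw [if_pos (by omega), if_pos (by omega)] at this
    simp [this]
  · intro h
    ext n m
    simp only [lowerDiag, Matrix.of_apply]
    split_ifs with hnm
    · exact sub_eq_zero.1 (h n m (by simp only [pos_nat]; omega))
    · rfl

lemma strictLower_eq_iff {A B : Matrix ℕ ℕ 𝕜} :
    strictLower A = strictLower B ↔ Ord 0 (A - B) := by
  constructor
  · intro h n m hnm
    simp only [pos_nat] at hnm
    have := congrFun (congrFun h n) m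
    simp only [strictLower, Matrix.of_apply] at this
    rw [if_pos (by omega), if_pos (by omega)] at this
    simp [this]
  · intro h
    ext n m
    simp only [strictLower, Matrix.of_apply]
    split_ifs with hnm
    · exact sub_eq_zero.1 (h n m (by simp only [pos_nat]; omega))
    · rfl

lemma lowerDiag_sum_smul {σ : Type*} (s : Finset σ) (c : σ → 𝕜) (A : σ → Matrix ℕ ℕ 𝕜) :
    lowerDiag (∑ i ∈ s, c i • A i) = ∑ i ∈ s, c i • lowerDiag (A i) := by
  ext n m
  simp only [lowerDiag, Matrix.of_apply, Matrix.sum_apply, Matrix.smul_apply, smul_eq_mul]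
  split_ifs <;> simp

lemma upperDiag_sum_smul {σ : Type*} (s : Finset σ) (c : σ → 𝕜) (A : σ → Matrix ℕ ℕ 𝕜) :
    upperDiag (∑ i ∈ s, c i • A i) = ∑ i ∈ s, c i • upperDiag (A i) := by
  ext n m
  simp only [upperDiag, Matrix.of_apply, Matrix.sum_apply, Matrix.smul_apply, smul_eq_mul]
  split_ifs <;> simp

lemma strictLower_sum_smul {σ : Type*} (s : Finset σ) (c : σ → 𝕜) (A : σ → Matrix ℕ ℕ 𝕜) :
    strictLower (∑ i ∈ s, c i • A i) = ∑ i ∈ s, c i • strictLower (A i) := by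
  ext n m
  simp only [strictLower, Matrix.of_apply, Matrix.sum_apply, Matrix.smul_apply, smul_eq_mul]
  split_ifs <;> simp

lemma block_sum_smul {σ : Type*} (s : Finset σ) (c : σ → 𝕜) (A : σ → Matrix ℤ ℤ 𝕜) :
    block (∑ i ∈ s, c i • A i) = ∑ i ∈ s, c i • block (A i) := by
  ext n m
  simp [block, Matrix.sum_apply]

lemma CouplingQ.lowerDiag_eq {p₂ : ℕ} (hp₂ : 1 ≤ p₂) {g : 𝕜} {tt : Fin p₂ → 𝕜}
    {Q Qt : Matrix ℕ ℕ 𝕜} (h : CouplingQ g tt Q Qt) :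
    lowerDiag Q = ∑ s ∈ Finset.range p₂, coupl g tt s • lowerDiag (lpow Qt s) := by
  obtain ⟨k, rfl⟩ : ∃ k, p₂ = k + 1 := ⟨p₂ - 1, by omega⟩
  have h1 : lowerDiag (1 : Matrix ℕ ℕ 𝕜) = 1 := by
    ext n m
    simp only [lowerDiag, Matrix.of_apply, Matrix.one_apply]
    grind
  have h2 : Finset.Icc 1 (k + 1 - 1) = Finset.Ico 1 (k + 1) := by ext; simp
  rw [h, h2, Finset.sum_Ico_eq_sum_range, Finset.sum_range_succ', lpow, h1, sub_eq_add_neg,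
    ← Finset.sum_neg_distrib, ← neg_smul]
  congr 1
  · refine Finset.sum_congr rfl fun s _ => ?_
    rw [← neg_smul, add_comm 1 s, coupl, neg_mul]
  · simp [coupl]

/-- The difference of the continued `Q` and `∑ α_s Q̃^s` is strictly upper triangular. -/
lemma extQ_sub_ord {p₂ : ℕ} (hp₂ : 1 ≤ p₂) {g : 𝕜} {tt : Fin p₂ → 𝕜} {Q Qt : Matrix ℕ ℕ 𝕜}
    (h : CouplingQ g tt Q Qt) (X : Band ℤ 𝕜) (hX : X.val = extTilde Qt) :
    Ord 1 (extQ g tt Q Qt - (∑ s ∈ Finset.range p₂, coupl g tt s • X ^ s).val) := by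
  have hb := h.lowerDiag_eq hp₂
  rw [← lowerDiag_sum_smul, lowerDiag_eq_iff] at hb
  intro n m hnm
  simp only [pos_int] at hnm
  by_cases h0 : 0 ≤ n ∧ 0 ≤ m
  · obtain ⟨hn, hm⟩ := h0
    lift n to ℕ using hn
    lift m to ℕ using hm
    have h1 := hb n m (by simpa using hnm)
    have h2 : (∑ s ∈ Finset.range p₂, coupl g tt s • X ^ s).val n m =
        (∑ s ∈ Finset.range p₂, coupl g tt s • lpow Qt s) n m := by
      have : block (∑ s ∈ Finset.range p₂, coupl g tt s • X ^ s).val =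
          ∑ s ∈ Finset.range p₂, coupl g tt s • lpow Qt s := by
        rw [Band.val_sum]
        simp only [Band.val_smul]
        rw [block_sum_smul]
        refine Finset.sum_congr rfl fun s _ => ?_
        rw [block_pow X (by rw [hX]; exact extTilde_cornerZero Qt), hX, block_extTilde]
      rw [← this]
      rfl
    rw [Matrix.sub_apply, h2, ← h1]
    simp [extQ]
  · simp only [Matrix.sub_apply, extQ, Matrix.of_apply]
    rw [if_neg h0]
    simp [Matrix.sum_apply, hX]

end Block

/-! ### The coefficients γ as coefficients of powers of one polynomial. -/

section Binomial

variable {𝕜 : Type*} [RCLike 𝕜]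

open PowerSeries in
lemma coeff_eq_of_X_pow_dvd_sub {N : ℕ} {F G : PowerSeries 𝕜} (h : X ^ N ∣ F - G) {i : ℕ}
    (hi : i < N) : coeff i F = coeff i G := by
  have := X_pow_dvd_iff.1 h i hi
  rwa [map_sub, sub_eq_zero] at this

lemma fracBinom_eq_choose (s k j : ℕ) :
    fracBinom 𝕜 s k j = Ring.choose ((s : 𝕜) / (k : 𝕜)) j := by
  rw [Ring.choose_eq_smul, ← Polynomial.aeval_eq_smeval, Polynomial.aeval_def,
    ← Polynomial.eval_map, descPochhammer_map, fracBinom, descPochhammer_eval_eq_prod_range, smul_eq_mul, div_eq_inv_mul]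

lemma rho_coeff (k : ℕ) (α : ℕ → 𝕜) (i : ℕ) :
    (rho k α).coeff i = if 1 ≤ i ∧ i ≤ k then α (k - i) / α k else 0 := by
  simp only [rho, Polynomial.finsetSum_coeff, Polynomial.coeff_C_mul, Polynomial.coeff_X_pow,
    mul_ite, mul_one, mul_zero, Finset.sum_ite_eq, Finset.mem_Icc]

lemma rho_pow_coeff_of_lt (k : ℕ) (α : ℕ → 𝕜) {i j : ℕ} (h : i < j) :
    ((rho k α) ^ j).coeff i = 0 := by
  have h1 : Polynomial.X ∣ rho k α := by
    rw [Polynomial.X_dvd_iff, rho_coeff, if_neg (by omega)]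
  exact Polynomial.X_pow_dvd_iff.1 (pow_dvd_pow_of_dvd h1 j) i h

lemma binomialSeries_pow (k s : ℕ) :
    (PowerSeries.binomialSeries 𝕜 ((1 : 𝕜) / k)) ^ s =
      PowerSeries.binomialSeries 𝕜 ((s : 𝕜) / k) := by
  induction s with
  | zero => simp
  | succ s ih =>
    rw [pow_succ, ih, ← PowerSeries.binomialSeries_add]
    congr 1
    push_cast
    ring

open PowerSeries in
lemma coeff_binomialSeries_subst (k : ℕ) (α : ℕ → 𝕜) (s i : ℕ) :
    coeff i ((PowerSeries.binomialSeries 𝕜 ((s : 𝕜) / k)).subst (rho k α : PowerSeries 𝕜)) =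
      ∑ j ∈ Finset.range (i + 1), fracBinom 𝕜 s k j * ((rho k α) ^ j).coeff i := by
  have hs : HasSubst (rho k α : PowerSeries 𝕜) := by
    refine HasSubst.of_constantCoeff_zero' ?_
    rw [← coeff_zero_eq_constantCoeff_apply, Polynomial.coeff_coe, rho_coeff, if_neg (by omega)]
  rw [coeff_subst' hs, finsum_eq_sum_of_support_subset (s := Finset.range (i + 1))]
  · refine Finset.sum_congr rfl fun j _ => ?_
    rw [binomialSeries_coeff, ← Polynomial.coe_pow, Polynomial.coeff_coe, fracBinom_eq_choose]
    simp
  · intro j hj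
    by_contra h
    simp only [Finset.coe_range, Set.mem_Iio, not_lt] at h
    apply hj
    dsimp only
    rw [← Polynomial.coe_pow, Polynomial.coeff_coe, rho_pow_coeff_of_lt k α (by omega), smul_zero]

/-- A polynomial approximating `(1 + ρ)^{1/k}`. -/
lemma exists_root_polynomial (k : ℕ) (α : ℕ → 𝕜) :
    ∃ π : Polynomial 𝕜, ∀ s i, i ≤ k → (π ^ s).coeff i =
      ∑ j ∈ Finset.range (i + 1), fracBinom 𝕜 s k j * ((rho k α) ^ j).coeff i := by
  have hs : PowerSeries.HasSubst (rho k α : PowerSeries 𝕜) := by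
    refine PowerSeries.HasSubst.of_constantCoeff_zero' ?_
    rw [← PowerSeries.coeff_zero_eq_constantCoeff_apply, Polynomial.coeff_coe, rho_coeff,
      if_neg (by omega)]
  set G := (PowerSeries.binomialSeries 𝕜 ((1 : 𝕜) / k)).subst (rho k α : PowerSeries 𝕜) with hG
  refine ⟨PowerSeries.trunc (k + 1) G, fun s i hi => ?_⟩
  rw [← coeff_binomialSeries_subst, ← binomialSeries_pow, PowerSeries.subst_pow hs, ← hG,
    ← Polynomial.coeff_coe, Polynomial.coe_pow]
  refine coeff_eq_of_X_pow_dvd_sub (N := k + 1) (dvd_trans ?_ (sub_dvd_pow_sub_pow _ _ s)) (by omega)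
  rw [PowerSeries.X_pow_dvd_iff]
  intro m hm
  rw [map_sub, Polynomial.coeff_coe, PowerSeries.coeff_trunc, if_pos hm, sub_self]

/-- The rows of γ come from powers of a single π, so that ∑ γ_{sσ} X^σ is approximately the s-th
power of one matrix. -/
lemma gam_of_root {k : ℕ} {α : ℕ → 𝕜} {π : Polynomial 𝕜}
    (hπ : ∀ s i, i ≤ k → (π ^ s).coeff i =
      ∑ j ∈ Finset.range (i + 1), fracBinom 𝕜 s k j * ((rho k α) ^ j).coeff i)
    (a : 𝕜) {s σ : ℕ} (hσ : σ ≤ s) (hk : s - σ ≤ k) :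
    gam k a α s σ = a ^ s * (π ^ s).coeff (s - σ) := by
  rw [gam, if_pos hσ, hπ s _ hk]

lemma sum_fracBinom_self {k : ℕ} (hk : k ≠ 0) (α : ℕ → 𝕜) (i : ℕ) :
    ∑ j ∈ Finset.range (i + 1), fracBinom 𝕜 k k j * ((rho k α) ^ j).coeff i =
      (1 + rho k α).coeff i := by
  rw [← coeff_binomialSeries_subst, div_self (by exact_mod_cast hk)]
  have hs : PowerSeries.HasSubst (rho k α : PowerSeries 𝕜) := by
    refine PowerSeries.HasSubst.of_constantCoeff_zero' ?_
    rw [← PowerSeries.coeff_zero_eq_constantCoeff_apply, Polynomial.coeff_coe, rho_coeff,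
      if_neg (by omega)]
  have h1 : PowerSeries.binomialSeries 𝕜 (1 : 𝕜) = 1 + PowerSeries.X := by
    have := PowerSeries.binomialSeries_nat (R := 𝕜) (A := 𝕜) 1
    simpa using this
  have h2 : PowerSeries.subst (rho k α : PowerSeries 𝕜) (1 + PowerSeries.X : PowerSeries 𝕜) =
      1 + (rho k α : PowerSeries 𝕜) := by
    rw [← PowerSeries.coe_substAlgHom hs, map_add, map_one, PowerSeries.coe_substAlgHom hs,
      PowerSeries.subst_X hs]
  rw [h1, h2, ← Polynomial.coe_one, ← Polynomial.coe_add, Polynomial.coeff_coe]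

/-- For s = k the exponent is 1, and the binomial series terminates as 1 + ρ. -/
lemma gam_self {k : ℕ} (hk : k ≠ 0) {a : 𝕜} {α : ℕ → 𝕜} (ha : a ≠ 0) (h : a ^ k = α k) {σ : ℕ}
    (hσ : σ ≤ k) : gam k a α k σ = α σ := by
  have h0 : α k ≠ 0 := h ▸ pow_ne_zero k ha
  rw [gam, if_pos hσ, sum_fracBinom_self hk, Polynomial.coeff_add, rho_coeff, h,
    Polynomial.coeff_one]
  rcases hσ.lt_or_eq with h1 | rfl
  · rw [if_neg (by omega), if_pos (by omega), Nat.sub_sub_self hσ]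
    field_simp
    ring
  · simp

lemma gam_diag (k : ℕ) (a : 𝕜) (α : ℕ → 𝕜) (s : ℕ) : gam k a α s s = a ^ s := by
  simp [gam, fracBinom]

end Binomial

/-! ### Existence of the fractional power. -/

section FracPower

variable {𝕜 : Type*} [RCLike 𝕜]

lemma pow_mul_pow_of_inverse {X Y : Band ℤ 𝕜} (hXY : X * Y = 1) {s i : ℕ} (h : i ≤ s) :
    X ^ s * Y ^ i = X ^ (s - i) := by
  obtain ⟨r, rfl⟩ := Nat.exists_eq_add_of_le' h
  rw [Nat.add_sub_cancel, pow_add, mul_assoc]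
  suffices X ^ i * Y ^ i = 1 by rw [this, mul_one]
  clear h
  induction i with
  | zero => simp
  | succ i ih =>
    rw [pow_succ, pow_succ', mul_assoc, ← mul_assoc X Y, hXY, one_mul, ih]

/-- X commutes with π(Y), so the s-th power is a combination of X^s Y^i with coefficients from π^s.
These match γ for i ≤ min(s, k), and the remaining terms have order i - s. The bound is 1 for s ≤ k
but only 0 for s = k + 1, which is why the top power is normalized only below the diagonal. -/
lemma root_pow_sub_ord {k : ℕ} {α : ℕ → 𝕜} {π : Polynomial 𝕜}
    (hπ : ∀ s i, i ≤ k → (π ^ s).coeff i =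
      ∑ j ∈ Finset.range (i + 1), fracBinom 𝕜 s k j * ((rho k α) ^ j).coeff i)
    (a : 𝕜) {X Y : Band ℤ 𝕜} (hX : Ord (-1) X.val) (hY : Ord 1 Y.val) (hXY : X * Y = 1)
    (hYX : Y * X = 1) (s : ℕ) :
    Ord (min s k + 1 - s) ((a • (X * Polynomial.aeval Y π)) ^ s -
      ∑ σ ∈ Finset.range (s + 1), gam k a α s σ • X ^ σ).val := by
  have hc : Commute X (Polynomial.aeval Y π) := by
    have : Commute X Y := hXY.trans hYX.symm
    rw [Polynomial.aeval_eq_sum_range]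
    exact Commute.sum_right _ _ _ fun i _ => (this.pow_right i).smul_right _
  set N := max ((π ^ s).natDegree + 1) (s + 1) with hN
  have h1 : (a • (X * Polynomial.aeval Y π)) ^ s =
      ∑ i ∈ Finset.range N, (a ^ s * (π ^ s).coeff i) • (X ^ s * Y ^ i) := by
    rw [smul_pow, hc.mul_pow, ← map_pow, Polynomial.aeval_eq_sum_range' (n := N) (by omega),
      Finset.mul_sum, Finset.smul_sum]
    refine Finset.sum_congr rfl fun i _ => ?_
    rw [mul_smul_comm, smul_smul]
  have h2 : ∑ σ ∈ Finset.range (s + 1), gam k a α s σ • X ^ σ =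
      ∑ i ∈ Finset.range N, (if i ≤ s then gam k a α s (s - i) else 0) • (X ^ s * Y ^ i) := by
    rw [← Finset.sum_range_reflect]
    refine Eq.trans (Finset.sum_congr rfl fun i hi => ?_)
      (Finset.sum_subset (s₁ := Finset.range (s + 1)) (fun i hi => ?_) fun i _ hi => ?_)
    · rw [Finset.mem_range] at hi
      rw [if_pos (by omega), pow_mul_pow_of_inverse hXY (by omega), Nat.add_sub_cancel]
    · rw [Finset.mem_range] at hi ⊢
      omega
    · rw [Finset.mem_range] at hi
      rw [if_neg (by omega), zero_smul]
  rw [h1, h2, ← Finset.sum_sub_distrib, Band.val_sum]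
  refine Ord.sum fun i _ => ?_
  rw [← sub_smul]
  by_cases hi : i ≤ min s k
  · have h3 : i ≤ s := by omega
    rw [if_pos h3, gam_of_root hπ a (by omega) (by omega), Nat.sub_sub_self h3, sub_self, zero_smul]
    exact ord_zero _
  · refine Ord.smul _ ((Band.ord_mul (Band.ord_pow hX s) (Band.ord_pow hY i)).mono ?_)
    omega

/-- Existence of the fractional power. -/
lemma exists_isFracPower {p₂ : ℕ} (hp₂ : 2 ≤ p₂) {g a : 𝕜} {tt : Fin p₂ → 𝕜}
    {Q Qt : Matrix ℕ ℕ 𝕜} (ha : a ≠ 0) (hak : a ^ (p₂ - 1) = coupl g tt (p₂ - 1))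
    (hQt : ∀ n, Qt (n + 1) n ≠ 0) (hQt' : ∀ n m, m + 2 ≤ n → Qt n m = 0)
    (hQ : CouplingQ g tt Q Qt) :
    ∃ Qh : Band ℤ 𝕜, IsFracPower g a tt Q Qt Qh.val := by
  obtain ⟨l, rfl⟩ : ∃ l, p₂ = l + 2 := ⟨p₂ - 2, by omega⟩
  simp only [show l + 2 - 1 = l + 1 by omega] at hak
  have hXh := extTilde_isHess hQt hQt'
  set X : Band ℤ 𝕜 := hXh.1.band with hXdef
  have hXv : X.val = extTilde Qt := rfl
  obtain ⟨Y, hY, hXY, hYX⟩ := IsHess.exists_inverse (X := X) hXh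
  obtain ⟨π, hπ⟩ := exists_root_polynomial (l + 1) (coupl g tt)
  set P : Band ℤ 𝕜 := a • (X * Polynomial.aeval Y π) with hP
  have hPs := root_pow_sub_ord hπ a (X := X) hXh.1 hY hXY hYX
  have hM0 := extQ_sub_ord (by omega) hQ X hXv
  have hR : Ord (-(l + 1)) (∑ s ∈ Finset.range (l + 2), coupl g tt s • X ^ s).val := by
    rw [Band.val_sum]
    refine Ord.sum fun s hs => Ord.smul _ ((Band.ord_pow hXh.1 s).mono ?_)
    rw [Finset.mem_range] at hs
    omega
  have hMo : Ord (-(l + 1)) (extQ g tt Q Qt) := by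
    have := (hM0.mono (by omega)).add hR
    simpa using this
  set M : Band ℤ 𝕜 := hMo.band with hMdef
  have hMv : M.val = extQ g tt Q Qt := rfl
  have hself : ∑ σ ∈ Finset.range (l + 1 + 1), gam (l + 1) a (coupl g tt) (l + 1) σ • X ^ σ =
      ∑ s ∈ Finset.range (l + 2), coupl g tt s • X ^ s := by
    refine Finset.sum_congr rfl fun σ hσ => ?_
    rw [Finset.mem_range] at hσ
    rw [gam_self (by omega) ha hak (by omega)]
  -- Both matrices agree with ∑ α_s X^s modulo strictly upper terms: M by the constraint, the power
  -- of P because row l + 1 of γ is α.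
  have hMP : Ord 1 (M - P ^ (l + 1)).val := by
    have h1 := hPs (l + 1)
    rw [hself] at h1
    have h2 : M - P ^ (l + 1) = (M - ∑ s ∈ Finset.range (l + 2), coupl g tt s • X ^ s) -
      (P ^ (l + 1) - ∑ s ∈ Finset.range (l + 2), coupl g tt s • X ^ s) := by abel
    rw [h2]
    exact Ord.sub hM0 (h1.mono (by omega))
  have hPh : IsHess P.val := by
    have h1 := hPs 1
    rw [pow_one, Finset.sum_range_succ, Finset.sum_range_one, gam_diag, pow_one, pow_one,
      pow_zero] at h1
    have h2 : IsHess (a • X.val) := ⟨hXh.1.smul a, fun n m h => mul_ne_zero ha (hXh.2 n m h)⟩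
    have h3 : Ord 0 ((P - (gam (l + 1) a (coupl g tt) 1 0 • (1 : Band ℤ 𝕜) + a • X)) +
        gam (l + 1) a (coupl g tt) 1 0 • (1 : Band ℤ 𝕜)).val :=
      (h1.mono (by omega)).add (ord_one.smul _)
    have h4 := h2.add le_rfl h3
    convert h4 using 1
    simp only [Band.val_add, Band.val_sub, Band.val_smul]
    abel
  obtain ⟨R, hRP, hRM⟩ := exists_root l hPh hMP
  have hR1 : Ord (-1) R.val := by
    have := hPh.1.add (hRP.mono (e := -1) (by omega))
    simpa using this
  -- Since R - P has order l + 1, R^s - P^s has order l + 2 - s. The normalization of the powers of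
  -- P therefore passes to R.
  have hdiff : ∀ s ≤ l + 2, Ord (min s (l + 1) + 1 - s)
      (R ^ s - ∑ σ ∈ Finset.range (s + 1), gam (l + 1) a (coupl g tt) s σ • X ^ σ).val := by
    intro s hs
    have h1 := Band.ord_pow_sub_pow hR1 hPh.1 hRP s
    have h2 : R ^ s - ∑ σ ∈ Finset.range (s + 1), gam (l + 1) a (coupl g tt) s σ • X ^ σ =
      (R ^ s - P ^ s) +
        (P ^ s - ∑ σ ∈ Finset.range (s + 1), gam (l + 1) a (coupl g tt) s σ • X ^ σ) := by abel
    rw [h2]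
    exact (h1.mono (by omega)).add (hPs s)
  have hblock : ∀ s ≤ l + 2, Ord (min s (l + 1) + 1 - s) (block (lpow R.val s) -
      ∑ σ ∈ Finset.range (s + 1), gam (l + 1) a (coupl g tt) s σ • lpow Qt σ) := by
    intro s hs
    have h1 : block (∑ σ ∈ Finset.range (s + 1), gam (l + 1) a (coupl g tt) s σ • X ^ σ).val =
        ∑ σ ∈ Finset.range (s + 1), gam (l + 1) a (coupl g tt) s σ • lpow Qt σ := by
      rw [Band.val_sum]
      simp only [Band.val_smul]
      rw [block_sum_smul]
      refine Finset.sum_congr rfl fun σ _ => ?_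
      rw [block_pow X (by rw [hXv]; exact extTilde_cornerZero Qt), hXv, block_extTilde]
    rw [← h1, ← Band.val_pow]
    exact fun n m hnm => hdiff s hs n m hnm
  refine ⟨R, fun n m hnm => hR1 n m (by simp only [pos_int]; omega), ?_, fun s hs => ?_, ?_⟩
  · rw [← hMv, ← hRM, Band.val_pow]
    rfl
  · rw [← lowerDiag_sum_smul, lowerDiag_eq_iff]
    exact (hblock s (by omega)).mono (by omega)
  · rw [← strictLower_sum_smul, strictLower_eq_iff]
    exact (hblock (l + 2) le_rfl).mono (by omega)

end FracPower

/-! ### Lagrange inversion for γ. -/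

section Lagrange

variable {𝕜 : Type*} [RCLike 𝕜]

open PowerSeries

lemma coeff_X_mul_derivative (F : PowerSeries 𝕜) (n : ℕ) :
    coeff n (X * d⁄dX 𝕜 F) = n * coeff n F := by
  cases n with
  | zero => simp
  | succ n =>
    rw [coeff_succ_X_mul, coeff_derivative]
    push_cast
    ring

/-- `Y - ε Y'`. -/
def eulerDefect (Y : PowerSeries 𝕜) : PowerSeries 𝕜 := Y - X * d⁄dX 𝕜 Y

/-- With z = Y/ε this says that z^{m-1} dz has a residue only for m = 0. For m > 0, multiplying by m
turns the series into m Y^m - ε (Y^m)', whose ε^m coefficient vanishes. -/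
lemma coeff_pow_mul_inv_mul_eulerDefect {Y : PowerSeries 𝕜} (hY : constantCoeff Y ≠ 0) (m : ℕ) :
    coeff m (Y ^ m * Y⁻¹ * eulerDefect Y) = if m = 0 then 1 else 0 := by
  have hYV : Y * Y⁻¹ = 1 := PowerSeries.mul_inv_cancel Y hY
  cases m with
  | zero => simp [eulerDefect, hY]
  | succ m =>
    rw [if_neg (by omega)]
    have h1 : d⁄dX 𝕜 (Y ^ (m + 1)) = C ((m : 𝕜) + 1) * (Y ^ m * d⁄dX 𝕜 Y) := by
      rw [Derivation.leibniz_pow]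
      simp [smul_eq_mul, nsmul_eq_mul]
    have h2 : C ((m : 𝕜) + 1) * (Y ^ (m + 1) * Y⁻¹ * eulerDefect Y) =
        C ((m : 𝕜) + 1) * Y ^ (m + 1) - X * d⁄dX 𝕜 (Y ^ (m + 1)) := by
      rw [h1, eulerDefect]
      linear_combination (C ((m : 𝕜) + 1) * Y ^ m * (Y - X * d⁄dX 𝕜 Y)) * hYV
    have h3 := congrArg (coeff (m + 1)) h2
    rw [coeff_C_mul, map_sub, coeff_C_mul, coeff_X_mul_derivative] at h3
    have h4 : (m : 𝕜) + 1 ≠ 0 := by exact_mod_cast Nat.succ_ne_zero m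
    have h5 : ((m : 𝕜) + 1) * coeff (m + 1) (Y ^ (m + 1) * Y⁻¹ * eulerDefect Y) = 0 := by
      rw [h3]; push_cast; ring
    exact (mul_eq_zero.1 h5).resolve_left h4

/-- Every power series is approximated by polynomials in `X * V`, for invertible `V`. -/
lemma exists_aeval_sub_dvd {V : PowerSeries 𝕜} (hV : constantCoeff V ≠ 0) (G : PowerSeries 𝕜)
    (N : ℕ) : ∃ h : Polynomial 𝕜, X ^ N ∣ Polynomial.aeval (X * V) h - G := by
  induction N with
  | zero => exact ⟨0, by simp⟩
  | succ N ih =>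
    obtain ⟨h, R, hR⟩ := ih
    set c := constantCoeff R / constantCoeff V ^ N
    refine ⟨h - Polynomial.C c * Polynomial.X ^ N, ?_⟩
    have h1 : Polynomial.aeval (X * V) (h - Polynomial.C c * Polynomial.X ^ N) - G =
        X ^ N * (R - C c * V ^ N) := by
      rw [map_sub, map_mul, map_pow, Polynomial.aeval_C, Polynomial.aeval_X, mul_pow,
        show algebraMap 𝕜 (PowerSeries 𝕜) c = C c from rfl]
      linear_combination hR
    rw [h1, pow_succ]
    refine mul_dvd_mul_left _ ?_
    rw [X_dvd_iff]
    simp [c, hV]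

/-- Here ε Y⁻¹ is 1/z, and h(1/z) approximates Y⁻¹ = w/z. Expanding Y^{-(σ+i)} in powers of 1/z, the
residue formula above picks out the i-th coefficient of h^{σ+i}. -/
lemma lagrange_inversion {Y : PowerSeries 𝕜} (hY : constantCoeff Y ≠ 0) (N : ℕ) :
    ∃ h : Polynomial 𝕜, ∀ σ i, i < N →
      (h ^ (σ + i)).coeff i = coeff i (Y⁻¹ ^ (σ + 1) * eulerDefect Y) := by
  have hYV : Y * Y⁻¹ = 1 := PowerSeries.mul_inv_cancel Y hY
  have hV : constantCoeff Y⁻¹ ≠ 0 := by simpa using hY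
  obtain ⟨h, hh⟩ := exists_aeval_sub_dvd hV Y⁻¹ N
  refine ⟨h, fun σ i hi => ?_⟩
  set p := h ^ (σ + i) with hp
  have h1 : X ^ N ∣ Polynomial.aeval (X * Y⁻¹) p - Y⁻¹ ^ (σ + i) := by
    rw [hp, map_pow]
    exact hh.trans (sub_dvd_pow_sub_pow _ _ _)
  have h2 : Y⁻¹ ^ (σ + 1) * eulerDefect Y =
      Y⁻¹ ^ (σ + i) * (Y ^ i * Y⁻¹ * eulerDefect Y) := by
    have : Y⁻¹ ^ i * Y ^ i = 1 := by rw [← mul_pow, mul_comm, hYV, one_pow]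
    rw [pow_add, pow_add]
    linear_combination (-(Y⁻¹ ^ σ * Y⁻¹ * eulerDefect Y)) * this
  have h3 : X ^ N ∣ Polynomial.aeval (X * Y⁻¹) p * (Y ^ i * Y⁻¹ * eulerDefect Y) -
      Y⁻¹ ^ (σ + i) * (Y ^ i * Y⁻¹ * eulerDefect Y) := by
    rw [← sub_mul]
    exact h1.mul_right _
  rw [h2, ← coeff_eq_of_X_pow_dvd_sub h3 hi,
    Polynomial.aeval_eq_sum_range' (n := max (p.natDegree + 1) (i + 1)) (by omega),
    Finset.sum_mul, map_sum, Finset.sum_eq_single i]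
  · have := coeff_pow_mul_inv_mul_eulerDefect hY 0
    have h4 : p.coeff i • (X * Y⁻¹) ^ i * (Y ^ i * Y⁻¹ * eulerDefect Y) =
        p.coeff i • (X ^ i * (Y ^ 0 * Y⁻¹ * eulerDefect Y)) := by
      have : Y⁻¹ ^ i * Y ^ i = 1 := by rw [← mul_pow, mul_comm, hYV, one_pow]
      rw [smul_mul_assoc, mul_pow]
      congr 1
      linear_combination (X ^ i * Y⁻¹ * eulerDefect Y) * this
    rw [h4, coeff_smul, show coeff i (X ^ i * (Y ^ 0 * Y⁻¹ * eulerDefect Y)) =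
      coeff (0 + i) (X ^ i * (Y ^ 0 * Y⁻¹ * eulerDefect Y)) by rw [zero_add],
      coeff_X_pow_mul, this]
    simp
  · intro j _ hji
    rw [smul_mul_assoc, coeff_smul]
    rcases lt_or_gt_of_ne hji with hlt | hgt
    · obtain ⟨m, rfl⟩ := Nat.exists_eq_add_of_lt hlt
      have h4 : (X * Y⁻¹) ^ j * (Y ^ (j + m + 1) * Y⁻¹ * eulerDefect Y) =
          X ^ j * (Y ^ (m + 1) * Y⁻¹ * eulerDefect Y) := by
        have : Y⁻¹ ^ j * Y ^ j = 1 := by rw [← mul_pow, mul_comm, hYV, one_pow]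
        rw [mul_pow, show j + m + 1 = j + (m + 1) by ring, pow_add]
        linear_combination (X ^ j * Y ^ (m + 1) * Y⁻¹ * eulerDefect Y) * this
      rw [h4, show j + m + 1 = (m + 1) + j by ring, coeff_X_pow_mul,
        coeff_pow_mul_inv_mul_eulerDefect hY, if_neg (by omega), smul_zero]
    · rw [mul_pow, mul_assoc, coeff_X_pow_mul', if_neg (by omega), smul_zero]
  · intro hi'
    rw [Finset.mem_range] at hi'
    omega

/-- The coefficients `γ_{sσ}` by Lagrange inversion. -/
lemma gam_eq_coeff {k : ℕ} (hk : k ≠ 0) {Y : PowerSeries 𝕜} (hY : constantCoeff Y ≠ 0)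
    {α : ℕ → 𝕜} (hα : ∀ j ≤ k, α j = coeff (k - j) (Y⁻¹ ^ (j + 1) * eulerDefect Y)) {s σ : ℕ}
    (hσ : σ ≤ s) (hs : s - σ ≤ k) :
    gam k (constantCoeff Y)⁻¹ α s σ = coeff (s - σ) (Y⁻¹ ^ (σ + 1) * eulerDefect Y) := by
  set a := (constantCoeff Y)⁻¹ with ha
  have ha0 : a ≠ 0 := inv_ne_zero hY
  have hk' : (k : 𝕜) ≠ 0 := by exact_mod_cast hk
  have hαk : a ^ k = α k := by
    rw [hα k le_rfl, Nat.sub_self, coeff_zero_eq_constantCoeff_apply, map_mul, map_pow,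
      PowerSeries.constantCoeff_inv, ← ha, pow_succ]
    simp [eulerDefect, ha, hY]
  obtain ⟨h, hh⟩ := lagrange_inversion hY (k + 1)
  obtain ⟨π, hπ⟩ := exists_root_polynomial k α
  have hh0 : h.coeff 0 = a := by
    have := hh 1 0 (by omega)
    rw [add_zero, pow_one] at this
    rw [this, coeff_zero_eq_constantCoeff_apply, map_mul, map_pow, PowerSeries.constantCoeff_inv,
      ← ha]
    simp only [eulerDefect, map_sub, map_mul, constantCoeff_X, zero_mul, sub_zero]
    rw [pow_succ, pow_one, mul_assoc, ha, inv_mul_cancel₀ hY, mul_one]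
  have hπ0 : π.coeff 0 = 1 := by
    have := hπ 1 0 (by omega)
    rw [pow_one] at this
    rw [this]
    simp [fracBinom]
  set H : PowerSeries 𝕜 := (h : PowerSeries 𝕜)
  set P : PowerSeries 𝕜 := C a * (π : PowerSeries 𝕜) with hP
  have hPs : ∀ s i, coeff i (P ^ s) = a ^ s * (π ^ s).coeff i := fun s i => by
    rw [hP, mul_pow, ← map_pow, coeff_C_mul, ← Polynomial.coe_pow, Polynomial.coeff_coe]
  have hHs : ∀ s i, coeff i (H ^ s) = (h ^ s).coeff i := fun s i => by
    rw [← Polynomial.coe_pow, Polynomial.coeff_coe]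
  have hdvd : X ^ (k + 1) ∣ H ^ k - P ^ k := by
    rw [X_pow_dvd_iff]
    intro i hi
    have h1 := gam_of_root hπ a (s := k) (σ := k - i) (by omega) (by omega)
    rw [gam_self hk ha0 hαk (by omega), Nat.sub_sub_self (by omega)] at h1
    have h2 := hh (k - i) i hi
    rw [Nat.sub_add_cancel (by omega)] at h2
    have h3 := hα (k - i) (by omega)
    rw [Nat.sub_sub_self (by omega)] at h3
    rw [map_sub, hPs, hHs, h2, ← h1, h3, sub_self]
  -- Uniqueness of the k-th root with constant term a: in H^k - P^k = (H - P)·∑ H^i P^{k-1-i} the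
  -- sum has constant term k a^{k-1} ≠ 0, so it is a unit.
  have hHP : X ^ (k + 1) ∣ H - P := by
    rw [← (Commute.all H P).mul_geom_sum₂ k] at hdvd
    refine (IsUnit.dvd_mul_right ?_).1 hdvd
    rw [PowerSeries.isUnit_iff_constantCoeff, isUnit_iff_ne_zero, map_sum]
    have hc1 : constantCoeff H = a := by
      rw [← coeff_zero_eq_constantCoeff_apply, Polynomial.coeff_coe, hh0]
    have hc2 : constantCoeff P = a := by
      rw [hP, map_mul, constantCoeff_C, ← coeff_zero_eq_constantCoeff_apply, Polynomial.coeff_coe,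
        hπ0, mul_one]
    have : ∀ i ∈ Finset.range k, constantCoeff (H ^ i * P ^ (k - 1 - i)) = a ^ (k - 1) := by
      intro i hi
      rw [Finset.mem_range] at hi
      rw [map_mul, map_pow, map_pow, hc1, hc2, ← pow_add]
      congr 1
      omega
    rw [Finset.sum_congr rfl this, Finset.sum_const, Finset.card_range, nsmul_eq_mul]
    exact mul_ne_zero hk' (pow_ne_zero _ ha0)
  rw [gam_of_root hπ a hσ hs, ← hPs, ← coeff_eq_of_X_pow_dvd_sub
    (hHP.trans (sub_dvd_pow_sub_pow _ _ s)) (show s - σ < k + 1 by omega), hHs,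
    ← hh σ (s - σ) (by omega), Nat.add_sub_cancel' hσ]

end Lagrange

/-! ### Coefficientwise differentiation of power series. -/

section Calculus

variable {𝕜 E : Type*} [RCLike 𝕜] [NormedAddCommGroup E] [NormedSpace 𝕜 E]

open PowerSeries

/-- Coefficientwise differentiability. -/
def CoeffDiff (F : E → PowerSeries 𝕜) (x : E) : Prop :=
  ∀ n, DifferentiableAt 𝕜 (fun y => coeff n (F y)) x

/-- Coefficientwise derivative. -/
def HasCoeffDeriv (F : 𝕜 → PowerSeries 𝕜) (F' : PowerSeries 𝕜) (x : 𝕜) : Prop :=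
  ∀ n, HasDerivAt (fun y => coeff n (F y)) (coeff n F') x

lemma CoeffDiff.mul {F G : E → PowerSeries 𝕜} {x : E} (hF : CoeffDiff F x) (hG : CoeffDiff G x) :
    CoeffDiff (fun y => F y * G y) x := fun n => by
  simp only [coeff_mul]
  exact DifferentiableAt.fun_sum fun i _ => (hF _).mul (hG _)

lemma CoeffDiff.pow {F : E → PowerSeries 𝕜} {x : E} (hF : CoeffDiff F x) (s : ℕ) :
    CoeffDiff (fun y => F y ^ s) x := by
  induction s with
  | zero => intro n; simp
  | succ s ih => simpa only [pow_succ] using ih.mul hF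

lemma CoeffDiff.inv {F : E → PowerSeries 𝕜} {x : E} (hF : CoeffDiff F x)
    (h0 : constantCoeff (F x) ≠ 0) : CoeffDiff (fun y => (F y)⁻¹) x := by
  have hc : DifferentiableAt 𝕜 (fun y => (constantCoeff (F y))⁻¹) x :=
    DifferentiableAt.inv (by simpa using hF 0) h0
  intro n
  induction n using Nat.strong_induction_on with
  | _ n ih =>
    simp only [coeff_inv n]
    split_ifs with h
    · exact hc
    · refine hc.neg.mul (DifferentiableAt.fun_sum fun i _ => ?_)
      by_cases hi : i.2 < n
      · simp only [if_pos hi]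
        exact (hF _).mul (ih _ hi)
      · simp only [if_neg hi]
        exact differentiableAt_const _

lemma CoeffDiff.eulerDefect {F : E → PowerSeries 𝕜} {x : E} (hF : CoeffDiff F x) :
    CoeffDiff (fun y => eulerDefect (F y)) x := fun n => by
  simp only [TwoMatrix.eulerDefect, map_sub, coeff_X_mul_derivative]
  exact (hF n).sub ((hF n).const_mul _)

lemma HasCoeffDeriv.mul {F G : 𝕜 → PowerSeries 𝕜} {F' G' : PowerSeries 𝕜} {x : 𝕜}
    (hF : HasCoeffDeriv F F' x) (hG : HasCoeffDeriv G G' x) :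
    HasCoeffDeriv (fun y => F y * G y) (F' * G x + F x * G') x := fun n => by
  simp only [coeff_mul, map_add, ← Finset.sum_add_distrib]
  exact HasDerivAt.fun_sum fun i _ => (hF _).mul (hG _)

lemma HasCoeffDeriv.congr_deriv {F : 𝕜 → PowerSeries 𝕜} {F' G' : PowerSeries 𝕜} {x : 𝕜}
    (hF : HasCoeffDeriv F F' x) (h : F' = G') : HasCoeffDeriv F G' x := h ▸ hF

/-- Differentiability comes from the recursion for the coefficients of the inverse; the value then
follows by differentiating F F⁻¹ = 1, valid near x. -/
lemma HasCoeffDeriv.inv {F : 𝕜 → PowerSeries 𝕜} {F' : PowerSeries 𝕜} {x : 𝕜}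
    (hF : HasCoeffDeriv F F' x) (h0 : constantCoeff (F x) ≠ 0) :
    HasCoeffDeriv (fun y => (F y)⁻¹) (-((F x)⁻¹ ^ 2 * F')) x := by
  have hd : CoeffDiff (fun y => (F y)⁻¹) x := CoeffDiff.inv (fun n => (hF n).differentiableAt) h0
  set V' : PowerSeries 𝕜 := PowerSeries.mk fun n => deriv (fun y => coeff n (F y)⁻¹) x with hV'
  have hV : HasCoeffDeriv (fun y => (F y)⁻¹) V' x := fun n => by
    rw [hV', coeff_mk]
    exact (hd n).hasDerivAt
  have hev : ∀ᶠ y in nhds x, F y * (F y)⁻¹ = 1 := by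
    have hc : ContinuousAt (fun y => constantCoeff (F y)) x := by
      simpa using (hF 0).continuousAt
    filter_upwards [hc.eventually_ne h0] with y hy
    exact PowerSeries.mul_inv_cancel _ hy
  have h1 : F' * (F x)⁻¹ + F x * V' = 0 := by
    ext n
    have h2 := hF.mul hV n
    have h3 : HasDerivAt (fun y => coeff n (F y * (F y)⁻¹)) 0 x :=
      (hasDerivAt_const x (coeff n (1 : PowerSeries 𝕜))).congr_of_eventuallyEq
        (hev.mono fun y hy => by simp only [hy])
    rw [h2.unique h3, map_zero]
  refine hV.congr_deriv ?_
  have h4 := PowerSeries.mul_inv_cancel _ h0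
  linear_combination (F x)⁻¹ * h1 - V' * h4

lemma HasCoeffDeriv.inv_pow {F : 𝕜 → PowerSeries 𝕜} {F' : PowerSeries 𝕜} {x : 𝕜}
    (hF : HasCoeffDeriv F F' x) (h0 : constantCoeff (F x) ≠ 0) (s : ℕ) :
    HasCoeffDeriv (fun y => (F y)⁻¹ ^ s) (-((s : PowerSeries 𝕜) * (F x)⁻¹ ^ (s + 1) * F')) x := by
  induction s with
  | zero => intro n; simpa using hasDerivAt_const x _
  | succ s ih =>
    simp only [pow_succ _ s]
    refine (ih.mul (hF.inv h0)).congr_deriv ?_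
    push_cast
    ring

lemma HasCoeffDeriv.eulerDefect {F : 𝕜 → PowerSeries 𝕜} {F' : PowerSeries 𝕜} {x : 𝕜}
    (hF : HasCoeffDeriv F F' x) :
    HasCoeffDeriv (fun y => eulerDefect (F y)) (eulerDefect F') x := fun n => by
  simp only [TwoMatrix.eulerDefect, map_sub, coeff_X_mul_derivative]
  exact (hF n).sub ((hF n).const_mul _)

lemma derivative_inv_pow {Y : PowerSeries 𝕜} (s : ℕ) :
    d⁄dX 𝕜 (Y⁻¹ ^ s) = -((s : PowerSeries 𝕜) * Y⁻¹ ^ (s + 1) * d⁄dX 𝕜 Y) := by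
  induction s with
  | zero => simp
  | succ s ih =>
    rw [pow_succ _ s, Derivation.leibniz, ih, derivative_inv']
    simp only [smul_eq_mul]
    push_cast
    ring

/-- With G = Y^{-s} δY, the variation of Y^{-s}(Y - εY') is (1 - s)G - εG'. So the Euler operator
acts on the n-th coefficient by the scalar 1 - s - n. -/
lemma HasCoeffDeriv.coeff_inv_pow_mul_eulerDefect {F : 𝕜 → PowerSeries 𝕜} {F' : PowerSeries 𝕜}
    {x : 𝕜} (hF : HasCoeffDeriv F F' x) (h0 : constantCoeff (F x) ≠ 0) (s n : ℕ) :
    HasDerivAt (fun y => coeff n ((F y)⁻¹ ^ s * TwoMatrix.eulerDefect (F y)))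
      ((1 - s - n) * coeff n ((F x)⁻¹ ^ s * F')) x := by
  have h1 := ((hF.inv_pow h0 s).mul hF.eulerDefect) n
  convert h1 using 1
  have h2 : -((s : PowerSeries 𝕜) * (F x)⁻¹ ^ (s + 1) * F') * TwoMatrix.eulerDefect (F x) +
      (F x)⁻¹ ^ s * TwoMatrix.eulerDefect F' =
      C (1 - s : 𝕜) * ((F x)⁻¹ ^ s * F') - X * d⁄dX 𝕜 ((F x)⁻¹ ^ s * F') := by
    rw [Derivation.leibniz, derivative_inv_pow, TwoMatrix.eulerDefect, TwoMatrix.eulerDefect]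
    simp only [smul_eq_mul, map_sub, map_one, map_natCast]
    have h4 := PowerSeries.mul_inv_cancel _ h0
    linear_combination (-((s : PowerSeries 𝕜) * (F x)⁻¹ ^ s * F')) * h4
  rw [h2, map_sub, coeff_C_mul, coeff_X_mul_derivative]
  ring

/-- Because s Y^{-s-1}(Y - εY') = s Y^{-s} + ε (Y^{-s})'. It puts the Lagrange formula for γ in the
form produced by differentiating T. -/
lemma coeff_inv_pow_succ_mul_eulerDefect {Y : PowerSeries 𝕜} (h0 : constantCoeff Y ≠ 0) {s : ℕ}
    (hs : s ≠ 0) (n : ℕ) :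
    coeff n (Y⁻¹ ^ (s + 1) * eulerDefect Y) = ((s + n : ℕ) / s : 𝕜) * coeff n (Y⁻¹ ^ s) := by
  have hs' : (s : 𝕜) ≠ 0 := by exact_mod_cast hs
  have h2 : C (s : 𝕜) * (Y⁻¹ ^ (s + 1) * eulerDefect Y) =
      C (s : 𝕜) * Y⁻¹ ^ s + X * d⁄dX 𝕜 (Y⁻¹ ^ s) := by
    rw [derivative_inv_pow, eulerDefect, map_natCast]
    have h4 := PowerSeries.mul_inv_cancel _ h0
    linear_combination ((s : PowerSeries 𝕜) * Y⁻¹ ^ s) * h4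
  have h3 := congrArg (coeff n) h2
  rw [coeff_C_mul, map_add, coeff_C_mul, coeff_X_mul_derivative] at h3
  field_simp
  push_cast
  linear_combination h3

end Calculus

/-! ### The change of times and its inverse. -/

section HatTimes

variable {𝕜 : Type*} [RCLike 𝕜]

lemma tm_add {p : ℕ} (θ v : Fin p → 𝕜) (r : ℕ) : tm (θ + v) r = tm θ r + tm v r := by
  unfold tm
  split_ifs <;> simp

lemma tm_smul {p : ℕ} (c : 𝕜) (v : Fin p → 𝕜) (r : ℕ) : tm (c • v) r = c * tm v r := by
  unfold tm
  split_ifs <;> simp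

lemma tm_of_mem {p : ℕ} (θ : Fin p → 𝕜) {r : ℕ} (h1 : 1 ≤ r) (h2 : r ≤ p) :
    tm θ r = θ ⟨r - 1, by omega⟩ := by
  rw [tm, dif_pos ⟨h1, h2⟩]

lemma tm_dir {p s r : ℕ} (hs : s ≠ 0) (hsp : s ≤ p) :
    tm (dir 𝕜 p s) r = if r = s then 1 else 0 := by
  unfold tm dir
  dsimp only
  split_ifs <;> first | rfl | omega

lemma tm_ext {p : ℕ} {θ θ' : Fin p → 𝕜} (h : ∀ r, 1 ≤ r → r ≤ p → tm θ r = tm θ' r) : θ = θ' := by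
  funext i
  have := h (i + 1) (by omega) (by omega)
  rw [tm_of_mem _ (by omega) (by omega), tm_of_mem _ (by omega) (by omega)] at this
  exact this

lemma differentiable_tm {p : ℕ} (r : ℕ) : Differentiable 𝕜 (fun θ : Fin p → 𝕜 => tm θ r) := by
  unfold tm
  split_ifs <;> fun_prop

/-- The coefficients of `z / w` in powers of `w⁻¹`, where `w = (∑ α_j z^j)^{1/k}`. -/
def timeSeries (k : ℕ) (g : 𝕜) (θ : Fin (k + 1) → 𝕜) : PowerSeries 𝕜 :=
  PowerSeries.mk fun i => ((k + 1 - i : ℕ) : 𝕜) / (g * k) * tm θ (k + 1 - i)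

/-- The change of times `t̂ ↦ t̃`. -/
def hatTimes (k : ℕ) (g : 𝕜) (θ : Fin (k + 1) → 𝕜) : Fin (k + 1) → 𝕜 := fun j =>
  -(g / ((j + 1 : ℕ) : 𝕜)) * PowerSeries.coeff (k - j)
    ((timeSeries k g θ)⁻¹ ^ ((j : ℕ) + 1) * eulerDefect (timeSeries k g θ))

lemma tm_hatTimes (k : ℕ) (g : 𝕜) (θ : Fin (k + 1) → 𝕜) {σ : ℕ} (h : σ ≤ k) :
    tm (hatTimes k g θ) (σ + 1) = -(g / ((σ + 1 : ℕ) : 𝕜)) * PowerSeries.coeff (k - σ)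
      ((timeSeries k g θ)⁻¹ ^ (σ + 1) * eulerDefect (timeSeries k g θ)) := by
  rw [tm_of_mem _ (by omega) (by omega)]
  rfl

/-- `hatTimes` is designed so that α has the form required in `gam_eq_coeff`. -/
lemma coupl_hatTimes {k : ℕ} {g : 𝕜} (hg : g ≠ 0) (θ : Fin (k + 1) → 𝕜) {σ : ℕ} (h : σ ≤ k) :
    coupl g (hatTimes k g θ) σ = PowerSeries.coeff (k - σ)
      ((timeSeries k g θ)⁻¹ ^ (σ + 1) * eulerDefect (timeSeries k g θ)) := by
  have h1 : ((σ + 1 : ℕ) : 𝕜) ≠ 0 := by exact_mod_cast Nat.succ_ne_zero σ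
  rw [coupl, tm_hatTimes k g θ h]
  field_simp

lemma constantCoeff_timeSeries (k : ℕ) (g : 𝕜) (θ : Fin (k + 1) → 𝕜) :
    PowerSeries.constantCoeff (timeSeries k g θ) = ((k + 1 : ℕ) : 𝕜) / (g * k) * tm θ (k + 1) := by
  rw [← PowerSeries.coeff_zero_eq_constantCoeff_apply, timeSeries, PowerSeries.coeff_mk]
  rfl

lemma leading_eq {k : ℕ} (g : 𝕜) (θ : Fin (k + 1) → 𝕜) :
    leading g θ = (PowerSeries.constantCoeff (timeSeries k g θ))⁻¹ := by
  rw [constantCoeff_timeSeries, leading]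
  push_cast
  rw [add_sub_cancel_right, mul_inv, inv_div, div_mul_eq_div_div, div_eq_mul_inv _ (tm _ _)]

lemma constantCoeff_timeSeries_ne_zero {k : ℕ} (hk : k ≠ 0) {g : 𝕜} (hg : g ≠ 0)
    {θ : Fin (k + 1) → 𝕜} (hθ : tm θ (k + 1) ≠ 0) :
    PowerSeries.constantCoeff (timeSeries k g θ) ≠ 0 := by
  rw [constantCoeff_timeSeries]
  have h1 : ((k + 1 : ℕ) : 𝕜) ≠ 0 := by exact_mod_cast Nat.succ_ne_zero k
  have h2 : (k : 𝕜) ≠ 0 := by exact_mod_cast hk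
  positivity

lemma timeSeries_add_smul (k : ℕ) (g τ : 𝕜) (θ v : Fin (k + 1) → 𝕜) (n : ℕ) :
    PowerSeries.coeff n (timeSeries k g (θ + τ • v)) =
      PowerSeries.coeff n (timeSeries k g θ) + τ * PowerSeries.coeff n (timeSeries k g v) := by
  simp only [timeSeries, PowerSeries.coeff_mk, tm_add, tm_smul]
  ring

lemma timeSeries_dir (k : ℕ) (g : 𝕜) {s : ℕ} (hs : s ≠ 0) (hsk : s ≤ k + 1) :
    timeSeries k g (dir 𝕜 (k + 1) s) =
      PowerSeries.C ((s : 𝕜) / (g * k)) * PowerSeries.X ^ (k + 1 - s) := by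
  ext n
  rw [timeSeries, PowerSeries.coeff_mk, tm_dir hs hsk, PowerSeries.coeff_C_mul,
    PowerSeries.coeff_X_pow]
  by_cases h : k + 1 - n = s
  · rw [if_pos h, if_pos (by omega), h]
  · rw [if_neg h, if_neg (by omega), mul_zero, mul_zero]

lemma isHatTimes_hatTimes {k : ℕ} (hk : k ≠ 0) {g : 𝕜} (hg : g ≠ 0) :
    IsHatTimes g (hatTimes k g) {θ | tm θ (k + 1) ≠ 0} where
  isOpen := isOpen_ne_fun (differentiable_tm _).continuous continuous_const
  ne_zero := fun θ h => h
  differentiable := fun θ hθ => by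
    have h1 : CoeffDiff (timeSeries k g) θ := fun n => by
      simp only [timeSeries, PowerSeries.coeff_mk]
      exact ((differentiable_tm _) θ).const_mul _
    have h2 := h1.inv (constantCoeff_timeSeries_ne_zero hk hg hθ)
    rw [differentiableAt_pi]
    intro j
    exact (((h2.pow _).mul h1.eulerDefect) _).const_mul _
  normalized := fun θ hθ => by
    have h0 := constantCoeff_timeSeries_ne_zero hk hg hθ
    rw [Nat.add_sub_cancel, coupl_hatTimes hg θ le_rfl, leading_eq, Nat.sub_self,
      PowerSeries.coeff_zero_eq_constantCoeff_apply, map_mul, map_pow,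
      PowerSeries.constantCoeff_inv, pow_succ]
    simp [eulerDefect, h0]
  jacobian := fun θ hθ s hs σ hσ => by
    rw [Finset.mem_Icc] at hs hσ
    obtain ⟨σ, rfl⟩ : ∃ j, σ = j + 1 := ⟨σ - 1, by omega⟩
    have h0 := constantCoeff_timeSeries_ne_zero hk hg hθ
    have hk' : (k : 𝕜) ≠ 0 := by exact_mod_cast hk
    have hσ' : ((σ + 1 : ℕ) : 𝕜) ≠ 0 := by exact_mod_cast Nat.succ_ne_zero σ
    set Y := timeSeries k g θ with hY
    set Y' := timeSeries k g (dir 𝕜 (k + 1) s) with hY'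
    have hd : HasCoeffDeriv (fun τ : 𝕜 => timeSeries k g (θ + τ • dir 𝕜 (k + 1) s)) Y' 0 := by
      intro n
      simp only [timeSeries_add_smul, ← hY']
      simpa using ((hasDerivAt_id (0 : 𝕜)).mul_const (PowerSeries.coeff n Y')).const_add
        (PowerSeries.coeff n (timeSeries k g θ))
    have h1 := hd.coeff_inv_pow_mul_eulerDefect (by simpa using h0) (σ + 1) (k - σ)
    simp only [zero_smul, add_zero, ← hY] at h1
    have h2 := h1.const_mul (-(g / ((σ + 1 : ℕ) : 𝕜)))
    unfold HasLineDerivAt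
    simp only [tm_hatTimes k g _ (show σ ≤ k by omega)]
    refine HasDerivAt.congr_deriv h2 (Eq.symm ?_)
    rw [leading_eq, ← hY, hY', timeSeries_dir k g (by omega) hs.2,
      mul_left_comm (Y⁻¹ ^ (σ + 1)) (PowerSeries.C _), PowerSeries.coeff_C_mul,
      PowerSeries.coeff_mul_X_pow']
    by_cases hsσ : σ + 1 ≤ s
    · rw [Nat.add_sub_cancel, gam_eq_coeff hk h0 (fun j hj => coupl_hatTimes hg θ hj) hsσ (by omega),
        coeff_inv_pow_succ_mul_eulerDefect h0 (Nat.succ_ne_zero σ), if_pos (by omega),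
        show k - σ - (k + 1 - s) = s - (σ + 1) by omega, Nat.add_sub_cancel' hsσ]
      -- The scalar from the variation is -k for every σ, and it cancels the factor k in the
      -- normalization of `timeSeries`.
      have h3 : (1 - ((σ + 1 : ℕ) : 𝕜) - ((k - σ : ℕ) : 𝕜)) = -k := by
        rw [Nat.cast_sub (by omega)]
        push_cast
        ring
      rw [h3]
      field_simp
    · rw [gam, if_neg hsσ, if_neg (by omega)]
      simp

variable {k : ℕ} {g : 𝕜} {T : (Fin (k + 1) → 𝕜) → (Fin (k + 1) → 𝕜)}

/-- The leading coefficient depends only on t̂_{k+1}, which is fixed along this line. The line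
therefore stays in the domain, and the derivative of each component σ ≥ s is constant along it: a^s
for σ = s and zero above. -/
lemma IsHatTimes.tm_add_smul_dir (hT : IsHatTimes g T {θ | tm θ (k + 1) ≠ 0})
    {θ : Fin (k + 1) → 𝕜} (hθ : tm θ (k + 1) ≠ 0) {s σ : ℕ} (hs : 1 ≤ s) (hsk : s ≤ k)
    (hsσ : s ≤ σ) (hσ : σ ≤ k + 1) (τ : 𝕜) :
    tm (T (θ + τ • dir 𝕜 (k + 1) s)) σ =
      tm (T θ) σ + if s = σ then τ * leading g θ ^ σ else 0 := by
  have htop : ∀ τ : 𝕜, tm (θ + τ • dir 𝕜 (k + 1) s) (k + 1) = tm θ (k + 1) := fun τ => by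
    rw [tm_add, tm_smul, tm_dir (by omega) (by omega), if_neg (by omega), mul_zero, add_zero]
  have hlead : ∀ τ : 𝕜, leading g (θ + τ • dir 𝕜 (k + 1) s) = leading g θ := fun τ => by
    rw [leading, htop, leading]
  set c : 𝕜 := if s = σ then leading g θ ^ σ else 0 with hc
  have hder : ∀ τ : 𝕜, HasDerivAt
      (fun τ : 𝕜 => tm (T (θ + τ • dir 𝕜 (k + 1) s)) σ - τ * c) 0 τ := by
    intro τ
    have h1 := hT.jacobian (θ + τ • dir 𝕜 (k + 1) s) (by
        rw [Set.mem_ofPred_eq, htop]; exact hθ) s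
      (Finset.mem_Icc.2 ⟨hs, by omega⟩) σ (Finset.mem_Icc.2 ⟨by omega, hσ⟩)
    have h2 : gam (k + 1 - 1) (leading g (θ + τ • dir 𝕜 (k + 1) s))
        (coupl g (T (θ + τ • dir 𝕜 (k + 1) s))) s σ = c := by
      rw [hlead, hc]
      split_ifs with h
      · rw [h, gam_diag]
      · rw [gam, if_neg (by omega)]
    rw [h2] at h1
    unfold HasLineDerivAt at h1
    have h3 : HasDerivAt (fun τ' : 𝕜 => tm (T (θ + τ' • dir 𝕜 (k + 1) s)) σ) c τ := by
      have h4 : HasDerivAt (fun τ' : 𝕜 => τ' - τ) 1 τ := (hasDerivAt_id τ).sub_const τ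
      have h5 := HasDerivAt.comp_of_eq τ h1 h4 (sub_self τ).symm
      rw [mul_one] at h5
      refine h5.congr_of_eventuallyEq (Filter.Eventually.of_forall fun τ' => ?_)
      simp only [Function.comp]
      rw [add_assoc, ← add_smul, add_sub_cancel]
    exact (h3.sub ((hasDerivAt_id τ).mul_const c)).congr_deriv (by simp)
  have hconst := is_const_of_deriv_eq_zero (fun τ => (hder τ).differentiableAt)
    (fun τ => (hder τ).deriv) τ 0
  simp only [zero_smul, add_zero, zero_mul, sub_zero] at hconst
  rw [← hconst, hc]
  split_ifs <;> ring

/-- Change of the entries with labels at most `m` does not affect the later times. -/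
lemma IsHatTimes.tm_congr (hT : IsHatTimes g T {θ | tm θ (k + 1) ≠ 0})
    {θ θ' : Fin (k + 1) → 𝕜} (hθ : tm θ (k + 1) ≠ 0) {m : ℕ} (hm : m ≤ k)
    (h : ∀ r, m < r → r ≤ k + 1 → tm θ r = tm θ' r) {σ : ℕ} (hmσ : m < σ) (hσ : σ ≤ k + 1) :
    tm (T θ) σ = tm (T θ') σ := by
  induction m generalizing θ with
  | zero =>
    have : θ = θ' := tm_ext fun r h1 h2 => h r (by omega) h2
    rw [this]
  | succ m ih =>
    have h1 := hT.tm_add_smul_dir hθ (s := m + 1) (σ := σ) (by omega) hm (by omega) hσ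
      (tm θ' (m + 1) - tm θ (m + 1))
    rw [if_neg (by omega), add_zero] at h1
    rw [← h1]
    have h2 : ∀ r, tm (θ + (tm θ' (m + 1) - tm θ (m + 1)) • dir 𝕜 (k + 1) (m + 1)) r =
        tm θ r + if r = m + 1 then tm θ' (m + 1) - tm θ (m + 1) else 0 := fun r => by
      rw [tm_add, tm_smul, tm_dir (by omega) (by omega)]
      split_ifs <;> simp
    refine ih ?_ (by omega) (fun r hr1 hr2 => ?_) (by omega)
    · rw [h2, if_neg (by omega), add_zero]
      exact hθ
    · rw [h2]
      split_ifs with hr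
      · rw [hr]; ring
      · rw [add_zero]
        exact h r (by omega) hr2

lemma leading_ne_zero (hk : k ≠ 0) (hg : g ≠ 0) {θ : Fin (k + 1) → 𝕜} (hθ : tm θ (k + 1) ≠ 0) :
    leading g θ ≠ 0 := by
  rw [leading_eq]
  exact inv_ne_zero (constantCoeff_timeSeries_ne_zero hk hg hθ)

/-- Descending triangular solution: a fixes t̂_{k+1}, and then each t̂_m moves the m-th component of
T affinely with slope a^m ≠ 0, without moving the components above it. -/
lemma IsHatTimes.existsUnique (hk : k ≠ 0) (hg : g ≠ 0)
    (hT : IsHatTimes g T {θ | tm θ (k + 1) ≠ 0}) (tt : Fin (k + 1) → 𝕜) {a : 𝕜} (ha : a ≠ 0)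
    (hak : a ^ k = coupl g tt k) :
    ∃! θ : Fin (k + 1) → 𝕜, tm θ (k + 1) ≠ 0 ∧ leading g θ = a ∧ T θ = tt := by
  have hk' : (k : 𝕜) ≠ 0 := by exact_mod_cast hk
  have hk1 : ((k + 1 : ℕ) : 𝕜) ≠ 0 := by exact_mod_cast Nat.succ_ne_zero k
  have key : ∀ j ≤ k, ∃ θ : Fin (k + 1) → 𝕜, tm θ (k + 1) ≠ 0 ∧ leading g θ = a ∧
      ∀ σ, k - j < σ → σ ≤ k + 1 → tm (T θ) σ = tm tt σ := by
    intro j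
    induction j with
    | zero =>
      intro _
      -- The only value of t̂_{k+1} with leading coefficient a; the top component of T is then right
      -- by the normalization.
      set y : 𝕜 := g * k / ((k + 1 : ℕ) * a) with hy
      have hy0 : y ≠ 0 := div_ne_zero (mul_ne_zero hg hk') (mul_ne_zero hk1 ha)
      set θ := y • dir 𝕜 (k + 1) (k + 1) with hθ
      have h1 : tm θ (k + 1) = y := by
        rw [hθ, tm_smul, tm_dir (by omega) le_rfl, if_pos rfl, mul_one]
      have h0 : tm θ (k + 1) ≠ 0 := by rwa [h1]
      have h2 : leading g θ = a := by
        rw [leading_eq, constantCoeff_timeSeries, h1, hy]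
        field_simp
      refine ⟨θ, h0, h2, fun σ hσ1 hσ2 => ?_⟩
      obtain rfl : σ = k + 1 := by omega
      have h3 := hT.normalized θ h0
      rw [Nat.add_sub_cancel, h2, hak, coupl, coupl] at h3
      have h4 : -(((k + 1 : ℕ) : 𝕜) / g) ≠ 0 := neg_ne_zero.2 (div_ne_zero hk1 hg)
      exact (mul_left_cancel₀ h4 h3).symm
    | succ j ih =>
      intro hj
      obtain ⟨θ, h0, h1, h2⟩ := ih (by omega)
      obtain ⟨m, hm⟩ : ∃ m, m = k - j := ⟨_, rfl⟩
      set τ := (tm tt m - tm (T θ) m) / a ^ m with hτ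
      have htop : tm (θ + τ • dir 𝕜 (k + 1) m) (k + 1) = tm θ (k + 1) := by
        rw [tm_add, tm_smul, tm_dir (by omega) (by omega), if_neg (by omega), mul_zero, add_zero]
      refine ⟨θ + τ • dir 𝕜 (k + 1) m, by rwa [htop], by rw [leading, htop, ← h1, leading],
        fun σ hσ1 hσ2 => ?_⟩
      rw [hT.tm_add_smul_dir h0 (by omega) (by omega) (by omega) hσ2, h1]
      split_ifs with h
      · rw [← h, hτ, div_mul_cancel₀ _ (pow_ne_zero _ ha)]
        ring
      · rw [add_zero]
        exact h2 σ (by omega) hσ2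
  obtain ⟨θ, h0, h1, h2⟩ := key k le_rfl
  have hTθ : T θ = tt := tm_ext fun r hr1 hr2 => h2 r (by omega) hr2
  refine ⟨θ, ⟨h0, h1, hTθ⟩, ?_⟩
  rintro θ' ⟨h0', h1', h2'⟩
  -- Move θ to the m-th coordinate of θ', where m = k - j. By `tm_congr` the m-th component of T
  -- must then equal that of θ', which is already that of θ, so the displacement times a^m is zero.
  have agree : ∀ j ≤ k, ∀ r, k - j < r → r ≤ k + 1 → tm θ r = tm θ' r := by
    intro j
    induction j with
    | zero =>
      intro _ r hr1 hr2
      obtain rfl : r = k + 1 := by omega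
      rw [← h1', leading_eq, leading_eq, inv_inj, constantCoeff_timeSeries,
        constantCoeff_timeSeries] at h1
      exact mul_left_cancel₀ (div_ne_zero hk1 (mul_ne_zero hg hk')) h1
    | succ j ih =>
      intro hj r hr1 hr2
      have ih' := ih (by omega)
      by_cases hr : k - j < r
      · exact ih' r hr hr2
      obtain rfl : r = k - j := by omega
      have h3 := hT.tm_add_smul_dir h0 (s := k - j) (σ := k - j) (by omega) (by omega) le_rfl
        (by omega) (tm θ' (k - j) - tm θ (k - j))
      rw [if_pos rfl, h1] at h3
      have h4 : ∀ r, tm (θ + (tm θ' (k - j) - tm θ (k - j)) • dir 𝕜 (k + 1) (k - j)) r =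
          tm θ r + if r = k - j then tm θ' (k - j) - tm θ (k - j) else 0 := fun r => by
        rw [tm_add, tm_smul, tm_dir (by omega) (by omega)]
        split_ifs <;> simp
      have h5 := hT.tm_congr
        (θ := θ + (tm θ' (k - j) - tm θ (k - j)) • dir 𝕜 (k + 1) (k - j)) (θ' := θ')
        (by rw [h4, if_neg (by omega), add_zero]; exact h0) (m := k - j - 1) (by omega)
        (fun r hr1 hr2 => by
          rw [h4]
          split_ifs with h
          · rw [h]; ring
          · rw [add_zero]; exact ih' r (by omega) hr2) (σ := k - j) (by omega) (by omega)
      rw [h5, h2', hTθ] at h3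
      have h6 : (tm θ' (k - j) - tm θ (k - j)) * a ^ (k - j) = 0 := by
        linear_combination -h3
      exact (sub_eq_zero.1 ((mul_eq_zero.1 h6).resolve_right (pow_ne_zero _ ha))).symm
  exact (tm_ext fun r hr1 hr2 => agree k le_rfl r (by omega) hr2).symm

end HatTimes

/-! ### Triangular parts, row bounds and commutators on ℕ. -/

section Parts

variable {𝕜 : Type*} [RCLike 𝕜]

lemma Ord.strictLower {d : ℤ} {A : Matrix ℕ ℕ 𝕜} (h : Ord d A) : Ord d (strictLower A) :=
  fun n m hnm => by simp [TwoMatrix.strictLower, h n m hnm]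

lemma Ord.upperDiag {d : ℤ} {A : Matrix ℕ ℕ 𝕜} (h : Ord d A) : Ord d (upperDiag A) :=
  fun n m hnm => by simp [TwoMatrix.upperDiag, h n m hnm]

/-- The strictly lower triangular part. -/
def Band.lower (A : Band ℕ 𝕜) : Band ℕ 𝕜 := A.exists_ord.choose_spec.strictLower.band

/-- The upper triangular part. -/
def Band.upper (A : Band ℕ 𝕜) : Band ℕ 𝕜 := A.exists_ord.choose_spec.upperDiag.band

@[simp] lemma Band.val_lower (A : Band ℕ 𝕜) : A.lower.val = strictLower A.val := rfl

@[simp] lemma Band.val_upper (A : Band ℕ 𝕜) : A.upper.val = upperDiag A.val := rfl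

lemma upperDiag_add_strictLower (A : Matrix ℕ ℕ 𝕜) : upperDiag A + strictLower A = A := by
  ext n m
  simp only [upperDiag, strictLower, Matrix.add_apply, Matrix.of_apply]
  by_cases h : n ≤ m
  · simp [h, Nat.not_lt.2 h]
  · simp [h, Nat.lt_of_not_le h]

lemma Band.upper_add_lower (A : Band ℕ 𝕜) : A.upper + A.lower = A :=
  Band.ext (upperDiag_add_strictLower A.val)

lemma strictLower_one : strictLower (1 : Matrix ℕ ℕ 𝕜) = 0 := by
  ext n m
  simp only [strictLower, Matrix.of_apply, Matrix.zero_apply]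
  split_ifs with h
  · exact Matrix.one_apply_ne (by omega)
  · rfl

lemma strictLower_lowerDiag (A : Matrix ℕ ℕ 𝕜) : strictLower (lowerDiag A) = strictLower A := by
  ext n m
  simp only [strictLower, lowerDiag, Matrix.of_apply]
  grind

/-- `A` is strictly lower triangular. -/
def IsLower (A : Matrix ℕ ℕ 𝕜) : Prop := ∀ n m, n ≤ m → A n m = 0

lemma isLower_strictLower (A : Matrix ℕ ℕ 𝕜) : IsLower (strictLower A) := fun n m h => by
  simp [strictLower, Nat.not_lt.2 h]

lemma IsLower.lmul {A B : Matrix ℕ ℕ 𝕜} (hA : IsLower A) (hB : IsLower B) :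
    IsLower (lmul A B) := fun n m h => by
  refine (finsum_congr fun k => ?_).trans finsum_zero
  by_cases hk : n ≤ k
  · rw [hA n k hk, zero_mul]
  · rw [hB k m (by omega), mul_zero]

lemma IsLower.sum_smul {σ : Type*} (s : Finset σ) (c : σ → 𝕜) {A : σ → Matrix ℕ ℕ 𝕜}
    (h : ∀ i ∈ s, IsLower (A i)) : IsLower (∑ i ∈ s, c i • A i) := fun n m hnm => by
  rw [Matrix.sum_apply]
  exact Finset.sum_eq_zero fun i hi => by rw [Matrix.smul_apply, h i hi n m hnm, smul_zero]

/-- The rows of `A` vanish from distance `c` to the right of the diagonal on. -/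
def RowBand (c : ℕ) (A : Matrix ℕ ℕ 𝕜) : Prop := ∀ n m, n + c ≤ m → A n m = 0

lemma RowBand.lmul_apply {c : ℕ} {A : Matrix ℕ ℕ 𝕜} (hA : RowBand c A) (B : Matrix ℕ ℕ 𝕜)
    (n m : ℕ) : lmul A B n m = ∑ k ∈ Finset.range (n + c), A n k * B k m := by
  refine finsum_eq_sum_of_support_subset _ fun k hk => ?_
  by_contra h
  simp only [Finset.coe_range, Set.mem_Iio, not_lt] at h
  exact hk (by dsimp only; rw [hA n k h, zero_mul])

lemma RowBand.lmul {c d : ℕ} {A B : Matrix ℕ ℕ 𝕜} (hA : RowBand c A) (hB : RowBand d B) :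
    RowBand (c + d) (lmul A B) := fun n m h => by
  refine (finsum_congr fun k => ?_).trans finsum_zero
  by_cases hk : n + c ≤ k
  · rw [hA n k hk, zero_mul]
  · rw [hB k m (by omega), mul_zero]

lemma RowBand.lpow {c : ℕ} {A : Matrix ℕ ℕ 𝕜} (hA : RowBand c A) (r : ℕ) :
    RowBand (r * c + 1) (lpow A r) := by
  induction r with
  | zero => exact fun n m h => Matrix.one_apply_ne (by omega)
  | succ r ih => exact fun n m h => ih.lmul hA n m (by rw [add_mul] at h; omega)

/-- A matrix with vanishing first row that commutes with a Hessenberg matrix is zero. -/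
lemma Band.eq_zero_of_commute {q D : Band ℕ 𝕜} (h1 : ∀ n, q.val n (n + 1) = 1)
    (h2 : RowBand 2 q.val) (h0 : ∀ m, D.val 0 m = 0) (hc : q * D = D * q) : D = 0 := by
  suffices ∀ n m, D.val n m = 0 from Band.ext (by ext n m; exact this n m)
  intro n
  induction n using Nat.strong_induction_on with
  | _ n ih =>
    intro m
    cases n with
    | zero => exact h0 m
    | succ n =>
      have h3 := congrFun (congrFun (congrArg Band.val hc) n) m
      -- Row n of q ends with the entry 1 in column n + 1, so row n of qD = Dq expresses row n + 1
      -- of D through the earlier rows.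
      rw [val_mul, val_mul, h2.lmul_apply, Finset.sum_range_succ, h1, one_mul,
        Finset.sum_eq_zero fun k hk => by
          rw [Finset.mem_range] at hk; rw [ih k (by omega) m, mul_zero], zero_add] at h3
      rw [h3]
      refine (finsum_congr fun k => ?_).trans finsum_zero
      rw [ih n (by omega) k, zero_mul]

/-- Commutation with b is a derivation. The truncated exponent at r = 0 is harmless, as its
coefficient is zero. -/
lemma Band.pow_commutator {q b : Band ℕ 𝕜} {c : 𝕜} (h : q * b - b * q = c • 1) (r : ℕ) :
    q ^ r * b - b * q ^ r = (r * c) • q ^ (r - 1) := by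
  induction r with
  | zero => simp
  | succ r ih =>
    have h1 : q ^ (r + 1) * b - b * q ^ (r + 1) =
        q ^ r * (q * b - b * q) + (q ^ r * b - b * q ^ r) * q := by
      rw [pow_succ]; noncomm_ring
    rw [h1, h, ih, mul_smul_comm, mul_one, smul_mul_assoc, Nat.add_sub_cancel]
    cases r with
    | zero => simp
    | succ r =>
      rw [Nat.add_sub_cancel, ← pow_succ, ← add_smul]
      congr 1
      push_cast
      ring

end Parts

/-! ### Differentiating matrix products; the flows of the second matrix. -/

section Flow

variable {𝕜 E : Type*} [RCLike 𝕜] [NormedAddCommGroup E] [NormedSpace 𝕜 E]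

open Filter Topology

lemma HasLineDerivAt.unique_of_eventuallyEq {f f' : E → 𝕜} {x v : E} {a b : 𝕜}
    (hf : HasLineDerivAt 𝕜 f a x v) (hf' : HasLineDerivAt 𝕜 f' b x v) (h : f =ᶠ[𝓝 x] f') :
    a = b := by
  have h1 : Tendsto (fun t : 𝕜 => x + t • v) (𝓝 0) (𝓝 x) := by
    have : Continuous (fun t : 𝕜 => x + t • v) := by fun_prop
    simpa using this.tendsto 0
  exact HasDerivAt.unique hf (HasDerivAt.congr_of_eventuallyEq hf' (h1.eventually h))

lemma FlowAt.unique {A : E → Matrix ℕ ℕ 𝕜} {x v : E} {X Y : Matrix ℕ ℕ 𝕜}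
    (hX : FlowAt A x v X) (hY : FlowAt A x v Y) : X = Y := by
  ext n m
  exact HasDerivAt.unique (hX n m) (hY n m)

lemma FlowAt.eq_zero {A : E → Matrix ℕ ℕ 𝕜} {x v : E} {X : Matrix ℕ ℕ 𝕜} (hX : FlowAt A x v X)
    {n m : ℕ} (h : ∀ᶠ y in 𝓝 x, A y n m = 0) : X n m = 0 :=
  HasLineDerivAt.unique_of_eventuallyEq (hX n m) (f' := fun _ => 0)
    (hasDerivAt_const (0 : 𝕜) (0 : 𝕜)) h

/-- The row bound, uniform near x, makes each entry of the product a sum over one fixed finite set,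
so the Leibniz rule applies termwise. -/
lemma FlowAt.lmul {A B : E → Matrix ℕ ℕ 𝕜} {x v : E} {X Y : Matrix ℕ ℕ 𝕜} (hA : FlowAt A x v X)
    (hB : FlowAt B x v Y) {c : ℕ} (hc : ∀ᶠ y in 𝓝 x, RowBand c (A y)) :
    FlowAt (fun y => lmul (A y) (B y)) x v (lmul X (B x) + lmul (A x) Y) := by
  intro n m
  have hX : RowBand c X := fun n m h => hA.eq_zero (hc.mono fun y hy => hy n m h)
  have h1 : Tendsto (fun t : 𝕜 => x + t • v) (𝓝 0) (𝓝 x) := by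
    have : Continuous (fun t : 𝕜 => x + t • v) := by fun_prop
    simpa using this.tendsto 0
  have h2 : HasDerivAt
      (fun t : 𝕜 => ∑ k ∈ Finset.range (n + c), A (x + t • v) n k * B (x + t • v) k m)
      (∑ k ∈ Finset.range (n + c), (X n k * B x k m + A x n k * Y k m)) 0 := by
    refine HasDerivAt.fun_sum fun k _ => ?_
    refine HasDerivAt.congr_deriv (HasDerivAt.mul (hA n k) (hB k m)) ?_
    simp
  rw [Matrix.add_apply, hX.lmul_apply, hc.self_of_nhds.lmul_apply, ← Finset.sum_add_distrib]
  refine HasDerivAt.congr_of_eventuallyEq h2 ?_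
  filter_upwards [h1.eventually hc] with t ht
  exact ht.lmul_apply _ n m

/-- Commutation with C is a derivation, so the flow of A has the same form on its powers. -/
lemma FlowAt.lpow {A : E → Matrix ℕ ℕ 𝕜} {x v : E} {q C : Band ℕ 𝕜} (hq : q.val = A x)
    (hA : FlowAt A x v (q * C - C * q).val) {c : ℕ} (hc : ∀ᶠ y in 𝓝 x, RowBand c (A y)) (r : ℕ) :
    FlowAt (fun y => lpow (A y) r) x v (q ^ r * C - C * q ^ r).val := by
  induction r with
  | zero =>
    intro n m
    exact HasDerivAt.congr_deriv (hasDerivAt_const (0 : 𝕜) ((1 : Matrix ℕ ℕ 𝕜) n m))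
      (by rw [pow_zero, one_mul, mul_one, sub_self]; rfl)
  | succ r ih =>
    have h1 := ih.lmul hA (hc.mono fun y hy => hy.lpow r)
    have h2 : q ^ (r + 1) * C - C * q ^ (r + 1) =
        (q ^ r * C - C * q ^ r) * q + q ^ r * (q * C - C * q) := by
      rw [pow_succ]; noncomm_ring
    rw [h2]
    simp only [← hq, ← Band.val_pow] at h1
    exact h1

lemma coupl_add_smul {p : ℕ} (g c : 𝕜) (t u : Fin p → 𝕜) (r : ℕ) :
    coupl g (t + c • u) r = coupl g t r + c * coupl g u r := by
  simp only [coupl, tm_add, tm_smul]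
  ring

lemma CouplingQt.upperDiag_eq {p₁ : ℕ} (hp₁ : 1 ≤ p₁) {g : 𝕜} {t : Fin p₁ → 𝕜}
    {Q Qt : Matrix ℕ ℕ 𝕜} (h : CouplingQt g t Q Qt) :
    upperDiag Qt = ∑ r ∈ Finset.range p₁, coupl g t r • upperDiag (lpow Q r) := by
  obtain ⟨k, rfl⟩ : ∃ k, p₁ = k + 1 := ⟨p₁ - 1, by omega⟩
  have h1 : upperDiag (1 : Matrix ℕ ℕ 𝕜) = 1 := by
    ext n m
    simp only [upperDiag, Matrix.of_apply, Matrix.one_apply]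
    grind
  have h2 : Finset.Icc 1 (k + 1 - 1) = Finset.Ico 1 (k + 1) := by ext; simp
  rw [h, h2, Finset.sum_Ico_eq_sum_range, Finset.sum_range_succ', TwoMatrix.lpow, h1,
    sub_eq_add_neg, ← Finset.sum_neg_distrib, ← neg_smul]
  congr 1
  · refine Finset.sum_congr rfl fun s _ => ?_
    rw [← neg_smul, add_comm 1 s, coupl, neg_mul]
  · simp [coupl]

/-- The flow of `Q̃` follows from that of `Q`, the constraint on the upper triangular part of `Q̃`
and the string equation. -/
lemma flow_second {p₁ p₂ : ℕ} (hp₁ : 1 ≤ p₁) {g : 𝕜} (hg : g ≠ 0)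
    {A B : (Fin p₁ → 𝕜) × (Fin p₂ → 𝕜) → Matrix ℕ ℕ 𝕜} {x v : (Fin p₁ → 𝕜) × (Fin p₂ → 𝕜)}
    {q b C : Band ℕ 𝕜} (hq : q.val = A x) (hb : b.val = B x) (hC : IsLower C.val)
    (hA1 : ∀ n, A x n (n + 1) = 1) (hA2 : ∀ᶠ y in 𝓝 x, RowBand 2 (A y))
    (hB1 : ∀ᶠ y in 𝓝 x, Ord (-1) (B y)) (hB2 : ∀ᶠ y in 𝓝 x, RowBand p₁ (B y))
    (hc : ∀ᶠ y in 𝓝 x, CouplingQt g y.1 (A y) (B y))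
    (hs : ∀ᶠ y in 𝓝 x, (1 : Matrix ℕ ℕ 𝕜) = -(g • lcomm (A y) (B y)))
    (hA : FlowAt A x v (q * C - C * q).val) {X : Matrix ℕ ℕ 𝕜} (hX : FlowAt B x v X) :
    X = (b * C - C * b + ∑ r ∈ Finset.range p₁, coupl g v.1 r • q ^ r).val := by
  have hXo : Ord (-1) X := fun n m h => hX.eq_zero (hB1.mono fun y hy => hy n m h)
  set B' : Band ℕ 𝕜 := hXo.band with hB'
  have hB'v : B'.val = X := rfl
  set e : Band ℕ 𝕜 := ∑ r ∈ Finset.range p₁, coupl g v.1 r • q ^ r with he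
  set S : Band ℕ 𝕜 := ∑ r ∈ Finset.range p₁, coupl g x.1 r • q ^ r with hS
  -- The deviation from the expected derivative; e is the contribution of the explicit dependence of
  -- the constraint on t.
  set D : Band ℕ 𝕜 := B' - (b * C - C * b) - e with hD
  have hqe : q * e = e * q := by
    rw [he, Finset.mul_sum, Finset.sum_mul]
    refine Finset.sum_congr rfl fun r _ => ?_
    rw [mul_smul_comm, smul_mul_assoc, ← pow_succ', ← pow_succ]
  have hupper : ∀ n m, n ≤ m → D.val n m = 0 := by
    intro n m hnm
    have hev : (fun y => B y n m) =ᶠ[𝓝 x]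
        fun y => ∑ r ∈ Finset.range p₁, coupl g y.1 r * lpow (A y) r n m := by
      filter_upwards [hc] with y hy
      have := congrFun (congrFun (hy.upperDiag_eq hp₁) n) m
      rw [← upperDiag_sum_smul] at this
      simp only [upperDiag, Matrix.of_apply, if_pos hnm] at this
      rw [this, Matrix.sum_apply]
      rfl
    have hder : HasLineDerivAt 𝕜
        (fun y : (Fin p₁ → 𝕜) × (Fin p₂ → 𝕜) =>
          ∑ r ∈ Finset.range p₁, coupl g y.1 r * lpow (A y) r n m)
        (∑ r ∈ Finset.range p₁, (coupl g v.1 r * lpow (A x) r n m +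
          coupl g x.1 r * (q ^ r * C - C * q ^ r).val n m)) x v := by
      refine HasDerivAt.fun_sum fun r _ => ?_
      have h1 : HasDerivAt (fun t : 𝕜 => coupl g (x + t • v).1 r) (coupl g v.1 r) 0 := by
        simp only [Prod.fst_add, Prod.smul_fst, coupl_add_smul]
        simpa using ((hasDerivAt_id (0 : 𝕜)).mul_const (coupl g v.1 r)).const_add (coupl g x.1 r)
      refine HasDerivAt.congr_deriv (HasDerivAt.mul h1 (FlowAt.lpow hq hA hA2 r n m)) ?_
      simp
    have h3 := HasLineDerivAt.unique_of_eventuallyEq (hX n m) hder hev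
    have h4 : X n m = e.val n m + (S * C - C * S).val n m := by
      rw [h3, Finset.sum_add_distrib]
      congr 1
      · rw [he, Band.val_sum, Matrix.sum_apply]
        simp [hq]
      · have : S * C - C * S =
            ∑ r ∈ Finset.range p₁, coupl g x.1 r • (q ^ r * C - C * q ^ r) := by
          rw [hS, Finset.sum_mul, Finset.mul_sum, ← Finset.sum_sub_distrib]
          refine Finset.sum_congr rfl fun r _ => ?_
          rw [smul_mul_assoc, mul_smul_comm, smul_sub]
        rw [this, Band.val_sum, Matrix.sum_apply]
        simp
    -- As b - S and C are both strictly lower, [b, C] and [S, C] agree on and above the diagonal,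
    -- and [S, C] comes from differentiating the powers in the constraint.
    have hbS : IsLower (b - S).val := by
      intro i j hij
      have := congrFun (congrFun (hc.self_of_nhds.upperDiag_eq hp₁) i) j
      rw [← upperDiag_sum_smul] at this
      simp only [upperDiag, Matrix.of_apply, if_pos hij] at this
      rw [Band.val_sub, Matrix.sub_apply, hb, this, hS, Band.val_sum]
      simp [Matrix.sum_apply, hq]
    have h5 : D = B' - e - (S * C - C * S) - ((b - S) * C - C * (b - S)) := by
      rw [hD]; noncomm_ring
    have h6 : ((b - S) * C).val n m = 0 := hbS.lmul hC n m hnm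
    have h7 : (C * (b - S)).val n m = 0 := hC.lmul hbS n m hnm
    rw [h5, Band.val_sub, Matrix.sub_apply, Band.val_sub _ (C * (b - S)), Matrix.sub_apply, h6, h7,
      Band.val_sub, Matrix.sub_apply, Band.val_sub, Matrix.sub_apply, hB'v, h4]
    ring
  have hstr0 : q * b - b * q = (-g⁻¹) • (1 : Band ℕ 𝕜) := by
    apply Band.ext
    rw [Band.val_comm, hq, hb, Band.val_smul, Band.val_one, hs.self_of_nhds, smul_neg, neg_smul,
      neg_neg, smul_smul, inv_mul_cancel₀ hg, one_smul]
  -- The derivative of the string equation, whose other side is constant.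
  have hcomm : (q * C - C * q) * b + q * B' - (B' * q + b * (q * C - C * q)) = 0 := by
    apply Band.ext
    have h1 := hA.lmul hX hA2
    have h2 := hX.lmul hA hB2
    rw [← hq, ← hb] at h1 h2
    ext n m
    have h3 : HasLineDerivAt 𝕜 (fun y => lmul (A y) (B y) n m - lmul (B y) (A y) n m)
        (((q * C - C * q) * b + q * B' - (B' * q + b * (q * C - C * q))).val n m) x v :=
      HasDerivAt.sub (h1 n m) (h2 n m)
    refine HasLineDerivAt.unique_of_eventuallyEq h3
      (f' := fun _ => -g⁻¹ * (1 : Matrix ℕ ℕ 𝕜) n m) (hasDerivAt_const (0 : 𝕜) _) ?_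
    filter_upwards [hs] with y hy
    rw [hy]
    simp only [lcomm, Matrix.neg_apply, Matrix.smul_apply, Matrix.sub_apply, smul_eq_mul]
    field_simp
  -- By the Jacobi identity [q, D] equals the differentiated string equation minus [[q, b], C] and
  -- [q, e]. These vanish because [q, b] is scalar and e is a polynomial in q.
  have hqD : q * D = D * q := by
    have h1 : q * D - D * q = ((q * C - C * q) * b + q * B' - (B' * q + b * (q * C - C * q))) -
        ((q * b - b * q) * C - C * (q * b - b * q)) - (q * e - e * q) := by
      rw [hD]; noncomm_ring
    rw [hcomm, hstr0, hqe] at h1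
    simp only [smul_mul_assoc, mul_smul_comm, one_mul, mul_one, sub_self] at h1
    exact sub_eq_zero.1 h1
  have hD0 := Band.eq_zero_of_commute (by rw [hq]; exact hA1) (by rw [hq]; exact hA2.self_of_nhds)
    (fun m => hupper 0 m (Nat.zero_le m)) hqD
  have : B' = b * C - C * b + e := by
    rw [hD, sub_sub, sub_eq_zero] at hD0
    exact hD0
  rw [← hB'v, this]

end Flow

/-! ### The chain rule for the change of times. -/

section Pullback

variable {𝕜 : Type*} [RCLike 𝕜] {p₁ p₂ : ℕ}

/-- The entrywise derivative of a matrix-valued function. -/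
def dMat (A : (Fin p₁ → 𝕜) × (Fin p₂ → 𝕜) → Matrix ℕ ℕ 𝕜) (y v : (Fin p₁ → 𝕜) × (Fin p₂ → 𝕜)) :
    Matrix ℕ ℕ 𝕜 :=
  Matrix.of fun n m => fderiv 𝕜 (fun z => A z n m) y v

lemma flowAt_iff {A : (Fin p₁ → 𝕜) × (Fin p₂ → 𝕜) → Matrix ℕ ℕ 𝕜}
    {y v : (Fin p₁ → 𝕜) × (Fin p₂ → 𝕜)} (hA : ∀ n m, DifferentiableAt 𝕜 (fun z => A z n m) y)
    {X : Matrix ℕ ℕ 𝕜} : FlowAt A y v X ↔ dMat A y v = X := by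
  have h1 : FlowAt A y v (dMat A y v) := fun n m => (hA n m).hasFDerivAt.hasLineDerivAt v
  exact ⟨fun h => h1.unique h, fun h => h ▸ h1⟩

lemma eq_sum_dir (v : Fin p₂ → 𝕜) : v = ∑ σ ∈ Finset.Icc 1 p₂, tm v σ • dir 𝕜 p₂ σ := by
  refine tm_ext fun r hr1 hr2 => ?_
  have h1 : tm (∑ σ ∈ Finset.Icc 1 p₂, tm v σ • dir 𝕜 p₂ σ) r =
      ∑ σ ∈ Finset.Icc 1 p₂, tm v σ * tm (dir 𝕜 p₂ σ) r := by
    simp only [tm_of_mem _ hr1 hr2, Finset.sum_apply, Pi.smul_apply, smul_eq_mul]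
  rw [h1, Finset.sum_eq_single r]
  · rw [tm_dir (by omega) hr2, if_pos rfl, mul_one]
  · intro σ hσ hne
    rw [Finset.mem_Icc] at hσ
    rw [tm_dir (by omega) hσ.2, if_neg (Ne.symm hne), mul_zero]
  · intro h
    exact absurd (Finset.mem_Icc.2 ⟨hr1, hr2⟩) h

variable {g : 𝕜} {T : (Fin p₂ → 𝕜) → (Fin p₂ → 𝕜)} {W : Set (Fin p₂ → 𝕜)}

lemma IsHatTimes.fderiv_dir (hT : IsHatTimes g T W) {θ : Fin p₂ → 𝕜} (hθ : θ ∈ W) {s : ℕ}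
    (hs : s ∈ Finset.Icc 1 p₂) :
    fderiv 𝕜 T θ (dir 𝕜 p₂ s) = ∑ σ ∈ Finset.Icc 1 p₂,
      gam (p₂ - 1) (leading g θ) (coupl g (T θ)) s σ • dir 𝕜 p₂ σ := by
  rw [eq_sum_dir (fderiv 𝕜 T θ (dir 𝕜 p₂ s))]
  refine Finset.sum_congr rfl fun σ hσ => ?_
  congr 1
  have h1 := hT.jacobian θ hθ s hs σ hσ
  rw [Finset.mem_Icc] at hσ
  have h2 : HasFDerivAt (fun θ' => tm (T θ') σ)
      ((ContinuousLinearMap.proj (R := 𝕜) (φ := fun _ : Fin p₂ => 𝕜)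
        (⟨σ - 1, by omega⟩ : Fin p₂)).comp (fderiv 𝕜 T θ)) θ := by
    simp only [tm_of_mem _ hσ.1 hσ.2]
    exact (ContinuousLinearMap.proj (R := 𝕜) (φ := fun _ : Fin p₂ => 𝕜)
      (⟨σ - 1, by omega⟩ : Fin p₂)).hasFDerivAt.comp θ (hT.differentiable θ hθ).hasFDerivAt
  have h3 := HasDerivAt.unique (h2.hasLineDerivAt (dir 𝕜 p₂ s)) h1
  rw [← h3, tm_of_mem _ hσ.1 hσ.2]
  rfl

lemma hasFDerivAt_timeMap (hT : IsHatTimes g T W) {x : (Fin p₁ → 𝕜) × (Fin p₂ → 𝕜)}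
    (hx : x.2 ∈ W) : HasFDerivAt (timeMap T)
      ((ContinuousLinearMap.fst 𝕜 (Fin p₁ → 𝕜) (Fin p₂ → 𝕜)).prod
        ((fderiv 𝕜 T x.2).comp (ContinuousLinearMap.snd 𝕜 (Fin p₁ → 𝕜) (Fin p₂ → 𝕜)))) x :=
  hasFDerivAt_fst.prodMk ((hT.differentiable _ hx).hasFDerivAt.comp x hasFDerivAt_snd)

variable {A : (Fin p₁ → 𝕜) × (Fin p₂ → 𝕜) → Matrix ℕ ℕ 𝕜} {x : (Fin p₁ → 𝕜) × (Fin p₂ → 𝕜)}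

lemma flowAt_comp (hT : IsHatTimes g T W) (hx : x.2 ∈ W)
    (hA : ∀ n m, DifferentiableAt 𝕜 (fun z => A z n m) (timeMap T x))
    (v : (Fin p₁ → 𝕜) × (Fin p₂ → 𝕜)) :
    FlowAt (fun x => A (timeMap T x)) x v
      (dMat A (timeMap T x) (v.1, fderiv 𝕜 T x.2 v.2)) := fun n m =>
  HasFDerivAt.hasLineDerivAt ((hA n m).hasFDerivAt.comp x (hasFDerivAt_timeMap hT hx)) v

lemma flowAt_comp_fst (hT : IsHatTimes g T W) (hx : x.2 ∈ W)
    (hA : ∀ n m, DifferentiableAt 𝕜 (fun z => A z n m) (timeMap T x)) (u : Fin p₁ → 𝕜) :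
    FlowAt (fun x => A (timeMap T x)) x (u, 0) (dMat A (timeMap T x) (u, 0)) := by
  simpa using flowAt_comp hT hx hA (u, 0)

lemma flowAt_comp_snd (hT : IsHatTimes g T W) (hx : x.2 ∈ W)
    (hA : ∀ n m, DifferentiableAt 𝕜 (fun z => A z n m) (timeMap T x)) {s : ℕ}
    (hs : s ∈ Finset.Icc 1 p₂) :
    FlowAt (fun x => A (timeMap T x)) x (0, dir 𝕜 p₂ s) (∑ σ ∈ Finset.Icc 1 p₂,
      gam (p₂ - 1) (leading g x.2) (coupl g (T x.2)) s σ •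
        dMat A (timeMap T x) (0, dir 𝕜 p₂ σ)) := by
  convert flowAt_comp hT hx hA (0, dir 𝕜 p₂ s) using 1
  ext n m
  rw [hT.fderiv_dir hx hs]
  have : ((0 : Fin p₁ → 𝕜), ∑ σ ∈ Finset.Icc 1 p₂,
      gam (p₂ - 1) (leading g x.2) (coupl g (T x.2)) s σ • dir 𝕜 p₂ σ) =
      ∑ σ ∈ Finset.Icc 1 p₂, gam (p₂ - 1) (leading g x.2) (coupl g (T x.2)) s σ •
        ((0 : Fin p₁ → 𝕜), dir 𝕜 p₂ σ) := by
    ext i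
    · simp [Prod.fst_sum]
    · simp [Prod.snd_sum]
  simp only [this, dMat, Matrix.of_apply, map_sum, map_smul, Matrix.sum_apply, Matrix.smul_apply]

end Pullback

/-- Inverts the Jacobian γ, so that flow equations in t̂ imply those in t̃. -/
lemma triangular_inj {𝕜 V : Type*} [Field 𝕜] [AddCommGroup V] [Module 𝕜 V] {p : ℕ}
    {c : ℕ → ℕ → 𝕜} (hc : ∀ s σ, s < σ → c s σ = 0) (hd : ∀ s, c s s ≠ 0) {M N : ℕ → V}
    (h : ∀ s ∈ Finset.Icc 1 p, ∑ σ ∈ Finset.Icc 1 p, c s σ • M σ =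
      ∑ σ ∈ Finset.Icc 1 p, c s σ • N σ) : ∀ s ∈ Finset.Icc 1 p, M s = N s := by
  intro s
  induction s using Nat.strong_induction_on with
  | _ s ih =>
    intro hs
    have h1 := h s hs
    rw [← sub_eq_zero, ← Finset.sum_sub_distrib, Finset.sum_eq_single s] at h1
    · rw [← smul_sub, smul_eq_zero] at h1
      exact sub_eq_zero.1 (h1.resolve_left (hd s))
    · intro σ hσ hne
      rcases lt_or_gt_of_ne hne with hlt | hgt
      · rw [ih σ hlt hσ, sub_self]
      · rw [hc s σ hgt, zero_smul, zero_smul, sub_self]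
    · exact fun hn => absurd hs hn

/-! ### Equivalence of the two systems under the constraints. -/

section Systems

variable {𝕜 : Type*} [RCLike 𝕜] {p₁ p₂ : ℕ}

/-- Pairs of Toda matrices that satisfy both constraints, in the two systems of times, together with
the fractional power. -/
structure Constrained (g : 𝕜) (T : (Fin p₂ → 𝕜) → (Fin p₂ → 𝕜)) (W : Set (Fin p₂ → 𝕜))
    (Ωh : Set ((Fin p₁ → 𝕜) × (Fin p₂ → 𝕜)))
    (Q Qt : (Fin p₁ → 𝕜) × (Fin p₂ → 𝕜) → Matrix ℕ ℕ 𝕜)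
    (Qh : (Fin p₁ → 𝕜) × (Fin p₂ → 𝕜) → Matrix ℤ ℤ 𝕜) : Prop where
  one_le : 1 ≤ p₁
  three_le : 3 ≤ p₂
  ne_zero : g ≠ 0
  hatTimes : IsHatTimes g T W
  isOpen : IsOpen Ωh
  mem : ∀ x ∈ Ωh, x.2 ∈ W
  pair : ∀ x ∈ Ωh, IsTodaPair p₁ p₂ (Q (timeMap T x)) (Qt (timeMap T x))
  diff : ∀ x ∈ Ωh, ∀ n m, DifferentiableAt 𝕜 (fun z => Q z n m) (timeMap T x)
  diff_t : ∀ x ∈ Ωh, ∀ n m, DifferentiableAt 𝕜 (fun z => Qt z n m) (timeMap T x)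
  coupling_t : ∀ x ∈ Ωh, CouplingQt g x.1 (Q (timeMap T x)) (Qt (timeMap T x))
  frac : ∀ x ∈ Ωh, IsFracPower g (leading g x.2) (T x.2) (Q (timeMap T x)) (Qt (timeMap T x))
    (Qh x)

namespace Constrained

variable {g : 𝕜} {T : (Fin p₂ → 𝕜) → (Fin p₂ → 𝕜)} {W : Set (Fin p₂ → 𝕜)}
  {Ωh : Set ((Fin p₁ → 𝕜) × (Fin p₂ → 𝕜))}
  {Q Qt : (Fin p₁ → 𝕜) × (Fin p₂ → 𝕜) → Matrix ℕ ℕ 𝕜}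
  {Qh : (Fin p₁ → 𝕜) × (Fin p₂ → 𝕜) → Matrix ℤ ℤ 𝕜}
  {x : (Fin p₁ → 𝕜) × (Fin p₂ → 𝕜)} {q b : Band ℕ 𝕜}

open Filter Topology

lemma exists_band (h : Constrained g T W Ωh Q Qt Qh) (hx : x ∈ Ωh) :
    ∃ q b : Band ℕ 𝕜, q.val = Q (timeMap T x) ∧ b.val = Qt (timeMap T x) := by
  have h1 : Ord (-p₂) (Q (timeMap T x)) := fun n m hnm =>
    (h.pair x hx).Q_lower n m (by simp only [pos_nat] at hnm; omega)
  have h2 : Ord (-1) (Qt (timeMap T x)) := fun n m hnm =>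
    (h.pair x hx).Qt_lower n m (by simp only [pos_nat] at hnm; omega)
  exact ⟨h1.band, h2.band, rfl, rfl⟩

lemma leading_ne_zero (h : Constrained g T W Ωh Q Qt Qh) (hx : x ∈ Ωh) : leading g x.2 ≠ 0 := by
  have h3 := h.three_le
  obtain ⟨k, rfl⟩ : ∃ k, p₂ = k + 1 := ⟨p₂ - 1, by omega⟩
  exact TwoMatrix.leading_ne_zero (by omega) h.ne_zero (h.hatTimes.ne_zero _ (h.mem x hx))

/-- The generators of the flows in the times `t̂_s`, `s ≤ p₂`. -/
lemma strictLower_frac (h : Constrained g T W Ωh Q Qt Qh) (hx : x ∈ Ωh)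
    (hb : b.val = Qt (timeMap T x)) {s : ℕ} (hs : s ≤ p₂) :
    strictLower (block (lpow (Qh x) s)) = (∑ σ ∈ Finset.Icc 1 p₂,
      gam (p₂ - 1) (leading g x.2) (coupl g (T x.2)) s σ • (b ^ σ).lower).val := by
  have h1 : strictLower (block (lpow (Qh x) s)) = ∑ σ ∈ Finset.range (s + 1),
      gam (p₂ - 1) (leading g x.2) (coupl g (T x.2)) s σ • strictLower (lpow b.val σ) := by
    rw [hb]
    rcases hs.lt_or_eq with hlt | rfl
    · rw [← strictLower_lowerDiag, (h.frac x hx).lower s hlt, strictLower_sum_smul]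
      simp only [strictLower_lowerDiag]
    · exact (h.frac x hx).lower_top
  rw [h1, Band.val_sum]
  simp only [Band.val_smul, Band.val_lower, Band.val_pow]
  rw [Finset.sum_range_succ', lpow, strictLower_one, smul_zero, add_zero]
  have h2 : Finset.Icc 1 p₂ = Finset.Ico 1 (p₂ + 1) := by ext; simp
  rw [h2, Finset.sum_Ico_eq_sum_range]
  refine (Finset.sum_subset (fun i hi => ?_) fun i hi hi' => ?_).trans
    (Finset.sum_congr rfl fun i _ => by rw [add_comm 1 i])
  · rw [Finset.mem_range] at hi ⊢
    omega
  · rw [Finset.mem_range] at hi hi'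
    rw [gam, if_neg (by omega), zero_smul]

/-- The generators of the flows in the times `t_r`. -/
lemma strictLower_frac_mul (h : Constrained g T W Ωh Q Qt Qh) (hx : x ∈ Ωh)
    (hq : q.val = Q (timeMap T x)) (r : ℕ) :
    strictLower (block (lpow (Qh x) (r * (p₂ - 1)))) = (q ^ r).lower.val := by
  have h1 : Ord (-1) (Qh x) := fun n m hnm =>
    (h.frac x hx).jacobi n m (by simp only [pos_int] at hnm; omega)
  have h2 : (h1.band ^ (p₂ - 1)).val = extQ g (T x.2) (Q (timeMap T x)) (Qt (timeMap T x)) := by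
    rw [Band.val_pow, ← (h.frac x hx).root]
    rfl
  -- Powers of the continued Q restrict to powers of Q because its corner from negative to
  -- nonnegative sites is zero.
  have h3 : block (lpow (Qh x) (r * (p₂ - 1))) = lpow (Q (timeMap T x)) r := by
    have := block_pow (h1.band ^ (p₂ - 1)) (by rw [h2]; exact extQ_cornerZero _ _ _ _) r
    rw [h2, block_extQ, ← pow_mul, mul_comm, Band.val_pow] at this
    exact this
  rw [h3, Band.val_lower, Band.val_pow, hq]

/-- The two parts of q^r add up to a matrix that commutes with q. -/
lemma lower_comm (q : Band ℕ 𝕜) (r : ℕ) :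
    (q ^ r).upper * q - q * (q ^ r).upper = q * (q ^ r).lower - (q ^ r).lower * q := by
  have h1 := (q ^ r).upper_add_lower
  have h2 : q ^ r * q = q * q ^ r := ((Commute.refl q).pow_left r).eq
  nth_rewrite 1 2 [← h1] at h2
  rw [add_mul, mul_add] at h2
  rw [sub_eq_sub_iff_add_eq_add, h2]
  abel

lemma lcomm_upper (hq : q.val = Q (timeMap T x)) (r : ℕ) :
    lcomm (upperDiag (lpow (Q (timeMap T x)) r)) (Q (timeMap T x)) =
      (q * (q ^ r).lower - (q ^ r).lower * q).val := by
  rw [← lower_comm, Band.val_comm, Band.val_upper, Band.val_pow, hq]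

/-- The two string equations are equivalent in the presence of the flows of `Q`. -/
lemma string_iff (h : Constrained g T W Ωh Q Qt Qh) (hx : x ∈ Ωh)
    (hq : q.val = Q (timeMap T x)) (hb : b.val = Qt (timeMap T x))
    (ht : ∀ r ∈ Finset.Icc 1 p₁, FlowAt (fun x => Q (timeMap T x)) x (dir 𝕜 p₁ r, 0)
      (q * (q ^ r).lower - (q ^ r).lower * q).val)
    (h1 : FlowAt (fun x => Q (timeMap T x)) x (hatDir 𝕜 p₁ p₂ 1)
      (lcomm (Q (timeMap T x)) (strictLower (block (lpow (Qh x) 1))))) :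
    (1 : Matrix ℕ ℕ 𝕜) = -(g • lcomm (Q (timeMap T x)) (Qt (timeMap T x))) ↔
    ∀ n m, ∑ r ∈ Finset.Icc 1 (p₁ - 1), ((r + 1 : ℕ) : 𝕜) * tm x.1 (r + 1) *
        lineDeriv 𝕜 (fun y => Q (timeMap T y) n m) x (dir 𝕜 p₁ r, 0)
      + ((p₂ : 𝕜) / ((p₂ : 𝕜) - 1)) * tm x.2 p₂ *
        lineDeriv 𝕜 (fun y => Q (timeMap T y) n m) x (hatDir 𝕜 p₁ p₂ 1)
      = -((1 : Matrix ℕ ℕ 𝕜) n m) := by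
  have hg := h.ne_zero
  have h3 := h.three_le
  have hp : 1 ≤ p₁ := h.one_le
  have hl0 := h.leading_ne_zero hx
  have hlow : strictLower (block (lpow (Qh x) 1)) = (leading g x.2 • b.lower).val := by
    rw [h.strictLower_frac hx hb (show 1 ≤ p₂ by omega), Finset.sum_eq_single 1]
    · rw [gam_diag, pow_one, pow_one]
    · intro σ hσ hne
      rw [Finset.mem_Icc] at hσ
      rw [gam, if_neg (by omega), zero_smul]
    · intro hn
      exact absurd (Finset.mem_Icc.2 ⟨le_rfl, by omega⟩) hn
  have hcoef : ((p₂ : 𝕜) / ((p₂ : 𝕜) - 1)) * tm x.2 p₂ = g * (leading g x.2)⁻¹ := by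
    rw [leading, inv_div]
    field_simp
  have hbup : b.upper = ∑ r ∈ Finset.range p₁, coupl g x.1 r • (q ^ r).upper := by
    apply Band.ext
    rw [Band.val_upper, hb, (h.coupling_t x hx).upperDiag_eq hp, Band.val_sum]
    simp [hq]
  set K : Band ℕ 𝕜 := ∑ r ∈ Finset.Icc 1 (p₁ - 1), (((r + 1 : ℕ) : 𝕜) * tm x.1 (r + 1)) •
      (q * (q ^ r).lower - (q ^ r).lower * q) + (g * (leading g x.2)⁻¹) •
      (q * (leading g x.2 • b.lower) - (leading g x.2 • b.lower) * q) with hK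
  -- The t_r terms give g[q, b₍₊₎] by the constraint, its r = 0 term being scalar; the t̂₁ term
  -- gives g[q, b₋], since γ₁₁ cancels.
  have hKeq : K = g • (q * b - b * q) := by
    have e1 : ∑ r ∈ Finset.Icc 1 (p₁ - 1), (((r + 1 : ℕ) : 𝕜) * tm x.1 (r + 1)) •
        (q * (q ^ r).lower - (q ^ r).lower * q) = g • (q * b.upper - b.upper * q) := by
      obtain ⟨l, rfl⟩ : ∃ l, p₁ = l + 1 := ⟨p₁ - 1, by omega⟩
      have e2 : Finset.Icc 1 (l + 1 - 1) = Finset.Ico 1 (l + 1) := by ext; simp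
      have e3 : (1 : Band ℕ 𝕜).upper = 1 := by
        have := (1 : Band ℕ 𝕜).upper_add_lower
        rwa [show (1 : Band ℕ 𝕜).lower = 0 from Band.ext strictLower_one, add_zero] at this
      rw [hbup, Finset.mul_sum, Finset.sum_mul, ← Finset.sum_sub_distrib, Finset.sum_range_succ',
        pow_zero, e3, mul_smul_comm, smul_mul_assoc, mul_one, one_mul, sub_self, add_zero, e2,
        Finset.sum_Ico_eq_sum_range, Finset.smul_sum]
      refine Finset.sum_congr rfl fun i _ => ?_
      rw [add_comm 1 i, ← lower_comm, mul_smul_comm, smul_mul_assoc, ← smul_sub, smul_smul, coupl,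
        ← neg_sub (q * (q ^ (i + 1)).upper), smul_neg, ← neg_smul]
      congr 1
      field_simp
    rw [hK, e1, mul_smul_comm, smul_mul_assoc, ← smul_sub, smul_smul, mul_assoc,
      inv_mul_cancel₀ hl0, mul_one, ← smul_add]
    congr 1
    have e4 : q * b - b * q = q * (b.upper + b.lower) - (b.upper + b.lower) * q := by
      rw [b.upper_add_lower]
    rw [e4]
    noncomm_ring
  have hLHS : ∀ n m, ∑ r ∈ Finset.Icc 1 (p₁ - 1), ((r + 1 : ℕ) : 𝕜) * tm x.1 (r + 1) *
        lineDeriv 𝕜 (fun y => Q (timeMap T y) n m) x (dir 𝕜 p₁ r, 0)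
      + ((p₂ : 𝕜) / ((p₂ : 𝕜) - 1)) * tm x.2 p₂ *
        lineDeriv 𝕜 (fun y => Q (timeMap T y) n m) x (hatDir 𝕜 p₁ p₂ 1) = K.val n m := by
    intro n m
    rw [hK, Band.val_add, Matrix.add_apply, Band.val_sum, Matrix.sum_apply]
    congr 1
    · refine Finset.sum_congr rfl fun r hr => ?_
      rw [Finset.mem_Icc] at hr
      rw [(ht r (Finset.mem_Icc.2 ⟨hr.1, by omega⟩) n m).lineDeriv]
      rfl
    · rw [(h1 n m).lineDeriv, hcoef, hlow, ← hq]
      rfl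
  simp only [hLHS, hKeq]
  constructor
  · intro hs n m
    rw [hs, Band.val_smul, Band.val_comm, hq, hb]
    simp
  · intro hs
    ext n m
    have := hs n m
    rw [Band.val_smul, Band.val_comm, hq, hb] at this
    rw [Matrix.neg_apply, this, neg_neg]

lemma hatDir_of_le {s : ℕ} (hs : s ≤ p₂) : hatDir 𝕜 p₁ p₂ s = (0, dir 𝕜 p₂ s) := if_pos hs

/-- For p₂ ≥ 3 the labels r(p₂ - 1) with r ≥ 2 exceed p₂, so they do not collide with those of the
times t̂_s, s ≤ p₂. -/
lemma hatDir_mul (h3 : 3 ≤ p₂) {r : ℕ} (hr : 2 ≤ r) :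
    hatDir 𝕜 p₁ p₂ (r * (p₂ - 1)) = (dir 𝕜 p₁ r, 0) := by
  have : 2 * (p₂ - 1) ≤ r * (p₂ - 1) := Nat.mul_le_mul_right _ hr
  rw [hatDir, if_neg (by omega), Nat.mul_div_cancel _ (by omega)]

lemma mul_sum_lower (q : Band ℕ 𝕜) (s : Finset ℕ) (c : ℕ → 𝕜) (f : ℕ → Band ℕ 𝕜) :
    q * (∑ σ ∈ s, c σ • f σ) - (∑ σ ∈ s, c σ • f σ) * q =
      ∑ σ ∈ s, c σ • (q * f σ - f σ * q) := by
  rw [Finset.mul_sum, Finset.sum_mul, ← Finset.sum_sub_distrib]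
  exact Finset.sum_congr rfl fun σ _ => by rw [mul_smul_comm, smul_mul_assoc, smul_sub]

/-- The t̂_s flow is the γ-combination of the t̃_σ flows by the chain rule. The first string
equation holds because both flows are generated by Q₋. -/
lemma hatSystem_of_todaSystem (h : Constrained g T W Ωh Q Qt Qh)
    (hT : TodaSystem g (timeMap T '' Ωh) Q Qt) : HatSystem Ωh (fun x => Q (timeMap T x)) Qh := by
  have h3 := h.three_le
  have hp := h.one_le
  have ht : ∀ x ∈ Ωh, ∀ q : Band ℕ 𝕜, q.val = Q (timeMap T x) → ∀ r ∈ Finset.Icc 1 p₁,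
      FlowAt (fun x => Q (timeMap T x)) x (dir 𝕜 p₁ r, 0)
        (q * (q ^ r).lower - (q ^ r).lower * q).val := by
    intro x hx q hq r hr
    have h1 := flowAt_comp_fst h.hatTimes (h.mem x hx) (h.diff x hx) (dir 𝕜 p₁ r)
    rw [(flowAt_iff (h.diff x hx)).1 (hT.flow_Q_t _ (Set.mem_image_of_mem _ hx) r hr),
      lcomm_upper hq] at h1
    exact h1
  have hflow : ∀ x ∈ Ωh, ∀ s : ℕ,
      (s ∈ Finset.Icc 1 p₂ ∨ ∃ r ∈ Finset.Icc 2 p₁, s = r * (p₂ - 1)) →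
      FlowAt (fun x => Q (timeMap T x)) x (hatDir 𝕜 p₁ p₂ s)
        (lcomm (Q (timeMap T x)) (strictLower (block (lpow (Qh x) s)))) := by
    intro x hx s hs
    obtain ⟨q, b, hq, hb⟩ := h.exists_band hx
    rcases hs with hs | ⟨r, hr, rfl⟩
    · have h1 := flowAt_comp_snd h.hatTimes (h.mem x hx) (h.diff x hx) hs
      have hs' := Finset.mem_Icc.1 hs
      rw [hatDir_of_le hs'.2, h.strictLower_frac hx hb hs'.2, ← hq, ← Band.val_comm, mul_sum_lower,
        Band.val_sum]
      convert h1 using 1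
      refine Finset.sum_congr rfl fun σ hσ => ?_
      rw [(flowAt_iff (h.diff x hx)).1 (hT.flow_Q_tt _ (Set.mem_image_of_mem _ hx) σ hσ),
        Band.val_smul, Band.val_comm, Band.val_lower, Band.val_pow, hq, hb]
    · rw [Finset.mem_Icc] at hr
      rw [hatDir_mul h3 hr.1, h.strictLower_frac_mul hx hq, ← hq, ← Band.val_comm]
      exact ht x hx q hq r (Finset.mem_Icc.2 ⟨by omega, hr.2⟩)
  refine ⟨hflow, fun x hx n m => ?_, fun x hx => ?_⟩
  · obtain ⟨q, b, hq, hb⟩ := h.exists_band hx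
    have h1 := ht x hx q hq 1 (Finset.mem_Icc.2 ⟨le_rfl, hp⟩)
    have h2 := hflow x hx (p₂ - 1) (Or.inl (Finset.mem_Icc.2 ⟨by omega, by omega⟩))
    have h4 := h.strictLower_frac_mul hx hq 1
    rw [one_mul] at h4
    rw [h4, ← hq, ← Band.val_comm] at h2
    rw [(h1 n m).lineDeriv, (h2 n m).lineDeriv]
  · obtain ⟨q, b, hq, hb⟩ := h.exists_band hx
    exact (h.string_iff hx hq hb (ht x hx q hq)
      (hflow x hx 1 (Or.inl (Finset.mem_Icc.2 ⟨le_rfl, by omega⟩)))).1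
      (hT.string _ (Set.mem_image_of_mem _ hx))

/-- The flows of Q come from inverting the Jacobian, and (a) from `string_iff`. Only then, with (a)
valid on an open set, does `flow_second` give the flows of Q̃. -/
lemma todaSystem_of_hatSystem (h : Constrained g T W Ωh Q Qt Qh)
    (hH : HatSystem Ωh (fun x => Q (timeMap T x)) Qh) : TodaSystem g (timeMap T '' Ωh) Q Qt := by
  have h3 := h.three_le
  have hp := h.one_le
  have hg := h.ne_zero
  have ht : ∀ x ∈ Ωh, ∀ q : Band ℕ 𝕜, q.val = Q (timeMap T x) → ∀ r ∈ Finset.Icc 1 p₁,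
      FlowAt (fun x => Q (timeMap T x)) x (dir 𝕜 p₁ r, 0)
        (q * (q ^ r).lower - (q ^ r).lower * q).val := by
    intro x hx q hq r hr
    rw [Finset.mem_Icc] at hr
    rcases hr.1.lt_or_eq with hlt | rfl
    · have h1 := hH.flow x hx (r * (p₂ - 1)) (Or.inr ⟨r, Finset.mem_Icc.2 ⟨hlt, hr.2⟩, rfl⟩)
      rw [hatDir_mul h3 hlt, h.strictLower_frac_mul hx hq, ← hq, ← Band.val_comm] at h1
      exact h1
    -- The t₁ flow is not among the hat flows; the first string equation identifies it with the flow
    -- in t̂_{p₂-1}, generated by Q₋.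
    · have h1 := flowAt_comp_fst h.hatTimes (h.mem x hx) (h.diff x hx) (dir 𝕜 p₁ 1)
      have h2 := hH.flow x hx (p₂ - 1) (Or.inl (Finset.mem_Icc.2 ⟨by omega, by omega⟩))
      have h4 := h.strictLower_frac_mul hx hq 1
      rw [one_mul] at h4
      rw [h4, ← hq, ← Band.val_comm] at h2
      have h5 : dMat Q (timeMap T x) (dir 𝕜 p₁ 1, 0) =
          (q * (q ^ 1).lower - (q ^ 1).lower * q).val := by
        ext n m
        rw [← (h1 n m).lineDeriv, hH.string_one x hx n m, (h2 n m).lineDeriv]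
      rwa [h5] at h1
  have hhat : ∀ x ∈ Ωh, ∀ q b : Band ℕ 𝕜, q.val = Q (timeMap T x) → b.val = Qt (timeMap T x) →
      ∀ s ∈ Finset.Icc 1 p₂, ∀ C : Band ℕ 𝕜, C = ∑ σ ∈ Finset.Icc 1 p₂,
        gam (p₂ - 1) (leading g x.2) (coupl g (T x.2)) s σ • (b ^ σ).lower →
      FlowAt (fun x => Q (timeMap T x)) x (0, dir 𝕜 p₂ s) (q * C - C * q).val := by
    intro x hx q b hq hb s hs C hC
    have hs' := Finset.mem_Icc.1 hs
    have h1 := hH.flow x hx s (Or.inl hs)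
    rw [hatDir_of_le hs'.2, h.strictLower_frac hx hb hs'.2, ← hq, ← Band.val_comm, ← hC] at h1
    exact h1
  have hstring : ∀ x ∈ Ωh,
      (1 : Matrix ℕ ℕ 𝕜) = -(g • lcomm (Q (timeMap T x)) (Qt (timeMap T x))) := by
    intro x hx
    obtain ⟨q, b, hq, hb⟩ := h.exists_band hx
    exact (h.string_iff hx hq hb (ht x hx q hq)
      (hH.flow x hx 1 (Or.inl (Finset.mem_Icc.2 ⟨le_rfl, by omega⟩)))).2 (hH.string_M x hx)
  have hsecond : ∀ x ∈ Ωh, ∀ q b C : Band ℕ 𝕜, q.val = Q (timeMap T x) →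
      b.val = Qt (timeMap T x) → IsLower C.val → ∀ v X,
      FlowAt (fun x => Q (timeMap T x)) x v (q * C - C * q).val →
      FlowAt (fun x => Qt (timeMap T x)) x v X →
      X = (b * C - C * b + ∑ r ∈ Finset.range p₁, coupl g v.1 r • q ^ r).val := by
    intro x hx q b C hq hb hC v X hQ hX
    have hev : ∀ᶠ y in 𝓝 x, y ∈ Ωh := h.isOpen.mem_nhds hx
    exact flow_second (A := fun x => Q (timeMap T x)) (B := fun x => Qt (timeMap T x)) hp hg hq hb hC
      (h.pair x hx).Q_one
      (hev.mono fun y hy => (h.pair y hy).Q_upper)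
      (hev.mono fun y hy n m hnm => (h.pair y hy).Qt_lower n m (by
        simp only [pos_nat] at hnm; omega))
      (hev.mono fun y hy => (h.pair y hy).Qt_upper) (hev.mono h.coupling_t) (hev.mono hstring)
      hQ hX
  have hcomm : ∀ x ∈ Ωh, ∀ q b : Band ℕ 𝕜, q.val = Q (timeMap T x) → b.val = Qt (timeMap T x) →
      q * b - b * q = (-g⁻¹) • (1 : Band ℕ 𝕜) := by
    intro x hx q b hq hb
    apply Band.ext
    rw [Band.val_comm, hq, hb, Band.val_smul, Band.val_one, hstring x hx, smul_neg, neg_smul,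
      neg_neg, smul_smul, inv_mul_cancel₀ hg, one_smul]
  constructor
  · rintro _ ⟨x, hx, rfl⟩ r hr
    obtain ⟨q, b, hq, hb⟩ := h.exists_band hx
    rw [flowAt_iff (h.diff x hx), lcomm_upper hq]
    exact (flowAt_comp_fst h.hatTimes (h.mem x hx) (h.diff x hx) (dir 𝕜 p₁ r)).unique
      (ht x hx q hq r hr)
  · rintro _ ⟨x, hx, rfl⟩ s hs
    obtain ⟨q, b, hq, hb⟩ := h.exists_band hx
    rw [flowAt_iff (h.diff x hx)]
    have key := triangular_inj (p := p₂)
      (c := fun s σ => gam (p₂ - 1) (leading g x.2) (coupl g (T x.2)) s σ)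
      (M := fun σ => dMat Q (timeMap T x) (0, dir 𝕜 p₂ σ))
      (N := fun σ => (q * (b ^ σ).lower - (b ^ σ).lower * q).val)
      (fun s σ hsσ => if_neg (by omega))
      (fun s => by
        simp only [gam_diag]
        exact pow_ne_zero _ (h.leading_ne_zero hx))
      (fun s hs => by
        rw [(flowAt_comp_snd h.hatTimes (h.mem x hx) (h.diff x hx) hs).unique
          (hhat x hx q b hq hb s hs _ rfl), mul_sum_lower, Band.val_sum]
        rfl) s hs
    rw [key, Band.val_comm, Band.val_lower, Band.val_pow, hq, hb]
  · rintro _ ⟨x, hx, rfl⟩ r hr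
    obtain ⟨q, b, hq, hb⟩ := h.exists_band hx
    have hr' := Finset.mem_Icc.1 hr
    rw [flowAt_iff (h.diff_t x hx)]
    rw [hsecond x hx q b (q ^ r).lower hq hb (isLower_strictLower _) _ _ (ht x hx q hq r hr)
      (flowAt_comp_fst h.hatTimes (h.mem x hx) (h.diff_t x hx) (dir 𝕜 p₁ r)),
      ← hq, ← hb, ← Band.val_pow, ← Band.val_upper, ← Band.val_comm]
    congr 1
    -- Only t_r varies, which leaves -(r/g) q^{r-1}. By (a) this is [q^r, b], and adding [b, (q^r)₋]
    -- gives [(q^r)₍₊₎, b].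
    have e1 : ∑ r' ∈ Finset.range p₁, coupl g (dir 𝕜 p₁ r) r' • q ^ r' =
        q ^ r * b - b * q ^ r := by
      rw [Band.pow_commutator (hcomm x hx q b hq hb), Finset.sum_eq_single (r - 1)]
      · rw [coupl, tm_dir (by omega) hr'.2, if_pos (by omega), Nat.sub_add_cancel hr'.1]
        congr 1
        field_simp
      · intro r' hr'' hne
        rw [Finset.mem_range] at hr''
        rw [coupl, tm_dir (by omega) hr'.2, if_neg (by omega), mul_zero, zero_smul]
      · intro hn
        rw [Finset.mem_range] at hn
        omega
    rw [e1]
    have := (q ^ r).upper_add_lower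
    nth_rewrite 3 4 [← this]
    noncomm_ring
  · rintro _ ⟨x, hx, rfl⟩ s hs
    obtain ⟨q, b, hq, hb⟩ := h.exists_band hx
    rw [flowAt_iff (h.diff_t x hx)]
    have key := triangular_inj (p := p₂)
      (c := fun s σ => gam (p₂ - 1) (leading g x.2) (coupl g (T x.2)) s σ)
      (M := fun σ => dMat Qt (timeMap T x) (0, dir 𝕜 p₂ σ))
      (N := fun σ => (b * (b ^ σ).lower - (b ^ σ).lower * b).val)
      (fun s σ hsσ => if_neg (by omega))
      (fun s => by
        simp only [gam_diag]
        exact pow_ne_zero _ (h.leading_ne_zero hx))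
      (fun s hs => by
        rw [hsecond x hx q b (∑ σ ∈ Finset.Icc 1 p₂,
            gam (p₂ - 1) (leading g x.2) (coupl g (T x.2)) s σ • (b ^ σ).lower) hq hb
          (by
            rw [Band.val_sum]
            exact IsLower.sum_smul _ _ fun σ _ => isLower_strictLower _)
          (0, dir 𝕜 p₂ s) _ (hhat x hx q b hq hb s hs _ rfl)
          (flowAt_comp_snd h.hatTimes (h.mem x hx) (h.diff_t x hx) hs), mul_sum_lower]
        -- The times t do not vary in this direction, so the constraint contributes no explicit
        -- term.
        have e0 : ∑ r ∈ Finset.range p₁, coupl g (0 : Fin p₁ → 𝕜) r • q ^ r = 0 :=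
          Finset.sum_eq_zero fun r _ => by
            have : tm (0 : Fin p₁ → 𝕜) (r + 1) = 0 := by
              unfold tm
              split_ifs <;> rfl
            rw [coupl, this, mul_zero, zero_smul]
        rw [e0, add_zero, Band.val_sum]
        rfl) s hs
    rw [key, Band.val_comm, Band.val_lower, Band.val_pow, hb]
  · rintro _ ⟨x, hx, rfl⟩
    exact hstring x hx

/-- `Q̃` in terms of `Q` and its fractional power. -/
lemma second_eq (h : Constrained g T W Ωh Q Qt Qh) (hx : x ∈ Ωh) :
    Qt (timeMap T x) = (leading g x.2)⁻¹ • strictLower (block (Qh x)) +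
      ∑ r ∈ Finset.range p₁, coupl g x.1 r • upperDiag (lpow (Q (timeMap T x)) r) := by
  have h3 := h.three_le
  have h1 := (h.frac x hx).lower 1 (by omega)
  have h2 : lpow (Qh x) 1 = Qh x := one_lmul' _
  have h4 : lpow (Qt (timeMap T x)) 1 = Qt (timeMap T x) := one_lmul' _
  rw [Finset.sum_range_succ, Finset.sum_range_one, h2, h4, gam_diag, pow_one] at h1
  have h5 : strictLower (block (Qh x)) = leading g x.2 • strictLower (Qt (timeMap T x)) := by
    rw [← strictLower_lowerDiag, h1]
    ext n m
    by_cases hnm : m < n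
    · simp [strictLower, lowerDiag, lpow, hnm, hnm.le, Matrix.one_apply_ne hnm.ne']
    · simp [strictLower, hnm]
  rw [h5, smul_smul, inv_mul_cancel₀ (h.leading_ne_zero hx), one_smul,
    ← (h.coupling_t x hx).upperDiag_eq h.one_le, add_comm, upperDiag_add_strictLower]

end Constrained

end Systems

end

end TwoMatrix

/-! ### The main theorem. -/

theorem proposition6p2 {𝕜 : Type*} [RCLike 𝕜] (p₁ p₂ : ℕ) (hp₁ : 1 ≤ p₁) (hp₂ : 3 ≤ p₂)
    (g : 𝕜) (hg : g ≠ 0) :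
    -- the change of times exists and is a change of coordinates
    (∃ T : (Fin p₂ → 𝕜) → (Fin p₂ → 𝕜),
      TwoMatrix.IsHatTimes g T {θ | TwoMatrix.tm θ p₂ ≠ 0} ∧
      ∀ (tt : Fin p₂ → 𝕜) (a : 𝕜), a ≠ 0 → a ^ (p₂ - 1) = TwoMatrix.coupl g tt (p₂ - 1) →
        ∃! θ : Fin p₂ → 𝕜, TwoMatrix.tm θ p₂ ≠ 0 ∧ TwoMatrix.leading g θ = a ∧ T θ = tt) ∧
    -- for any such change of times, the two systems are equivalent
    ∀ (T : (Fin p₂ → 𝕜) → (Fin p₂ → 𝕜)) (W : Set (Fin p₂ → 𝕜)), TwoMatrix.IsHatTimes g T W →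
    ∀ (Ωh : Set ((Fin p₁ → 𝕜) × (Fin p₂ → 𝕜))), IsOpen Ωh → (∀ x ∈ Ωh, x.2 ∈ W) →
    ∀ (Q Qt : (Fin p₁ → 𝕜) × (Fin p₂ → 𝕜) → Matrix ℕ ℕ 𝕜),
      (∀ y ∈ TwoMatrix.timeMap T '' Ωh,
        TwoMatrix.IsTodaPair p₁ p₂ (Q y) (Qt y) ∧
        (∀ n m, DifferentiableAt 𝕜 (fun z => Q z n m) y) ∧
        (∀ n m, DifferentiableAt 𝕜 (fun z => Qt z n m) y) ∧
        TwoMatrix.CouplingQ g y.2 (Q y) (Qt y) ∧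
        TwoMatrix.CouplingQt g y.1 (Q y) (Qt y)) →
      ∃ Qh : (Fin p₁ → 𝕜) × (Fin p₂ → 𝕜) → Matrix ℤ ℤ 𝕜,
        (∀ x ∈ Ωh, TwoMatrix.IsFracPower g (TwoMatrix.leading g x.2) (T x.2)
          (Q (TwoMatrix.timeMap T x)) (Qt (TwoMatrix.timeMap T x)) (Qh x)) ∧
        -- `Q̃` is eliminated in favour of `Q`
        (∀ x ∈ Ωh, Qt (TwoMatrix.timeMap T x) =
          (TwoMatrix.leading g x.2)⁻¹ • TwoMatrix.strictLower (TwoMatrix.block (Qh x)) +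
            ∑ r ∈ Finset.range p₁, TwoMatrix.coupl g x.1 r •
              TwoMatrix.upperDiag (TwoMatrix.lpow (Q (TwoMatrix.timeMap T x)) r)) ∧
        (TwoMatrix.TodaSystem g (TwoMatrix.timeMap T '' Ωh) Q Qt ↔
          TwoMatrix.HatSystem Ωh (fun x => Q (TwoMatrix.timeMap T x)) Qh) := by
  constructor
  · obtain ⟨k, rfl⟩ : ∃ k, p₂ = k + 1 := ⟨p₂ - 1, by omega⟩
    have hT := TwoMatrix.isHatTimes_hatTimes (k := k) (by omega) hg
    exact ⟨TwoMatrix.hatTimes k g, hT, fun tt a ha hak => hT.existsUnique (by omega) hg tt ha hak⟩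
  · intro T W hT Ωh hΩ hW Q Qt hyp
    have hlead : ∀ x ∈ Ωh, TwoMatrix.leading g x.2 ≠ 0 := by
      intro x hx
      obtain ⟨k, rfl⟩ : ∃ k, p₂ = k + 1 := ⟨p₂ - 1, by omega⟩
      exact TwoMatrix.leading_ne_zero (by omega) hg (hT.ne_zero _ (hW x hx))
    have hex : ∀ x : (Fin p₁ → 𝕜) × (Fin p₂ → 𝕜), ∃ R : Matrix ℤ ℤ 𝕜, x ∈ Ωh →
        TwoMatrix.IsFracPower g (TwoMatrix.leading g x.2) (T x.2)
          (Q (TwoMatrix.timeMap T x)) (Qt (TwoMatrix.timeMap T x)) R := by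
      intro x
      by_cases hx : x ∈ Ωh
      · obtain ⟨h1, -, -, h2, -⟩ := hyp _ (Set.mem_image_of_mem _ hx)
        obtain ⟨R, hR⟩ := TwoMatrix.exists_isFracPower (by omega) (hlead x hx)
          (hT.normalized _ (hW x hx)) h1.Qt_ne_zero h1.Qt_lower h2
        exact ⟨R.val, fun _ => hR⟩
      -- A dummy value outside the domain, so that a root can be chosen at every point; no
      -- regularity of Q̂ in the times is needed.
      · exact ⟨0, fun h => absurd h hx⟩
    choose Qh hQh using hex
    have hc : TwoMatrix.Constrained g T W Ωh Q Qt Qh :=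
      { one_le := hp₁
        three_le := hp₂
        ne_zero := hg
        hatTimes := hT
        isOpen := hΩ
        mem := hW
        pair := fun x hx => (hyp _ (Set.mem_image_of_mem _ hx)).1
        diff := fun x hx => (hyp _ (Set.mem_image_of_mem _ hx)).2.1
        diff_t := fun x hx => (hyp _ (Set.mem_image_of_mem _ hx)).2.2.1
        coupling_t := fun x hx => (hyp _ (Set.mem_image_of_mem _ hx)).2.2.2.2
        frac := hQh }
    exact ⟨Qh, hQh, fun x hx => hc.second_eq hx, hc.hatSystem_of_todaSystem,
      hc.todaSystem_of_hatSystem⟩
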